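/- There are a deterministic algorithm $A$ and a constant $c$ such that the following holds. An input of $A$, over a field $\mathbb F$, consists of an arithmetic circuit $C$ (gates: field constants, variables, $+$, $\times$) of size $s$ computing a polynomial $f\in\mathbb F[x_1,\dots,x_n]$; the coefficients of linear forms $\ell_1,\dots,\ell_r$ ($r\ge 1$) in $x_1,\dots,x_n$ such that $f\in\mathbb F[\ell_1,\dots,\ell_r]$; the coefficients of nonzero univariate polynomials $p_1(x_1),\dots,p_n(x_n)$ over $\mathbb F$; a point $\alpha\in\mathbb F^n$; and a number $d\ge 1$ with $\deg f\le d$ and $\deg p_i\le d$ for all $i$. Let $I=\langle p_1(x_1),\dots,p_n(x_n)\rangle$. (1) For every field $\mathbb F$ and every such input there is exactly one polynomial $R$ with $f-R\in I$ and $\deg_{x_i}R<\deg p_i$ for all $i$ (the remainder $R=f \bmod I$), and $A$ outputs $R(\alpha)$. If every operation in $\mathbb F$ has cost at most $\tau+1$, then $A$ takes time at most $(\tau+1)\cdot d^{cr}\,(n+s+1)^c$. In particular, if field operations have unit cost and $s\le \mathrm{poly}(n)$, the time is $d^{O(r)}\,\mathrm{poly}(n)$. (2) Over $\mathbb F=\mathbb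 Q$, suppose that all coefficients of the $\ell_j$ and the $p_i$, all coordinates of $\alpha$, and all coefficients of the polynomials computed at the gates of $C$ have bit size at most $L$. Then $A$, with every operation charged the bit sizes of the numbers involved, takes time at most $d^{cr}\,(n+s+L+1)^c$. Here $A$ is one program of a random access machine over fields, the same for all $\mathbb F,n,r,d,s$. It has arrays of natural numbers and of field elements. Operations on natural numbers have logarithmic cost. The operations on field elements are $+,-,\times$, inverse, zero test and copying. -/

import Mathlib

noncomputable section

namespace UnivRem

/-! ### Arithmetic circuits -/

/-- A gate that may only refer to gates of index `< m`: a field constant, an input variable,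
or the sum / the product of two earlier gates. -/
inductive Gate (F : Type*) (n m : ℕ) where
  | const (a : F) : Gate F n m
  | var (i : Fin n) : Gate F n m
  | add (j k : Fin m) : Gate F n m
  | mul (j k : Fin m) : Gate F n m

/-- An arithmetic circuit over `F` in the variables `x_0, …, x_{n-1}`, its gates listed in a
topological order, with a designated output gate. Its size is the number of gates. -/
structure Circuit (F : Type*) (n : ℕ) where
  size : ℕ
  gate : (m : Fin size) → Gate F n m.val
  out : Fin size

/-- The polynomial computed at a gate. -/
def Circuit.gatePoly {F : Type*} [Field F] {n : ℕ} (C : Circuit F n) (m : Fin C.size) :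
    MvPolynomial (Fin n) F :=
  match C.gate m with
  | .const a => MvPolynomial.C a
  | .var i => MvPolynomial.X i
  | .add j k => C.gatePoly ⟨j.val, j.isLt.trans m.isLt⟩ + C.gatePoly ⟨k.val, k.isLt.trans m.isLt⟩
  | .mul j k => C.gatePoly ⟨j.val, j.isLt.trans m.isLt⟩ * C.gatePoly ⟨k.val, k.isLt.trans m.isLt⟩
termination_by m.val
decreasing_by all_goals simp

/-- The polynomial computed by the circuit. -/
def Circuit.poly {F : Type*} [Field F] {n : ℕ} (C : Circuit F n) : MvPolynomial (Fin n) F :=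
  C.gatePoly C.out

/-! ### Univariate ideals and remainders -/

/-- The linear form `∑ i, a i * x_i`. -/
def linForm {F : Type*} [Field F] {n : ℕ} (a : Fin n → F) : MvPolynomial (Fin n) F :=
  ∑ i, MvPolynomial.C (a i) * MvPolynomial.X i

/-- The univariate ideal `⟨p_0(x_0), …, p_{n-1}(x_{n-1})⟩`. -/
def univIdeal {F : Type*} [Field F] {n : ℕ} (p : Fin n → Polynomial F) :
    Ideal (MvPolynomial (Fin n) F) :=
  Ideal.span (Set.range fun i => Polynomial.aeval (MvPolynomial.X i) (p i))

/-- `R` is a remainder of `f` modulo the univariate ideal: `f - R ∈ I`, and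
`deg_{x_i} R < deg p_i` for all `i` (every monomial of `R` has exponent `< deg p_i` at `x_i`;
so `R = 0` is the only candidate when some `p_i` is a nonzero constant). -/
def IsRemainder {F : Type*} [Field F] {n : ℕ} (p : Fin n → Polynomial F)
    (f R : MvPolynomial (Fin n) F) : Prop :=
  f - R ∈ univIdeal p ∧ ∀ i, ∀ m ∈ R.support, m i < (p i).natDegree

/-! ### A random access machine over a field

A program works on finitely many unbounded arrays of natural numbers and of field elements
(named by literals, with computed indices). It is finite and does not mention the field.
Control flow is sequencing, zero tests and loops whose number of rounds is fixed on entry, so a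
program is deterministic and always halts. -/

/-- Memory: `nat a i` / `fld a i` is the cell of index `i` of the `a`-th array. -/
structure Store (F : Type*) where
  nat : ℕ → ℕ → ℕ
  fld : ℕ → ℕ → F

/-- Natural number expressions (truncated subtraction, floor division). -/
inductive NExpr where
  | lit (k : ℕ) : NExpr
  | get (a : ℕ) (i : NExpr) : NExpr
  | add (x y : NExpr) : NExpr
  | sub (x y : NExpr) : NExpr
  | mul (x y : NExpr) : NExpr
  | div (x y : NExpr) : NExpr
  | mod (x y : NExpr) : NExpr

/-- Field expressions; the only constants are `0` and `1`. -/
inductive FExpr where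
  | zero : FExpr
  | one : FExpr
  | get (a : ℕ) (i : NExpr) : FExpr
  | add (x y : FExpr) : FExpr
  | sub (x y : FExpr) : FExpr
  | mul (x y : FExpr) : FExpr
  | inv (x : FExpr) : FExpr

/-- Programs. -/
inductive Prog where
  | skip : Prog
  | setN (a : ℕ) (i e : NExpr) : Prog
  | setF (a : ℕ) (i : NExpr) (e : FExpr) : Prog
  | seq (P Q : Prog) : Prog
  | ifZeroN (e : NExpr) (P Q : Prog) : Prog
  | ifZeroF (e : FExpr) (P Q : Prog) : Prog
  | loop (e : NExpr) (P : Prog) : Prog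

def NExpr.val {F : Type*} (σ : Store F) : NExpr → ℕ
  | .lit k => k
  | .get a i => σ.nat a (i.val σ)
  | .add x y => x.val σ + y.val σ
  | .sub x y => x.val σ - y.val σ
  | .mul x y => x.val σ * y.val σ
  | .div x y => x.val σ / y.val σ
  | .mod x y => x.val σ % y.val σ

def FExpr.val {F : Type*} [Field F] (σ : Store F) : FExpr → F
  | .zero => 0
  | .one => 1
  | .get a i => σ.fld a (i.val σ)
  | .add x y => x.val σ + y.val σ
  | .sub x y => x.val σ - y.val σ
  | .mul x y => x.val σ * y.val σ
  | .inv x => (x.val σ)⁻¹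

/-- Logarithmic cost: evaluating a node costs one plus the bit length of its value, on top of
the cost of its operands (of the index, for a memory access). -/
def NExpr.cost {F : Type*} (σ : Store F) : NExpr → ℕ
  | .lit k => 1 + k.size
  | .get a i => i.cost σ + 1 + (NExpr.val σ (.get a i)).size
  | .add x y => x.cost σ + y.cost σ + 1 + (NExpr.val σ (.add x y)).size
  | .sub x y => x.cost σ + y.cost σ + 1 + (NExpr.val σ (.sub x y)).size
  | .mul x y => x.cost σ + y.cost σ + 1 + (NExpr.val σ (.mul x y)).size
  | .div x y => x.cost σ + y.cost σ + 1 + (NExpr.val σ (.div x y)).size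
  | .mod x y => x.cost σ + y.cost σ + 1 + (NExpr.val σ (.mod x y)).size

/-- Cost of a field expression: every node costs one plus the weight `w` of its value, on top of
the cost of its operands. -/
def FExpr.cost {F : Type*} [Field F] (w : F → ℕ) (σ : Store F) : FExpr → ℕ
  | .zero => 1 + w 0
  | .one => 1 + w 1
  | .get a i => i.cost σ + 1 + w (FExpr.val σ (.get a i))
  | .add x y => x.cost w σ + y.cost w σ + 1 + w (FExpr.val σ (.add x y))
  | .sub x y => x.cost w σ + y.cost w σ + 1 + w (FExpr.val σ (.sub x y))
  | .mul x y => x.cost w σ + y.cost w σ + 1 + w (FExpr.val σ (.mul x y))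
  | .inv x => x.cost w σ + 1 + w (FExpr.val σ (.inv x))

def Store.setN {F : Type*} (σ : Store F) (a i v : ℕ) : Store F :=
  { σ with nat := Function.update σ.nat a (Function.update (σ.nat a) i v) }

def Store.setF {F : Type*} (σ : Store F) (a i : ℕ) (v : F) : Store F :=
  { σ with fld := Function.update σ.fld a (Function.update (σ.fld a) i v) }

open Classical in
/-- The memory after running a program. `loop e P` runs `P` as many times as the value of `e`
on entry. -/
def Prog.exec {F : Type*} [Field F] : Prog → Store F → Store F
  | .skip, σ => σ
  | .setN a i e, σ => σ.setN a (i.val σ) (e.val σ)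
  | .setF a i e, σ => σ.setF a (i.val σ) (e.val σ)
  | .seq P Q, σ => Q.exec (P.exec σ)
  | .ifZeroN e P Q, σ => if e.val σ = 0 then P.exec σ else Q.exec σ
  | .ifZeroF e P Q, σ => if e.val σ = 0 then P.exec σ else Q.exec σ
  | .loop e P, σ => (fun τ => P.exec τ)^[e.val σ] σ

open Classical in
/-- The running time of a program, for a weight `w` on the field elements. -/
def Prog.cost {F : Type*} [Field F] (w : F → ℕ) : Prog → Store F → ℕ
  | .skip, _ => 1
  | .setN _ i e, σ => i.cost σ + e.cost σ + 1
  | .setF _ i e, σ => i.cost σ + e.cost w σ + 1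
  | .seq P Q, σ => P.cost w σ + Q.cost w (P.exec σ) + 1
  | .ifZeroN e P Q, σ => e.cost σ + (if e.val σ = 0 then P.cost w σ else Q.cost w σ) + 1
  | .ifZeroF e P Q, σ => e.cost w σ + (if e.val σ = 0 then P.cost w σ else Q.cost w σ) + 1
  | .loop e P, σ =>
      e.cost σ + (∑ k ∈ Finset.range (e.val σ), (P.cost w ((fun τ => P.exec τ)^[k] σ) + 1)) + 1

/-- Bit size of a rational number in lowest terms. -/
def ratSize (q : ℚ) : ℕ := q.num.natAbs.size + q.den.size

/-! ### The computational problem -/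

/-- The data of an input: a circuit, `r` linear forms (by coefficients), the generators of a
univariate ideal, a point, and a degree bound. -/
structure Input (F : Type*) [Field F] where
  n : ℕ
  r : ℕ
  d : ℕ
  circuit : Circuit F n
  form : Fin r → Fin n → F
  p : Fin n → Polynomial F
  pt : Fin n → F

/-- The promise on an input: the circuit computes a polynomial in `F[ℓ_1, …, ℓ_r]`, the
generators are nonzero, and `d` bounds all degrees. -/
structure Input.Valid {F : Type*} [Field F] (I : Input F) : Prop where
  one_le_r : 1 ≤ I.r
  one_le_d : 1 ≤ I.d
  mem_adjoin : I.circuit.poly ∈ Algebra.adjoin F (Set.range fun j => linForm (I.form j))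
  totalDegree_le : I.circuit.poly.totalDegree ≤ I.d
  p_ne_zero : ∀ i, I.p i ≠ 0
  natDegree_le : ∀ i, (I.p i).natDegree ≤ I.d

/-- Over `ℚ`: all coefficients in the input, and all coefficients of the polynomials computed at
the gates of the circuit, have bit size at most `L`. -/
structure Input.BitsLE (I : Input ℚ) (L : ℕ) : Prop where
  gate : ∀ m e, ratSize ((I.circuit.gatePoly m).coeff e) ≤ L
  form : ∀ j i, ratSize (I.form j i) ≤ L
  p : ∀ i k, ratSize ((I.p i).coeff k) ≤ L
  pt : ∀ i, ratSize (I.pt i) ≤ L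

def Gate.code {F : Type*} {n m : ℕ} : Gate F n m → ℕ
  | .const _ => 0
  | .var _ => 1
  | .add _ _ => 2
  | .mul _ _ => 3

def Gate.fst {F : Type*} {n m : ℕ} : Gate F n m → ℕ
  | .const _ => 0
  | .var i => i
  | .add j _ => j
  | .mul j _ => j

def Gate.snd {F : Type*} {n m : ℕ} : Gate F n m → ℕ
  | .const _ => 0
  | .var _ => 0
  | .add _ k => k
  | .mul _ k => k

def Gate.scalar {F : Type*} [Field F] {n m : ℕ} : Gate F n m → F
  | .const a => a
  | _ => 0

/-- The initial memory. Number arrays: `0` holds `n, r, d`, the circuit size and the index of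
the output gate; `1`, `2`, `3` hold the type and the two arguments of each gate. Field arrays:
`0` holds the constants at the gates; `1` the coefficient of `x_i` in `ℓ_j` at `n * j + i`; `2` the
coefficient of `x_i ^ k`, `k ≤ d`, in `p_i` at `(d + 1) * i + k`; `3` the point. All other cells
are zero. -/
def Input.store {F : Type*} [Field F] (I : Input F) : Store F where
  nat := fun a i =>
    match a with
    | 0 => [I.n, I.r, I.d, I.circuit.size, I.circuit.out.val].getD i 0
    | 1 => if h : i < I.circuit.size then (I.circuit.gate ⟨i, h⟩).code else 0
    | 2 => if h : i < I.circuit.size then (I.circuit.gate ⟨i, h⟩).fst else 0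
    | 3 => if h : i < I.circuit.size then (I.circuit.gate ⟨i, h⟩).snd else 0
    | _ => 0
  fld := fun a i =>
    match a with
    | 0 => if h : i < I.circuit.size then (I.circuit.gate ⟨i, h⟩).scalar else 0
    | 1 => if h : i < I.r * I.n then
        I.form (finProdFinEquiv.symm ⟨i, h⟩).1 (finProdFinEquiv.symm ⟨i, h⟩).2 else 0
    | 2 => if h : i < I.n * (I.d + 1) then
        (I.p (finProdFinEquiv.symm ⟨i, h⟩).1).coeff (finProdFinEquiv.symm ⟨i, h⟩).2.val else 0
    | 3 => if h : i < I.n then I.pt ⟨i, h⟩ else 0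
    | _ => 0

/-- The result of a program on an input: the first cell of field array `4` at the end. -/
def Input.output {F : Type*} [Field F] (I : Input F) (P : Prog) : F :=
  (P.exec I.store).fld 4 0

/-- The polynomial of the input has exactly one remainder modulo its univariate ideal, and the
program outputs the value of that remainder at the given point. -/
def Input.Solves {F : Type*} [Field F] (I : Input F) (P : Prog) : Prop :=
  ∃ R : MvPolynomial (Fin I.n) F, IsRemainder I.p I.circuit.poly R ∧
    (∀ R', IsRemainder I.p I.circuit.poly R' → R' = R) ∧
    I.output P = MvPolynomial.eval I.pt R

end UnivRem

end

/-! Replacing every monomial `x^e` by the product of the remainders `x_i^(e_i) mod p_i` extends to a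
linear map `normal`. It kills the ideal, fixes polynomials whose exponents are already small, and
changes a polynomial only by an element of the ideal (`normal_eq_zero`, `normal_eq_self`,
`sub_normal_mem`). Hence it gives the unique remainder. The wanted value is the image of `f` under
the functional `x^e ↦ ∏ h_i(e_i)`, where `h_i(k)` is the value at `α_i` of `x_i^k mod p_i`
(`powVal`). Each `h_i` obeys a linear recurrence with the coefficients of `p_i`.

To write `f = g(ℓ_1, …, ℓ_r)` explicitly, the forms are brought to reduced row echelon form. Sending
the pivot variable of row `j` to `y_j` and all other variables to `0` sends row `j` to `y_j`, hence
sends `f` to a suitable `g` (`formSubst_pivSubst`). The circuit is evaluated under this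
substitution, keeping only exponents at most `d` in each `y_j`: that is `(d+1)^r` coefficients,
addressed by the base `d+1` code of the exponent vector. As pivots are distinct, each coefficient
met is zero or a coefficient of the polynomial at the same gate (`coeff_pivSubst`), so the promise
on the gates bounds its size.

The functional is applied to the products `∏ ℓ_j^(m_j)` by adding the variables `x_i` one at a time.
The binomial theorem gives a linear recursion of length `n` and width `(d+1)^r` (`phiVal_rec`).
Pairing its last row with the coefficients of `g` gives the answer (`Input.sum_gateCoeff`).

Both cost models are handled through an abstract height. If all numbers stay below `M` and all
heights below `W`, the cost is at most `M^e * W` with `e` depending only on the program text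
(`Prog.cost_le`), so it remains to bound what is stored. Subadditivity of the height would lose a
factor per step of a recursion, which is exponential in `n`. The field `rec_le` gives linear growth
in `n` instead, and for rationals it holds by common denominators (`rat_rec_common_den`).
Elimination uses subadditivity only and loses `4^r`, which is affordable.

For `d = 1` the allowed time does not depend on `r`, so `2^r` coefficients are too many. Then `f` is
affine, and its linear part serves as the only form. -/

noncomputable section

namespace UnivRem

universe u

set_option linter.unusedSectionVars false

/-! ### Heights -/

/-- A height on a field: subadditive under all operations, with linear recursions of length `n`
and width `K` increasing it only polynomially in `n` and `K`. -/
structure Height {F : Type u} [Field F] (ht : F → ℕ) : Prop where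
  pos : ∀ a, 1 ≤ ht a
  zero_le : ∀ a, ht 0 ≤ ht a
  one_le : ∀ a, ht 1 ≤ ht a
  add_le : ∀ a b, ht (a + b) ≤ ht a + ht b
  sub_le : ∀ a b, ht (a - b) ≤ ht a + ht b
  mul_le : ∀ a b, ht (a * b) ≤ ht a + ht b
  inv_le : ∀ a, ht a⁻¹ ≤ ht a
  rec_le : ∀ (n K X : ℕ) (Φ : ℕ → ℕ → F) (u : ℕ → ℕ → ℕ → F) (g : ℕ → ℕ → ℕ),
    (∀ m < K, ∀ k < K, g m k < K) → (∀ m < K, ht (Φ 0 m) ≤ X) →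
    (∀ i < n, ∀ m < K, ∀ k < K, ht (u i m k) ≤ X) →
    (∀ i < n, ∀ m < K, Φ (i + 1) m = ∑ k ∈ Finset.range K, u i m k * Φ i (g m k)) →
    ∀ i ≤ n, ∀ m < K, ht (Φ i m) ≤ 10 * (n + 1) * (K + 1) ^ 2 * X

namespace Height

variable {F : Type u} [Field F] {ht : F → ℕ}

theorem sum_le (h : Height ht) {X : ℕ} (t : ℕ → F) (N : ℕ)
    (ht1 : ∀ k < N, ht (t k) ≤ X) (h0 : ht 0 ≤ X) :
    ht (∑ k ∈ Finset.range N, t k) ≤ (N + 1) * X := by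
  induction N with
  | zero => simpa using h0
  | succ N ih =>
    rw [Finset.sum_range_succ]
    have := h.add_le (∑ k ∈ Finset.range N, t k) (t N)
    have h1 := ih fun k hk => ht1 k (by omega)
    have h2 := ht1 N (by omega)
    nlinarith

theorem prod_le (h : Height ht) {X : ℕ} (t : ℕ → F) (N : ℕ)
    (ht1 : ∀ k < N, ht (t k) ≤ X) (h0 : ht 0 ≤ X) :
    ht (∏ k ∈ Finset.range N, t k) ≤ (N + 1) * X := by
  induction N with
  | zero => simpa using (h.one_le 0).trans h0
  | succ N ih =>
    rw [Finset.prod_range_succ]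
    have := h.mul_le (∏ k ∈ Finset.range N, t k) (t N)
    have h1 := ih fun k hk => ht1 k (by omega)
    have h2 := ht1 N (by omega)
    nlinarith

theorem pow_le (h : Height ht) (a : F) (k : ℕ) : ht (a ^ k) ≤ (k + 1) * ht a := by
  have := h.prod_le (fun _ => a) k (fun _ _ => le_rfl) (h.zero_le a)
  simpa using this

/-- The constant height. -/
theorem const (F : Type u) [Field F] (τ : ℕ) : Height fun _ : F => τ + 1 where
  pos _ := by simp
  zero_le _ := le_rfl
  one_le _ := le_rfl
  add_le _ _ := by simp
  sub_le _ _ := by simp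
  mul_le _ _ := by simp
  inv_le _ := le_rfl
  rec_le n K X Φ u g _ h0 _ _ i _ m hm := by
    have := h0 m hm
    have : 1 ≤ 10 * (n + 1) * (K + 1) ^ 2 := Nat.one_le_iff_ne_zero.2 (by positivity)
    nlinarith

end Height

/-! ### Running times from bounds on the memory -/

/-- An exponent bounding the value and the cost of an expression in terms of the memory. -/
def NExpr.expo : NExpr → ℕ
  | .lit k => k + 1
  | .get _ i => i.expo + 3
  | .add x y | .sub x y | .mul x y | .div x y | .mod x y => x.expo + y.expo + 3

def FExpr.expo : FExpr → ℕ
  | .zero | .one => 3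
  | .get _ i => i.expo + 3
  | .add x y | .sub x y | .mul x y => x.expo + y.expo + 3
  | .inv x => x.expo + 3

def Prog.expo : Prog → ℕ
  | .skip => 0
  | .setN _ i e => i.expo + e.expo + 3
  | .setF _ i e => i.expo + e.expo + 3
  | .seq P Q => P.expo + Q.expo + 3
  | .ifZeroN e P Q => e.expo + P.expo + Q.expo + 3
  | .ifZeroF e P Q => e.expo + P.expo + Q.expo + 3
  | .loop e P => e.expo + P.expo + 3

section

variable {F : Type u} [Field F]

/-- All numbers in the memory are at most `M`, all field elements have height at most `W`. -/
structure Store.Bdd (ht : F → ℕ) (M W : ℕ) (σ : Store F) : Prop where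
  nat : ∀ a i, σ.nat a i ≤ M
  fld : ∀ a i, ht (σ.fld a i) ≤ W

open Classical in
/-- Along the execution, all assigned numbers are at most `M` and all assigned field elements have
height at most `W`. -/
def Prog.Safe (ht : F → ℕ) (M W : ℕ) : Prog → Store F → Prop
  | .skip, _ => True
  | .setN _ _ e, σ => e.val σ ≤ M
  | .setF _ _ e, σ => ht (e.val σ) ≤ W
  | .seq P Q, σ => P.Safe ht M W σ ∧ Q.Safe ht M W (P.exec σ)
  | .ifZeroN e P Q, σ => if e.val σ = 0 then P.Safe ht M W σ else Q.Safe ht M W σ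
  | .ifZeroF e P Q, σ => if e.val σ = 0 then P.Safe ht M W σ else Q.Safe ht M W σ
  | .loop e P, σ => ∀ k < e.val σ, P.Safe ht M W ((fun τ => P.exec τ)^[k] σ)

theorem size_le_self (n : ℕ) : n.size ≤ n := Nat.size_le.2 Nat.lt_two_pow_self

/-- The left side is at most seven copies of `M^(x+y) * k`, and `7 ≤ 2^3 ≤ M^3`. This is why each
compound node adds `3` in `expo`. -/
theorem pow_combine {M x y a b c k : ℕ} (hM : 2 ≤ M) (ha : a ≤ M ^ x * k) (hb : b ≤ M ^ y * k)
    (hk : 1 ≤ k) (hc : c ≤ 4 * (M ^ (x + y) * k)) : a + b + 1 + c ≤ M ^ (x + y + 3) * k := by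
  have hx : 1 ≤ M ^ x := Nat.one_le_pow _ _ (by omega)
  have hy : 1 ≤ M ^ y := Nat.one_le_pow _ _ (by omega)
  have h8 : 2 ^ 3 ≤ M ^ 3 := Nat.pow_le_pow_left hM 3
  have e : M ^ (x + y + 3) * k = M ^ 3 * (M ^ x * M ^ y * k) := by ring
  rw [pow_add] at hc
  have h1 : M ^ x * k ≤ M ^ x * M ^ y * k := by gcongr; nlinarith
  have h2 : M ^ y * k ≤ M ^ x * M ^ y * k := by gcongr; nlinarith
  have h3 : 1 ≤ M ^ x * M ^ y * k := by nlinarith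
  rw [e]
  generalize M ^ x * M ^ y * k = Z at *
  nlinarith

theorem NExpr.val_cost_le (e : NExpr) (σ : Store F) {M : ℕ} (hM : 2 ≤ M)
    (h : ∀ a i, σ.nat a i ≤ M) : e.val σ ≤ M ^ e.expo ∧ e.cost σ ≤ M ^ e.expo := by
  have one (x : ℕ) : 1 ≤ M ^ x := Nat.one_le_pow _ _ (by omega)
  have bin (x y a b v : ℕ) (ha : a ≤ M ^ x) (hb : b ≤ M ^ y) (hv : v ≤ 4 * M ^ (x + y)) :
      v ≤ M ^ (x + y + 3) ∧ a + b + 1 + v.size ≤ M ^ (x + y + 3) := by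
    have := pow_combine (c := v) (k := 1) hM (by simpa using ha) (by simpa using hb) le_rfl
      (by simpa using hv)
    have := size_le_self v
    constructor <;> omega
  have pr (x y : ℕ) : M ^ x ≤ M ^ (x + y) ∧ M ^ y ≤ M ^ (x + y) :=
    ⟨Nat.pow_le_pow_right (by omega) (by omega), Nat.pow_le_pow_right (by omega) (by omega)⟩
  induction e with
  | lit k =>
    have h1 : k < 2 ^ k := Nat.lt_two_pow_self
    have h2 : 2 ^ k ≤ M ^ k := Nat.pow_le_pow_left hM k
    have h3 : M ^ k ≤ M ^ (k + 1) := Nat.pow_le_pow_right (by omega) (by omega)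
    have h4 := size_le_self k
    simp only [NExpr.val, NExpr.cost, NExpr.expo]
    constructor <;> omega
  | get a i ih =>
    obtain ⟨-, ih⟩ := ih
    have h1 := h a (i.val σ)
    have h2 : M ^ 1 ≤ M ^ (i.expo + 1) := Nat.pow_le_pow_right (by omega) (by omega)
    have h3 : M ^ (i.expo + 1) * 2 ≤ M ^ (i.expo + 1) * M := by gcongr
    have h4 : M ^ (i.expo + 1) * M * 2 ≤ M ^ (i.expo + 1) * M * M := by gcongr
    have h5 : M ^ (i.expo + 3) = M ^ (i.expo + 1) * M * M := by ring
    have h6 : M ^ i.expo ≤ M ^ (i.expo + 1) := Nat.pow_le_pow_right (by omega) (by omega)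
    have h7 := size_le_self (σ.nat a (i.val σ))
    have h8 := one i.expo
    rw [pow_one] at h2
    simp only [NExpr.val, NExpr.cost, NExpr.expo]
    constructor <;> omega
  | add x y ihx ihy =>
    exact bin _ _ _ _ _ ihx.2 ihy.2 (by have := pr x.expo y.expo; simp only [NExpr.val]; omega)
  | sub x y ihx ihy =>
    exact bin _ _ _ _ _ ihx.2 ihy.2 (by have := pr x.expo y.expo; simp only [NExpr.val]; omega)
  | mul x y ihx ihy =>
    refine bin _ _ _ _ _ ihx.2 ihy.2 ?_
    have := Nat.mul_le_mul ihx.1 ihy.1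
    rw [← pow_add] at this
    simp only [NExpr.val]; omega
  | div x y ihx ihy =>
    refine bin _ _ _ _ _ ihx.2 ihy.2 ?_
    have := pr x.expo y.expo
    have := Nat.div_le_self (x.val σ) (y.val σ)
    simp only [NExpr.val]; omega
  | mod x y ihx ihy =>
    refine bin _ _ _ _ _ ihx.2 ihy.2 ?_
    have := pr x.expo y.expo
    have := Nat.mod_le (x.val σ) (y.val σ)
    simp only [NExpr.val]; omega

variable {ht w : F → ℕ}

/-- Heights add up along the expression, so `W` enters only to the first power; the size of the
expression and the computation of indices are paid by the power of `M`. The factor `2` in `hw`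
leaves room for a bit size that counts numerator and denominator. -/
theorem FExpr.val_cost_le (hht : Height ht) (hw : ∀ a, w a ≤ 2 * ht a) (e : FExpr) (σ : Store F)
    {M W : ℕ} (hM : 2 ≤ M) (h : σ.Bdd ht M W) :
    ht (e.val σ) ≤ M ^ e.expo * W ∧ e.cost w σ ≤ M ^ e.expo * W := by
  have hW : 1 ≤ W := (hht.pos _).trans (h.fld 0 0)
  have bin (x y a b : ℕ) (v v₁ v₂ : F) (ha : a ≤ M ^ x * W) (hb : b ≤ M ^ y * W)
      (hv : ht v ≤ ht v₁ + ht v₂) (h1 : ht v₁ ≤ M ^ x * W) (h2 : ht v₂ ≤ M ^ y * W) :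
      ht v ≤ M ^ (x + y + 3) * W ∧ a + b + 1 + w v ≤ M ^ (x + y + 3) * W := by
    have p1 : M ^ x * W ≤ M ^ (x + y) * W := by gcongr <;> omega
    have p2 : M ^ y * W ≤ M ^ (x + y) * W := by gcongr <;> omega
    have := hw v
    have q1 := pow_combine (c := w v) (k := W) hM ha hb hW (by omega)
    have q2 := pow_combine (c := ht v) (k := W) hM ha hb hW (by omega)
    constructor <;> omega
  have cst (v : F) (hv : ∀ a, ht v ≤ ht a) : ht v ≤ M ^ 3 * W ∧ 1 + w v ≤ M ^ 3 * W := by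
    have h8 : 2 ^ 3 ≤ M ^ 3 := Nat.pow_le_pow_left hM 3
    have := (hv _).trans (h.fld 0 0)
    have := hw v
    constructor <;> nlinarith
  induction e with
  | zero => exact cst 0 hht.zero_le
  | one => exact cst 1 hht.one_le
  | get a i =>
    have h1 := (i.val_cost_le σ hM h.nat).2
    have h2 := h.fld a (i.val σ)
    have := hw (σ.fld a (i.val σ))
    -- Taking weight plus height for `c` serves both conclusions at once; by `hw` it is at most `3 *
    -- W`.
    have q := pow_combine (x := i.expo) (y := 0) (a := i.cost σ) (b := 0)
      (c := w (σ.fld a (i.val σ)) + ht (σ.fld a (i.val σ))) (k := W) hM (by nlinarith) (by simp) hW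
      (by have : 1 ≤ M ^ i.expo := Nat.one_le_pow _ _ (by omega)
          have : W ≤ M ^ (i.expo + 0) * W := by simp only [add_zero]; nlinarith
          omega)
    simp only [FExpr.val, FExpr.cost, FExpr.expo]
    simp only [add_zero] at q
    constructor <;> omega
  | add x y ihx ihy => exact bin _ _ _ _ _ _ _ ihx.2 ihy.2 (hht.add_le _ _) ihx.1 ihy.1
  | sub x y ihx ihy => exact bin _ _ _ _ _ _ _ ihx.2 ihy.2 (hht.sub_le _ _) ihx.1 ihy.1
  | mul x y ihx ihy => exact bin _ _ _ _ _ _ _ ihx.2 ihy.2 (hht.mul_le _ _) ihx.1 ihy.1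
  | inv x ihx =>
    have := bin x.expo 0 _ 0 _ _ 0 ihx.2 (by simp)
      ((hht.inv_le (x.val σ)).trans (Nat.le_add_right _ (ht 0))) ihx.1
      (by simpa using (hht.zero_le _).trans (h.fld 0 0))
    simpa only [FExpr.val, FExpr.cost, FExpr.expo, add_zero] using this

theorem Store.Bdd.setN {M W : ℕ} {σ : Store F} (h : σ.Bdd ht M W) (a i : ℕ) {v : ℕ}
    (hv : v ≤ M) : (σ.setN a i v).Bdd ht M W where
  nat b j := by
    simp only [Store.setN, Function.update_apply]
    split_ifs with h1
    · rw [Function.update_apply]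
      split_ifs
      exacts [hv, h.nat a j]
    · exact h.nat b j
  fld := h.fld

theorem Store.Bdd.setF {M W : ℕ} {σ : Store F} (h : σ.Bdd ht M W) (a i : ℕ) {v : F}
    (hv : ht v ≤ W) : (σ.setF a i v).Bdd ht M W where
  fld b j := by
    simp only [Store.setF, Function.update_apply]
    split_ifs with h1
    · rw [Function.update_apply]
      split_ifs
      exacts [hv, h.fld a j]
    · exact h.fld b j
  nat := h.nat

theorem Prog.Safe.bdd {M W : ℕ} (P : Prog) {σ : Store F} (hs : P.Safe ht M W σ)
    (h : σ.Bdd ht M W) : (P.exec σ).Bdd ht M W := by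
  induction P generalizing σ with
  | skip => exact h
  | setN a i e => exact h.setN _ _ hs
  | setF a i e => exact h.setF _ _ hs
  | seq P Q ihP ihQ => exact ihQ hs.2 (ihP hs.1 h)
  | ifZeroN e P Q ihP ihQ =>
    simp only [Prog.Safe, Prog.exec] at *
    split_ifs at * with hc
    · exact ihP hs h
    · exact ihQ hs h
  | ifZeroF e P Q ihP ihQ =>
    simp only [Prog.Safe, Prog.exec] at *
    split_ifs at * with hc
    · exact ihP hs h
    · exact ihQ hs h
  | loop e P ih =>
    simp only [Prog.Safe, Prog.exec] at *
    generalize e.val σ = N at hs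
    induction N with
    | zero => exact h
    | succ N ihN =>
      rw [Function.iterate_succ_apply']
      exact ih (hs N (by omega)) (ihN fun k hk => hs k (by omega))

-- The same `M` and `W` bound the memory before every round of a loop, so a loop multiplies the
-- bound for its body by the number of rounds, which is itself a power of `M`. The exponent is
-- therefore read off the syntax.
open Classical in
theorem Prog.cost_le (hht : Height ht) (hw : ∀ a, w a ≤ 2 * ht a) (P : Prog) (σ : Store F)
    {M W : ℕ} (hM : 2 ≤ M) (hs : P.Safe ht M W σ) (h : σ.Bdd ht M W) :
    P.cost w σ ≤ M ^ P.expo * W := by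
  have hW : 1 ≤ W := (hht.pos _).trans (h.fld 0 0)
  have toW {a x : ℕ} (ha : a ≤ M ^ x) : a ≤ M ^ x * W := ha.trans (Nat.le_mul_of_pos_right _ hW)
  have three (e p q a b c : ℕ) (ha : a ≤ M ^ e) (hb : b ≤ M ^ p * W ∨ b ≤ M ^ q * W) :
      a + b + 1 ≤ M ^ (e + p + q + 3) * W := by
    have hb' : b ≤ M ^ (p + q) * W := by
      rcases hb with hb | hb
      · exact hb.trans (by gcongr <;> omega)
      · exact hb.trans (by gcongr <;> omega)
    have := pow_combine (c := 0) hM (toW ha) hb' hW (by omega)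
    rwa [add_zero, ← add_assoc] at this
  induction P generalizing σ with
  | skip => simpa [Prog.cost, Prog.expo] using hW
  | setN a i e =>
    exact pow_combine (c := 0) hM (toW (i.val_cost_le σ hM h.nat).2)
      (toW (e.val_cost_le σ hM h.nat).2) hW (by omega)
  | setF a i e =>
    exact pow_combine (c := 0) hM (toW (i.val_cost_le σ hM h.nat).2)
      (e.val_cost_le hht hw σ hM h).2 hW (by omega)
  | seq P Q ihP ihQ =>
    exact pow_combine (c := 0) hM (ihP _ hs.1 h) (ihQ _ hs.2 (hs.1.bdd _ h)) hW (by omega)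
  | ifZeroN e P Q ihP ihQ =>
    simp only [Prog.Safe, Prog.cost, Prog.expo] at *
    refine three _ _ _ _ _ 0 (e.val_cost_le σ hM h.nat).2 ?_
    split_ifs at * with hc
    · exact Or.inl (ihP _ hs h)
    · exact Or.inr (ihQ _ hs h)
  | ifZeroF e P Q ihP ihQ =>
    simp only [Prog.Safe, Prog.cost, Prog.expo] at *
    have h1 := (e.val_cost_le hht hw σ hM h).2
    have hb : (if e.val σ = 0 then P.cost w σ else Q.cost w σ) ≤ M ^ (P.expo + Q.expo) * W := by
      split_ifs at * with hc
      · exact (ihP _ hs h).trans (by gcongr <;> omega)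
      · exact (ihQ _ hs h).trans (by gcongr <;> omega)
    have := pow_combine (c := 0) hM h1 hb hW (by omega)
    rwa [add_zero, ← add_assoc] at this
  | loop e P ih =>
    obtain ⟨h1, h2⟩ := e.val_cost_le σ hM h.nat
    have key : ∀ k < e.val σ, P.cost w ((fun τ => P.exec τ)^[k] σ) + 1 ≤ M ^ P.expo * W + 1 := by
      intro k hk
      refine Nat.add_le_add_right (ih _ (hs k hk) ?_) 1
      -- The store before round `k` is the final store of the same loop cut off after `k` rounds.
      have : ((Prog.loop (.lit k) P).exec σ).Bdd ht M W :=
        Prog.Safe.bdd (Prog.loop (.lit k) P) (fun j hj => hs j (lt_trans hj hk)) h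
      exact this
    have h3 : ∑ k ∈ Finset.range (e.val σ), (P.cost w ((fun τ => P.exec τ)^[k] σ) + 1) ≤
        M ^ e.expo * (M ^ P.expo * W + 1) := by
      refine (Finset.sum_le_card_nsmul _ _ _ fun k hk => key k (Finset.mem_range.1 hk)).trans ?_
      simp only [Finset.card_range, smul_eq_mul]
      exact Nat.mul_le_mul_right _ h1
    have h4 : M ^ e.expo * (M ^ P.expo * W + 1) ≤ 2 * (M ^ (e.expo + P.expo) * W) := by
      have : 1 ≤ M ^ P.expo * W := Nat.mul_pos (Nat.pow_pos (by omega)) hW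
      calc _ ≤ M ^ e.expo * (M ^ P.expo * W + M ^ P.expo * W) := by gcongr
        _ = _ := by ring
    have := pow_combine (b := 0) (c := 2 * (M ^ (e.expo + P.expo) * W)) (y := P.expo) hM
      (toW h2) (Nat.zero_le _) hW (by omega)
    simp only [Prog.cost, Prog.expo]
    omega

end

/-! ### Total correctness with bounded memory -/

section

variable {F : Type u} [Field F] {ht : F → ℕ} {M W : ℕ}

/-- Running `P` from `σ` keeps all assigned values bounded and ends in a store satisfying `Q`. -/
def Tr (ht : F → ℕ) (M W : ℕ) (P : Prog) (σ : Store F) (Q : Store F → Prop) : Prop :=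
  P.Safe ht M W σ ∧ Q (P.exec σ)

/-- A syntactic over-approximation of the arrays written. On a concrete program it evaluates, so the
side conditions of `Frame` are closed by `rfl`. -/
def Prog.modN : Prog → ℕ → Bool
  | .skip, _ => false
  | .setN a _ _, b => a == b
  | .setF _ _ _, _ => false
  | .seq P Q, b => P.modN b || Q.modN b
  | .ifZeroN _ P Q, b => P.modN b || Q.modN b
  | .ifZeroF _ P Q, b => P.modN b || Q.modN b
  | .loop _ P, b => P.modN b

def Prog.modF : Prog → ℕ → Bool
  | .skip, _ => false
  | .setN _ _ _, _ => false
  | .setF a _ _, b => a == b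
  | .seq P Q, b => P.modF b || Q.modF b
  | .ifZeroN _ P Q, b => P.modF b || Q.modF b
  | .ifZeroF _ P Q, b => P.modF b || Q.modF b
  | .loop _ P, b => P.modF b

/-- The arrays not written by `P` agree in `σ` and `τ`. -/
structure Frame (P : Prog) (σ τ : Store F) : Prop where
  nat : ∀ a, P.modN a = false → τ.nat a = σ.nat a
  fld : ∀ a, P.modF a = false → τ.fld a = σ.fld a

@[simp] theorem setN_nat_self (σ : Store F) (a i v : ℕ) :
    (σ.setN a i v).nat a = Function.update (σ.nat a) i v := by simp [Store.setN]

@[simp] theorem setF_fld_self (σ : Store F) (a i : ℕ) (v : F) :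
    (σ.setF a i v).fld a = Function.update (σ.fld a) i v := by simp [Store.setF]

theorem setN_nat_ne (σ : Store F) {a b : ℕ} (i v : ℕ) (h : b ≠ a) :
    (σ.setN a i v).nat b = σ.nat b := by simp [Store.setN, h]

theorem setF_fld_ne (σ : Store F) {a b : ℕ} (i : ℕ) (v : F) (h : b ≠ a) :
    (σ.setF a i v).fld b = σ.fld b := by simp [Store.setF, h]

@[simp] theorem setN_fld (σ : Store F) (a i v : ℕ) : (σ.setN a i v).fld = σ.fld := rfl

@[simp] theorem setF_nat (σ : Store F) (a i : ℕ) (v : F) : (σ.setF a i v).nat = σ.nat := rfl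

theorem Frame.rfl {P : Prog} {σ : Store F} : Frame P σ σ :=
  ⟨fun _ _ => Eq.refl _, fun _ _ => Eq.refl _⟩

theorem Frame.trans {P : Prog} {σ τ υ : Store F} (h : Frame P σ τ) (h' : Frame P τ υ) :
    Frame P σ υ :=
  ⟨fun a ha => (h'.nat a ha).trans (h.nat a ha), fun a ha => (h'.fld a ha).trans (h.fld a ha)⟩

theorem Frame.mono {P Q : Prog} {σ τ : Store F} (h : Frame P σ τ)
    (hN : ∀ a, Q.modN a = false → P.modN a = false)
    (hF : ∀ a, Q.modF a = false → P.modF a = false) : Frame Q σ τ :=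
  ⟨fun a ha => h.nat a (hN a ha), fun a ha => h.fld a (hF a ha)⟩

theorem Prog.frame (P : Prog) (σ : Store F) : Frame P σ (P.exec σ) := by
  induction P generalizing σ with
  | skip => exact .rfl
  | setN a i e =>
    refine ⟨fun b hb => ?_, fun b _ => Eq.refl _⟩
    have : b ≠ a := by rintro h; simp [Prog.modN, h] at hb
    exact setN_nat_ne _ _ _ this
  | setF a i e =>
    refine ⟨fun b _ => Eq.refl _, fun b hb => ?_⟩
    have : b ≠ a := by rintro h; simp [Prog.modF, h] at hb
    exact setF_fld_ne _ _ _ this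
  | seq P Q ihP ihQ =>
    exact ((ihP σ).mono (by simp +contextual [Prog.modN]) (by simp +contextual [Prog.modF])).trans
      ((ihQ _).mono (by simp +contextual [Prog.modN]) (by simp +contextual [Prog.modF]))
  | ifZeroN e P Q ihP ihQ =>
    simp only [Prog.exec]
    split_ifs
    · exact (ihP σ).mono (by simp +contextual [Prog.modN]) (by simp +contextual [Prog.modF])
    · exact (ihQ σ).mono (by simp +contextual [Prog.modN]) (by simp +contextual [Prog.modF])
  | ifZeroF e P Q ihP ihQ =>
    simp only [Prog.exec]
    split_ifs
    · exact (ihP σ).mono (by simp +contextual [Prog.modN]) (by simp +contextual [Prog.modF])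
    · exact (ihQ σ).mono (by simp +contextual [Prog.modN]) (by simp +contextual [Prog.modF])
  | loop e P ih =>
    simp only [Prog.exec]
    generalize e.val σ = N
    induction N with
    | zero => exact .rfl
    | succ N ihN =>
      rw [Function.iterate_succ_apply']
      exact ihN.trans ((ih _).mono (fun _ h => h) (fun _ h => h))

/-- The rule of consequence. It also hands over the frame, so a specification need only describe the
arrays that matter in its result. -/
theorem Tr.mono {P : Prog} {σ : Store F} {Q R : Store F → Prop} (h : Tr ht M W P σ Q)
    (hQ : ∀ τ, Frame P σ τ → Q τ → R τ) : Tr ht M W P σ R :=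
  ⟨h.1, hQ _ (P.frame σ) h.2⟩

theorem Tr.skip {σ : Store F} {Q : Store F → Prop} (h : Q σ) : Tr ht M W .skip σ Q :=
  ⟨trivial, h⟩

theorem Tr.setN {σ : Store F} {Q : Store F → Prop} {a : ℕ} {i e : NExpr} (hM : e.val σ ≤ M)
    (h : Q (σ.setN a (i.val σ) (e.val σ))) : Tr ht M W (.setN a i e) σ Q :=
  ⟨hM, h⟩

theorem Tr.setF {σ : Store F} {Q : Store F → Prop} {a : ℕ} {i : NExpr} {e : FExpr}
    (hW : ht (e.val σ) ≤ W) (h : Q (σ.setF a (i.val σ) (e.val σ))) :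
    Tr ht M W (.setF a i e) σ Q :=
  ⟨hW, h⟩

theorem Tr.seq {σ : Store F} {P P' : Prog} {R : Store F → Prop}
    (h : Tr ht M W P σ fun τ => Tr ht M W P' τ R) : Tr ht M W (.seq P P') σ R :=
  ⟨⟨h.1, h.2.1⟩, h.2.2⟩

theorem Tr.ifZeroN {σ : Store F} {P P' : Prog} {e : NExpr} {R : Store F → Prop}
    (h : e.val σ = 0 → Tr ht M W P σ R) (h' : e.val σ ≠ 0 → Tr ht M W P' σ R) :
    Tr ht M W (.ifZeroN e P P') σ R := by
  by_cases hc : e.val σ = 0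
  · simpa [Tr, Prog.Safe, Prog.exec, hc] using h hc
  · simpa [Tr, Prog.Safe, Prog.exec, hc] using h' hc

theorem Tr.ifZeroF {σ : Store F} {P P' : Prog} {e : FExpr} {R : Store F → Prop}
    (h : e.val σ = 0 → Tr ht M W P σ R) (h' : e.val σ ≠ 0 → Tr ht M W P' σ R) :
    Tr ht M W (.ifZeroF e P P') σ R := by
  by_cases hc : e.val σ = 0
  · simpa [Tr, Prog.Safe, Prog.exec, hc] using h hc
  · simpa [Tr, Prog.Safe, Prog.exec, hc] using h' hc

/-- The scalar variable stored in the first cell of a number array. -/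
abbrev nv (a : ℕ) : NExpr := .get a (.lit 0)

/-- The scalar variable stored in the first cell of a field array. -/
abbrev fv (a : ℕ) : FExpr := .get a (.lit 0)

/-- `for v < e do P`. -/
def forN (v : ℕ) (e : NExpr) (P : Prog) : Prog :=
  .seq (.setN v (.lit 0) (.lit 0))
    (.loop e (.seq P (.setN v (.lit 0) (.add (nv v) (.lit 1)))))

@[simp] theorem forN_modN (v : ℕ) (e : NExpr) (P : Prog) (a : ℕ) :
    (forN v e P).modN a = (v == a || P.modN a) := by
  simp only [forN, Prog.modN]
  cases v == a <;> cases P.modN a <;> rfl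

@[simp] theorem forN_modF (v : ℕ) (e : NExpr) (P : Prog) (a : ℕ) :
    (forN v e P).modF a = P.modF a := by
  simp [forN, Prog.modF]

/-- The invariant is carried through the rounds together with the value of the counter and the frame
relative to the initial store. The bound `e` is read once, after the counter has been reset, and
`hN` makes the assignments to the counter safe. -/
theorem Tr.forN {v : ℕ} {e : NExpr} {P : Prog} {σ : Store F} {Q : Store F → Prop} (N : ℕ)
    (Inv : ℕ → Store F → Prop) (hv : P.modN v = false) (he : e.val (σ.setN v 0 0) = N)
    (hN : N ≤ M) (h0 : Inv 0 (σ.setN v 0 0))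
    (hstep : ∀ k τ, k < N → Frame (forN v e P) σ τ → τ.nat v 0 = k → Inv k τ →
      Tr ht M W P τ fun τ' => Inv (k + 1) (τ'.setN v 0 (k + 1)))
    (hpost : ∀ τ, Frame (UnivRem.forN v e P) σ τ → Inv N τ → Q τ) :
    Tr ht M W (UnivRem.forN v e P) σ Q := by
  set B : Prog := .seq P (.setN v (.lit 0) (.add (nv v) (.lit 1))) with hB
  have hfr : Frame (UnivRem.forN v e P) σ (σ.setN v 0 0) := by
    refine ⟨fun a ha => setN_nat_ne _ _ _ ?_, fun a _ => Eq.refl _⟩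
    rintro h; simp [h] at ha
  have key : ∀ k ≤ N, (∀ j < k, B.Safe ht M W ((fun τ => B.exec τ)^[j] (σ.setN v 0 0))) ∧
      Frame (UnivRem.forN v e P) σ ((fun τ => B.exec τ)^[k] (σ.setN v 0 0)) ∧
      ((fun τ => B.exec τ)^[k] (σ.setN v 0 0)).nat v 0 = k ∧
      Inv k ((fun τ => B.exec τ)^[k] (σ.setN v 0 0)) := by
    intro k
    induction k with
    | zero => exact fun _ => ⟨fun _ h => absurd h (by omega), hfr, by simp, h0⟩
    | succ k ih =>
      intro hk
      obtain ⟨i1, i2, i3, i4⟩ := ih (by omega)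
      have ht := hstep k _ (by omega) i2 i3 i4
      rw [Function.iterate_succ_apply']
      set τ := (fun τ => B.exec τ)^[k] (σ.setN v 0 0)
      have hc : (P.exec τ).nat v 0 = k := by rw [(P.frame τ).nat v hv, i3]
      have hx : B.exec τ = (P.exec τ).setN v 0 (k + 1) := by
        simp [hB, Prog.exec, NExpr.val, hc]
      refine ⟨fun j hj => ?_, ?_, ?_, ?_⟩
      · rcases Nat.lt_succ_iff_lt_or_eq.1 hj with hj | hj
        · exact i1 j hj
        · rw [hj]
          refine ⟨ht.1, ?_⟩
          show (P.exec τ).nat v 0 + 1 ≤ M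
          omega
      · refine i2.trans (Frame.mono (B.frame τ) ?_ ?_)
        · intro a; simp only [forN_modN, hB, Prog.modN]; cases P.modN a <;> simp
        · intro a; simp [hB, Prog.modF]
      · show (B.exec τ).nat v 0 = _
        rw [hx]; simp
      · show Inv _ (B.exec τ)
        rw [hx]; exact ht.2
  obtain ⟨k1, k2, k3, k4⟩ := key N le_rfl
  have e1 : (UnivRem.forN v e P).exec σ = (fun τ => B.exec τ)^[N] (σ.setN v 0 0) := by
    rw [← he]; rfl
  refine ⟨⟨by simp [Prog.Safe, NExpr.val], ?_⟩, ?_⟩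
  · intro j hj
    exact k1 j (by rw [← he]; exact hj)
  · rw [e1]; exact hpost _ k2 k4

end

/-! ### Programs: digits and arithmetic of truncated polynomials -/

/-- The `j`-th digit of `x` in base `B`. -/
def dig (B x j : ℕ) : ℕ := x / B ^ j % B

abbrev nE : NExpr := .get 0 (.lit 0)
abbrev rE : NExpr := .get 0 (.lit 1)
abbrev dE : NExpr := .get 0 (.lit 2)
abbrev sE : NExpr := .get 0 (.lit 3)
abbrev outE : NExpr := .get 0 (.lit 4)
/-- The base `d + 1`. -/
abbrev bE : NExpr := .add dE (.lit 1)
/-- The number `(d + 1) ^ r` of truncated monomials. -/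
abbrev kE : NExpr := .get 6 rE
/-- The number `r * d + 1` of exponents of one variable. -/
abbrev hE : NExpr := .add (.mul rE dE) (.lit 1)
abbrev digE (x j : NExpr) : NExpr := .mod (.div x (.get 6 j)) bE

/-- Tabulate the powers of `d + 1`. -/
def powProg : Prog :=
  .seq (.setN 6 (.lit 0) (.lit 1))
    (forN 10 rE (.setN 6 (.add (nv 10) (.lit 1)) (.mul (.get 6 (nv 10)) bE)))

/-- Test whether the digits of `y` (variable `14`) are at most those of `x` (variable `12`). -/
def leProg : Prog :=
  .seq (.setN 15 (.lit 0) (.lit 0))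
    (forN 13 rE (.ifZeroN (.sub (digE (nv 14) (nv 13)) (digE (nv 12) (nv 13))) .skip
      (.setN 15 (.lit 0) (.lit 1))))

/-- The coefficient `x` of the product of the truncated polynomials of the two arguments of gate
`m` (variable `11`). -/
def mulProg : Prog :=
  forN 14 kE (.seq leProg (.ifZeroN (nv 15)
    (.setF 7 (.lit 0) (.add (fv 7) (.mul
      (.get 5 (.add (.mul kE (.get 2 (nv 11))) (nv 14)))
      (.get 5 (.add (.mul kE (.get 3 (nv 11))) (.sub (nv 12) (nv 14)))))))
    .skip))

/-- The coefficient `x` of the image of a variable. -/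
def varProg : Prog :=
  forN 13 rE (.ifZeroN (.add (.sub (.get 5 (nv 13)) (.add (.get 2 (nv 11)) (.lit 1)))
      (.sub (.add (.get 2 (nv 11)) (.lit 1)) (.get 5 (nv 13))))
    (.ifZeroN (.add (.sub (nv 12) (.get 6 (nv 13))) (.sub (.get 6 (nv 13)) (nv 12)))
      (.setF 7 (.lit 0) (.add (fv 7) .one)) .skip) .skip)

/-- The coefficient `x` at gate `m`. -/
def gateProg : Prog :=
  .seq (.setF 7 (.lit 0) .zero) (.seq
    (.ifZeroN (.get 1 (nv 11))
      (.ifZeroN (nv 12) (.setF 7 (.lit 0) (.get 0 (nv 11))) .skip)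
      (.ifZeroN (.sub (.get 1 (nv 11)) (.lit 1)) varProg
        (.ifZeroN (.sub (.get 1 (nv 11)) (.lit 2))
          (.setF 7 (.lit 0) (.add
            (.get 5 (.add (.mul kE (.get 2 (nv 11))) (nv 12)))
            (.get 5 (.add (.mul kE (.get 3 (nv 11))) (nv 12)))))
          mulProg)))
    (.setF 5 (.add (.mul kE (nv 11)) (nv 12)) (fv 7)))

/-- Evaluate the circuit in truncated polynomials, after the substitution given by the pivots. -/
def symProg : Prog := forN 11 sE (forN 12 kE gateProg)

/-- The numerical parameters of an input. -/
structure Params where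
  n : ℕ
  r : ℕ
  d : ℕ
  s : ℕ
  out : ℕ

/-- The base of the digits. -/
abbrev Params.B (p : Params) : ℕ := p.d + 1
/-- The number of truncated monomials. -/
abbrev Params.K (p : Params) : ℕ := (p.d + 1) ^ p.r

structure Params.Fits (p : Params) (M : ℕ) : Prop where
  n : p.n ≤ M
  r : p.r ≤ M
  d : p.d + 1 ≤ M
  s : p.s ≤ M
  h : p.r * p.d + 1 ≤ M
  K : (p.d + 1) ^ p.r ≤ M

theorem Params.Fits.pow {p : Params} {M j : ℕ} (h : p.Fits M) (hj : j ≤ p.r) :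
    (p.d + 1) ^ j ≤ M :=
  (Nat.pow_le_pow_right (by omega) hj).trans h.K

/-! ### Correctness of the evaluation of the circuit in truncated polynomials. -/

section

variable {F : Type u} [Field F] {ht : F → ℕ} {M W : ℕ} {p : Params}

structure HasParams (p : Params) (σ : Store F) : Prop where
  n : σ.nat 0 0 = p.n
  r : σ.nat 0 1 = p.r
  d : σ.nat 0 2 = p.d
  s : σ.nat 0 3 = p.s
  out : σ.nat 0 4 = p.out

theorem HasParams.of_eq {σ τ : Store F} (h : HasParams p σ) (e : τ.nat 0 = σ.nat 0) :
    HasParams p τ := by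
  constructor <;> rw [e]
  exacts [h.n, h.r, h.d, h.s, h.out]

/-- The parameters and the table of powers are in memory. -/
structure Ctx (p : Params) (σ : Store F) : Prop extends HasParams p σ where
  pw : ∀ j ≤ p.r, σ.nat 6 j = (p.d + 1) ^ j

theorem Ctx.of_eq {σ τ : Store F} (h : Ctx p σ) (e : τ.nat 0 = σ.nat 0) (e' : τ.nat 6 = σ.nat 6) :
    Ctx p τ :=
  ⟨h.toHasParams.of_eq e, by rw [e']; exact h.pw⟩

theorem Ctx.frame {P : Prog} {σ τ : Store F} (h : Ctx p σ) (hf : Frame P σ τ)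
    (h0 : P.modN 0 = false) (h6 : P.modN 6 = false) : Ctx p τ :=
  h.of_eq (hf.nat 0 h0) (hf.nat 6 h6)

theorem Ctx.K {σ : Store F} (h : Ctx p σ) : σ.nat 6 p.r = p.K := h.pw _ le_rfl

theorem powProg_spec {σ : Store F} (hp : HasParams p σ) (hM : p.Fits M) :
    Tr ht M W powProg σ (Ctx p) := by
  have h1 : 1 ≤ M := by have := hM.d; omega
  refine Tr.seq (Tr.setN h1 ?_)
  refine Tr.forN p.r (fun k τ => ∀ j ≤ k, τ.nat 6 j = (p.d + 1) ^ j) rfl hp.r hM.r ?_ ?_ ?_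
  · intro j hj
    obtain rfl : j = 0 := by omega
    rfl
  · intro k τ hk hf hc hI
    have hp' := hp.of_eq (hf.nat 0 rfl)
    have hval : (NExpr.mul (.get 6 (nv 10)) bE).val τ = (p.d + 1) ^ (k + 1) := by
      simp [NExpr.val, hc, hI k le_rfl, hp'.d, pow_succ]
    refine Tr.setN (hval ▸ hM.pow (by omega)) ?_
    rw [hval]
    intro j hj
    simp only [NExpr.val, hc]
    rw [setN_nat_ne _ _ _ (by decide), setN_nat_self, Function.update_apply]
    split_ifs with hjk
    · rw [hjk]
    · exact hI j (by omega)
  · intro τ hf hI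
    exact ⟨hp.of_eq (hf.nat 0 rfl), hI⟩

theorem leProg_spec {σ : Store F} (hp : Ctx p σ) (hM : p.Fits M) {x y : ℕ}
    (hx : σ.nat 12 0 = x) (hy : σ.nat 14 0 = y) :
    Tr ht M W leProg σ fun τ => τ.nat 15 0 = 0 ↔ ∀ j < p.r, dig p.B y j ≤ dig p.B x j := by
  have h1 : 1 ≤ M := by have := hM.d; omega
  refine Tr.seq (Tr.setN (Nat.zero_le _) ?_)
  refine Tr.forN p.r (fun k τ => τ.nat 15 0 = 0 ↔ ∀ j < k, dig p.B y j ≤ dig p.B x j) rfl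
    hp.r hM.r ?_ ?_ fun τ _ h => h
  · simp [setN_nat_ne, NExpr.val]
  · intro k τ hk hf hc hI
    have hp' : Ctx p τ := hp.of_eq (hf.nat 0 rfl) (hf.nat 6 rfl)
    have hx' : τ.nat 12 0 = x := by rw [hf.nat 12 rfl]; exact hx
    have hy' : τ.nat 14 0 = y := by rw [hf.nat 14 rfl]; exact hy
    -- Subtraction is truncated, so this difference vanishes exactly when the digit of `y` is at
    -- most that of `x`.
    have hv : (NExpr.sub (digE (nv 14) (nv 13)) (digE (nv 12) (nv 13))).val τ =
        dig p.B y k - dig p.B x k := by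
      simp [NExpr.val, hc, hp'.pw k hk.le, hp'.d, hx', hy', dig]
    refine Tr.ifZeroN (fun h => Tr.skip ?_) fun h => Tr.setN h1 ?_
    · rw [hv] at h
      rw [setN_nat_ne _ _ _ (by decide), hI, Nat.forall_lt_succ_right]
      exact ⟨fun h' => ⟨h', by omega⟩, fun h' => h'.1⟩
    · rw [hv] at h
      rw [setN_nat_ne _ _ _ (by decide), setN_nat_self]
      simp only [NExpr.val, Function.update_self, one_ne_zero, false_iff, not_forall]
      exact ⟨k, by omega, by omega⟩

-- The code of a difference of exponent vectors is the difference of the codes when no digit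
-- borrows, so `x - y` addresses the complementary coefficient. A partial sum has at most `K` terms
-- of height at most `2 * X`, which explains `hW`.
open Classical in
theorem mulProg_spec (hh : Height ht) {σ : Store F} (hp : Ctx p σ) (hM : p.Fits M)
    {m x j k X : ℕ} {a b : ℕ → F} (hm : σ.nat 11 0 = m) (hx : σ.nat 12 0 = x)
    (hj : σ.nat 2 m = j) (hk : σ.nat 3 m = k) (hxK : x < p.K)
    (ha : ∀ y < p.K, σ.fld 5 (p.K * j + y) = a y) (hb : ∀ y < p.K, σ.fld 5 (p.K * k + y) = b y)
    (haX : ∀ y < p.K, ht (a y) ≤ X) (hbX : ∀ y < p.K, ht (b y) ≤ X) (hW : (p.K + 1) * (2 * X) ≤ W)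
    (h0 : σ.fld 7 0 = 0) :
    Tr ht M W mulProg σ fun τ => τ.fld 7 0 = ∑ y ∈ Finset.range p.K,
      if ∀ j < p.r, dig p.B y j ≤ dig p.B x j then a y * b (x - y) else 0 := by
  set t : ℕ → F := fun y => if ∀ j < p.r, dig p.B y j ≤ dig p.B x j then a y * b (x - y) else 0
  have htX : ∀ y < p.K, ht (t y) ≤ 2 * X := by
    intro y hy
    simp only [t]
    split_ifs
    · have := hh.mul_le (a y) (b (x - y))
      have := haX y hy
      have := hbX (x - y) (by omega)
      omega
    · have := (hh.zero_le _).trans (haX y hy)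
      omega
  have hsum : ∀ N ≤ p.K, ht (∑ y ∈ Finset.range N, t y) ≤ W := by
    intro N hN
    refine (hh.sum_le t N (fun k hk => htX k (by omega)) ((hh.zero_le _).trans (htX x hxK))).trans ?_
    refine le_trans ?_ hW
    gcongr
  refine Tr.forN p.K (fun N τ => τ.fld 7 0 = ∑ y ∈ Finset.range N, t y) rfl ?_ hM.K (by simpa using h0) ?_
    fun τ _ h => h
  · show (σ.nat 6 (σ.nat 0 1)) = _
    rw [hp.r, hp.K]
  · intro y τ hy hf hc hI
    have hp' : Ctx p τ := hp.of_eq (hf.nat 0 rfl) (hf.nat 6 rfl)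
    have hx' : τ.nat 12 0 = x := by rw [hf.nat 12 rfl, hx]
    refine Tr.seq ((leProg_spec hp' hM hx' hc).mono ?_)
    intro υ hg hle
    have hp'' : Ctx p υ := hp'.of_eq (hg.nat 0 rfl) (hg.nat 6 rfl)
    have e7 : υ.fld 7 0 = ∑ y ∈ Finset.range y, t y := by rw [hg.fld 7 rfl, hI]
    have hcy : υ.nat 14 0 = y := by rw [hg.nat 14 rfl, hc]
    refine Tr.ifZeroN (fun h => ?_) (fun h => Tr.skip ?_)
    · have hcond := hle.1 h
      have e2 : υ.nat 2 m = j := by rw [hg.nat 2 rfl, hf.nat 2 rfl, hj]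
      have e3 : υ.nat 3 m = k := by rw [hg.nat 3 rfl, hf.nat 3 rfl, hk]
      have e5 : υ.fld 5 = σ.fld 5 := by rw [hg.fld 5 rfl, hf.fld 5 rfl]
      have e11 : υ.nat 11 0 = m := by rw [hg.nat 11 rfl, hf.nat 11 rfl, hm]
      have e12 : υ.nat 12 0 = x := by rw [hg.nat 12 rfl, hx']
      have hv : (FExpr.add (fv 7) (.mul
          (.get 5 (.add (.mul kE (.get 2 (nv 11))) (nv 14)))
          (.get 5 (.add (.mul kE (.get 3 (nv 11))) (.sub (nv 12) (nv 14)))))).val υ =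
          ∑ y ∈ Finset.range (y + 1), t y := by
        simp only [FExpr.val, NExpr.val, e7, e11, e12, hcy, e2, e3, e5, hp''.r, hp''.K]
        rw [ha y hy, hb (x - y) (by omega), Finset.sum_range_succ]
        simp [t, if_pos hcond]
      refine Tr.setF (by rw [hv]; exact hsum _ hy) ?_
      rw [hv]
      simp [NExpr.val]
    · have hcond : ¬ ∀ j < p.r, dig p.B y j ≤ dig p.B x j := fun hh => h (hle.2 hh)
      rw [setN_fld, e7, Finset.sum_range_succ]
      simp [t, if_neg hcond]

end

section

variable {F : Type u} [Field F] {ht : F → ℕ} {M W : ℕ} {p : Params}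

theorem varProg_spec (hh : Height ht) {σ : Store F} (hp : Ctx p σ) (hM : p.Fits M)
    {m x i X : ℕ} (hm : σ.nat 11 0 = m) (hx : σ.nat 12 0 = x) (hi : σ.nat 2 m = i)
    (hX : ∀ a : F, a = 0 ∨ a = 1 → ht a ≤ X) (hW : (p.r + 1) * X ≤ W) (h0 : σ.fld 7 0 = 0) :
    Tr ht M W varProg σ fun τ => τ.fld 7 0 = ∑ j ∈ Finset.range p.r,
      if σ.nat 5 j = i + 1 ∧ x = p.B ^ j then 1 else 0 := by
  set t : ℕ → F := fun j => if σ.nat 5 j = i + 1 ∧ x = p.B ^ j then 1 else 0 with ht0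
  have hsum : ∀ N ≤ p.r, ht (∑ j ∈ Finset.range N, t j) ≤ W := by
    intro N hN
    refine (hh.sum_le t N (fun k hk => hX _ ?_) (hX _ (Or.inl rfl))).trans (le_trans ?_ hW)
    · simp only [t]; split_ifs <;> simp
    · gcongr
  refine Tr.forN p.r (fun N τ => τ.fld 7 0 = ∑ j ∈ Finset.range N, t j) rfl hp.r hM.r
    (by simpa using h0) ?_ fun τ _ h => h
  intro j τ hj hf hc hI
  have hp' : Ctx p τ := hp.of_eq (hf.nat 0 rfl) (hf.nat 6 rfl)
  have e2 : τ.nat 2 m = i := by rw [hf.nat 2 rfl, hi]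
  have e11 : τ.nat 11 0 = m := by rw [hf.nat 11 rfl, hm]
  have e12 : τ.nat 12 0 = x := by rw [hf.nat 12 rfl, hx]
  have e5 : τ.nat 5 = σ.nat 5 := hf.nat 5 rfl
  -- Equality `a = b` is tested as `(a - b) + (b - a) = 0` with truncated subtraction, first for the
  -- pivot and then for the code of `y_j`.
  refine Tr.ifZeroN (fun h => Tr.ifZeroN (fun h' => ?_) fun h' => Tr.skip ?_) fun h => Tr.skip ?_
  · simp only [NExpr.val, hc, e11, e12, e2, e5, hp'.pw j hj.le] at h h'
    have hv : (FExpr.add (fv 7) .one).val τ = ∑ j ∈ Finset.range (j + 1), t j := by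
      rw [Finset.sum_range_succ]
      simp only [FExpr.val, NExpr.val, hI, t]
      rw [if_pos ⟨by omega, by simp only [Params.B]; omega⟩]
    refine Tr.setF (by rw [hv]; exact hsum _ hj) ?_
    rw [hv]
    simp [NExpr.val]
  · simp only [NExpr.val, hc, e11, e12, e2, e5, hp'.pw j hj.le] at h h'
    rw [setN_fld, hI, Finset.sum_range_succ]
    simp only [t]
    rw [if_neg (fun h'' => h' (by have := h''.2; simp only [Params.B] at this; omega)), add_zero]
  · simp only [NExpr.val, hc, e11, e2, e5] at h
    rw [setN_fld, hI, Finset.sum_range_succ]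
    simp only [t]
    rw [if_neg (fun h'' => h (by have := h''.1; omega)), add_zero]

open Classical in
/-- The tables of coefficients of the polynomials at the gates, described recursively. -/
structure GateTable (p : Params) (σ : Store F) (G : ℕ → ℕ → F) : Prop where
  rec_eq : ∀ m < p.s,
    (σ.nat 1 m = 0 ∧ ∀ x < p.K, G m x = if x = 0 then σ.fld 0 m else 0) ∨
    (σ.nat 1 m = 1 ∧ ∀ x < p.K, G m x = ∑ j ∈ Finset.range p.r,
      if σ.nat 5 j = σ.nat 2 m + 1 ∧ x = p.B ^ j then 1 else 0) ∨
    (σ.nat 1 m = 2 ∧ σ.nat 2 m < m ∧ σ.nat 3 m < m ∧ ∀ x < p.K,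
      G m x = G (σ.nat 2 m) x + G (σ.nat 3 m) x) ∨
    (σ.nat 1 m = 3 ∧ σ.nat 2 m < m ∧ σ.nat 3 m < m ∧ ∀ x < p.K,
      G m x = ∑ y ∈ Finset.range p.K,
        if ∀ j < p.r, dig p.B y j ≤ dig p.B x j then G (σ.nat 2 m) y * G (σ.nat 3 m) (x - y) else 0)

theorem GateTable.of_eq {σ τ : Store F} {G : ℕ → ℕ → F} (h : GateTable p σ G)
    (e1 : τ.nat 1 = σ.nat 1) (e2 : τ.nat 2 = σ.nat 2) (e3 : τ.nat 3 = σ.nat 3)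
    (e5 : τ.nat 5 = σ.nat 5) (e0 : τ.fld 0 = σ.fld 0) : GateTable p τ G := by
  constructor
  rw [e1, e2, e3, e5, e0]
  exact h.rec_eq

theorem gateProg_spec (hh : Height ht) {σ : Store F} (hp : Ctx p σ) (hM : p.Fits M)
    {G : ℕ → ℕ → F} (hG : GateTable p σ G) {m x X : ℕ} (hm : σ.nat 11 0 = m)
    (hx : σ.nat 12 0 = x) (hms : m < p.s) (hxK : x < p.K)
    (hX : ∀ m < p.s, ∀ x < p.K, ht (G m x) ≤ X) (hX1 : ∀ a : F, a = 0 ∨ a = 1 → ht a ≤ X)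
    (hW : (p.r + 1) * X ≤ W) (hW' : (p.K + 1) * (2 * X) ≤ W)
    (hI : ∀ m' < m, ∀ x < p.K, σ.fld 5 (p.K * m' + x) = G m' x) :
    Tr ht M W gateProg σ fun τ =>
      τ.fld 5 = Function.update (σ.fld 5) (p.K * m + x) (G m x) := by
  have hXW : X ≤ W := by nlinarith
  -- All branches end with the accumulator copied into the table. The frame of `.seq varProg
  -- mulProg` covers whatever any of the branches writes.
  have fin {τ : Store F} (hf : Frame (.seq varProg mulProg) σ τ) (h7 : τ.fld 7 0 = G m x) :
      Tr ht M W (.setF 5 (.add (.mul kE (nv 11)) (nv 12)) (fv 7)) τ fun τ =>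
      τ.fld 5 = Function.update (σ.fld 5) (p.K * m + x) (G m x) := by
    have hp' : Ctx p τ := hp.of_eq (hf.nat 0 rfl) (hf.nat 6 rfl)
    have e11 : τ.nat 11 0 = m := by rw [hf.nat 11 rfl, hm]
    have e12 : τ.nat 12 0 = x := by rw [hf.nat 12 rfl, hx]
    have hv : (fv 7).val τ = G m x := h7
    refine Tr.setF (by rw [hv]; exact (hX m hms x hxK).trans hXW) ?_
    rw [hv, setF_fld_self, hf.fld 5 rfl]
    simp [NExpr.val, hp'.r, hp'.K, e11, e12]
  refine Tr.seq (Tr.setF ((hX1 0 (Or.inl rfl)).trans hXW) (Tr.seq ?_))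
  set σ' := σ.setF 7 ((NExpr.lit 0).val σ) (FExpr.zero.val σ)
  have hf' : Frame (.seq varProg mulProg) σ σ' :=
    ⟨fun _ _ => rfl, fun a ha => setF_fld_ne _ _ _ (by rintro rfl; cases ha)⟩
  have hp' : Ctx p σ' := hp.of_eq rfl rfl
  have h70 : σ'.fld 7 0 = 0 := by simp [σ', NExpr.val, FExpr.val]
  have hm' : σ'.nat 11 0 = m := hm
  have hx' : σ'.nat 12 0 = x := hx
  have e5 : σ'.fld 5 = σ.fld 5 := rfl
  have hcode : (NExpr.get 1 (nv 11)).val σ' = σ.nat 1 m := by simp [NExpr.val, σ', hm]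
  rcases hG.rec_eq m hms with ⟨hc, h⟩ | ⟨hc, h⟩ | ⟨hc, h2, h3, h⟩ | ⟨hc, h2, h3, h⟩
  · refine Tr.ifZeroN (fun _ => Tr.ifZeroN (fun h0 => ?_) fun h0 => Tr.skip ?_)
      fun h' => absurd (hcode.trans hc) h'
    · have hx0 : x = 0 := by simpa [NExpr.val, hx'] using h0
      have hv : (FExpr.get 0 (nv 11)).val σ' = G m x := by
        rw [h x hxK, if_pos hx0]
        simp only [FExpr.val, NExpr.val, hm']
        rfl
      refine Tr.setF (by rw [hv]; exact (hX m hms x hxK).trans hXW) (fin ?_ ?_)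
      · exact ⟨fun _ _ => rfl, fun a ha => (setF_fld_ne _ _ _ (by rintro rfl; cases ha)).trans
          (hf'.fld a ha)⟩
      · rw [hv]; simp [NExpr.val]
    · have hx0 : x ≠ 0 := by simpa [NExpr.val, hx'] using h0
      exact fin hf' (by rw [h70, h x hxK, if_neg hx0])
  · refine Tr.ifZeroN (fun h' => absurd (hcode.symm.trans h') (by omega)) fun _ => ?_
    refine Tr.ifZeroN (fun _ => ?_) fun h' => absurd (by simp only [NExpr.val] at hcode ⊢; omega) h'
    refine (varProg_spec hh hp' hM hm' hx' (i := σ.nat 2 m) rfl hX1 hW h70).mono ?_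
    intro τ hf h7
    exact fin (hf'.trans (hf.mono (by simp +contextual [Prog.modN])
      (by simp +contextual [Prog.modF]))) (by rw [h7, h x hxK]; rfl)
  · refine Tr.ifZeroN (fun h' => absurd (hcode.symm.trans h') (by omega)) fun _ => ?_
    refine Tr.ifZeroN (fun h' => ?_) fun _ => ?_
    · simp only [NExpr.val] at hcode h'; omega
    refine Tr.ifZeroN (fun _ => ?_) fun h' => absurd (by simp only [NExpr.val] at hcode ⊢; omega) h'
    have hv : (FExpr.add
            (.get 5 (.add (.mul kE (.get 2 (nv 11))) (nv 12)))
            (.get 5 (.add (.mul kE (.get 3 (nv 11))) (nv 12)))).val σ' = G m x := by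
      simp only [FExpr.val, NExpr.val, hm', hx', e5, hp'.r, hp'.K]
      rw [h x hxK, ← hI _ h2 x hxK, ← hI _ h3 x hxK]
      rfl
    refine Tr.setF (by rw [hv]; exact (hX m hms x hxK).trans hXW) (fin ?_ ?_)
    · exact ⟨fun _ _ => rfl, fun a ha => (setF_fld_ne _ _ _ (by rintro rfl; cases ha)).trans
        (hf'.fld a ha)⟩
    · rw [hv]; simp [NExpr.val]
  · refine Tr.ifZeroN (fun h' => absurd (hcode.symm.trans h') (by omega)) fun _ => ?_
    refine Tr.ifZeroN (fun h' => ?_) fun _ => ?_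
    · simp only [NExpr.val] at hcode h'; omega
    refine Tr.ifZeroN (fun h' => ?_) fun _ => ?_
    · simp only [NExpr.val] at hcode h'; omega
    refine (mulProg_spec hh hp' hM hm' hx' rfl rfl hxK (a := G (σ.nat 2 m)) (b := G (σ.nat 3 m))
      (X := X) (fun y hy => hI _ h2 y hy) (fun y hy => hI _ h3 y hy)
      (fun y hy => hX _ (by omega) y hy) (fun y hy => hX _ (by omega) y hy) hW' h70).mono ?_
    intro τ hf h7
    exact fin (hf'.trans (hf.mono (by simp +contextual [Prog.modN])
      (by simp +contextual [Prog.modF]))) (by rw [h7, h x hxK])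

theorem mul_add_inj {K a b x y : ℕ} (hx : x < K) (hy : y < K) :
    K * a + x = K * b + y ↔ a = b ∧ x = y := by
  constructor
  · intro h
    have h1 : (K * a + x) / K = (K * b + y) / K := by rw [h]
    have hK : 0 < K := by omega
    rw [Nat.mul_add_div hK, Nat.mul_add_div hK, Nat.div_eq_of_lt hx, Nat.div_eq_of_lt hy] at h1
    obtain rfl : a = b := by omega
    exact ⟨rfl, by omega⟩
  · rintro ⟨rfl, rfl⟩; rfl

/-- The entries of row `m` depend only on rows of smaller index, which are complete when the outer
loop reaches `m` because the gates are in topological order. -/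
theorem symProg_spec (hh : Height ht) {σ : Store F} (hp : Ctx p σ) (hM : p.Fits M)
    {G : ℕ → ℕ → F} (hG : GateTable p σ G) {X : ℕ}
    (hX : ∀ m < p.s, ∀ x < p.K, ht (G m x) ≤ X) (hX1 : ∀ a : F, a = 0 ∨ a = 1 → ht a ≤ X)
    (hW : (p.r + 1) * X ≤ W) (hW' : (p.K + 1) * (2 * X) ≤ W) :
    Tr ht M W symProg σ fun τ => ∀ m < p.s, ∀ x < p.K, τ.fld 5 (p.K * m + x) = G m x := by
  refine Tr.forN p.s (fun N τ => ∀ m < N, ∀ x < p.K, τ.fld 5 (p.K * m + x) = G m x) rfl hp.s hM.s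
    (fun m hm => absurd hm (by omega)) ?_ fun τ _ h => h
  intro m τ hm hf hc hI
  have hp' : Ctx p τ := hp.of_eq (hf.nat 0 rfl) (hf.nat 6 rfl)
  have hG' : GateTable p τ G :=
    hG.of_eq (hf.nat 1 rfl) (hf.nat 2 rfl) (hf.nat 3 rfl) (hf.nat 5 rfl) (hf.fld 0 rfl)
  refine Tr.forN p.K (fun N τ => (∀ m' < m, ∀ x < p.K, τ.fld 5 (p.K * m' + x) = G m' x) ∧
    ∀ x < N, τ.fld 5 (p.K * m + x) = G m x) rfl ?_ hM.K ⟨hI, fun x hx => absurd hx (by omega)⟩ ?_ ?_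
  · show (τ.nat 6 (τ.nat 0 1)) = _
    rw [hp'.r, hp'.K]
  · intro x υ hx hg hcx hJ
    refine (gateProg_spec hh (hp'.of_eq (hg.nat 0 rfl) (hg.nat 6 rfl)) hM
      (hG'.of_eq (hg.nat 1 rfl) (hg.nat 2 rfl) (hg.nat 3 rfl) (hg.nat 5 rfl) (hg.fld 0 rfl))
      (by rw [hg.nat 11 rfl, hc]) hcx hm hx hX hX1 hW hW' hJ.1).mono ?_
    intro ω _ h5
    simp only [setN_fld, h5]
    refine ⟨fun m' hm' y hy => ?_, fun y hy => ?_⟩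
    · rw [Function.update_apply, if_neg, hJ.1 m' hm' y hy]
      rw [mul_add_inj hy hx]; omega
    · rw [Function.update_apply]
      split_ifs with h
      · rw [((mul_add_inj (by omega) hx).1 h).2]
      · exact hJ.2 y (by rcases Nat.lt_succ_iff_lt_or_eq.1 hy with h' | h'
                         · exact h'
                         · exact absurd (by rw [h']) h)
  · intro υ _ hJ m' hm' x hx
    rcases Nat.lt_succ_iff_lt_or_eq.1 hm' with h' | h'
    · exact hJ.1 m' h' x hx
    · rw [h']; exact hJ.2 x hx

end

/-! ### Gauss-Jordan elimination -/

/-- Overwrite a row of the matrix of the linear forms. -/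
def rowProg (j : NExpr) (e : FExpr) : Prog :=
  forN 31 nE (.setF 1 (.add (.mul nE j) (nv 31)) e)

/-- Find a pivot in row `j` (variable `32`). -/
def pivProg : Prog :=
  .seq (.setN 5 (nv 32) (.lit 0))
    (forN 31 nE (.ifZeroN (.get 5 (nv 32))
      (.ifZeroF (.get 1 (.add (.mul nE (nv 32)) (nv 31))) .skip
        (.setN 5 (nv 32) (.add (nv 31) (.lit 1)))) .skip))

/-- Clear the pivot column in row `j'` (variable `33`). -/
def clearProg : Prog :=
  .seq (.setF 12 (.lit 0) (.get 1 (.add (.mul nE (nv 33)) (.sub (.get 5 (nv 32)) (.lit 1)))))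
    (rowProg (nv 33) (.sub (.get 1 (.add (.mul nE (nv 33)) (nv 31)))
      (.mul (fv 12) (.get 1 (.add (.mul nE (nv 32)) (nv 31))))))

/-- Normalize row `j` and clear its pivot column in the other rows. -/
def elimProg : Prog :=
  .seq (.setF 12 (.lit 0)
      (.inv (.get 1 (.add (.mul nE (nv 32)) (.sub (.get 5 (nv 32)) (.lit 1))))))
    (.seq (rowProg (nv 32) (.mul (.get 1 (.add (.mul nE (nv 32)) (nv 31))) (fv 12)))
      (forN 33 rE (.ifZeroN (.add (.sub (nv 33) (nv 32)) (.sub (nv 32) (nv 33))) .skip clearProg)))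

def gaussProg : Prog :=
  forN 32 rE (.seq pivProg (.ifZeroN (.get 5 (nv 32)) .skip elimProg))

/-! ### Correctness of the elimination and growth of the entries. -/

section

variable {F : Type u} [Field F] {ht : F → ℕ} {M W : ℕ} {p : Params}

/-- The matrix of the linear forms. -/
def mat (p : Params) (σ : Store F) (j i : ℕ) : F := σ.fld 1 (p.n * j + i)

/-- The first `t` rows of `A` are zero or have a pivot, and the rows of `A` span those of `A₀`. -/
structure Reduced (p : Params) (A₀ : ℕ → ℕ → F) (t : ℕ) (A : ℕ → ℕ → F) (piv : ℕ → ℕ) : Prop where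
  row : ∀ j < t, (piv j = 0 ∧ ∀ i < p.n, A j i = 0) ∨
    ∃ i < p.n, piv j = i + 1 ∧ A j i = 1 ∧ ∀ j' < p.r, j' ≠ j → A j' i = 0
  span : ∀ j < p.r, ∃ c : ℕ → F, ∀ i < p.n, A₀ j i = ∑ k ∈ Finset.range p.r, c k * A k i

/-- Row `t` has zeros in the earlier pivot columns, so subtracting its multiples leaves those
columns intact. Earlier zero rows have zero in column `i₀` and stay zero. -/
theorem Reduced.step {A₀ A A' : ℕ → ℕ → F} {t i₀ : ℕ} {piv : ℕ → ℕ} (h : Reduced p A₀ t A piv)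
    (htr : t < p.r) (hi₀ : i₀ < p.n) (hne : A t i₀ ≠ 0)
    (hA't : ∀ i < p.n, A' t i = A t i * (A t i₀)⁻¹)
    (hA' : ∀ j < p.r, j ≠ t → ∀ i < p.n, A' j i = A j i - A j i₀ * A' t i)
    {piv' : ℕ → ℕ} (hp : ∀ j < t, piv' j = piv j) (hpt : piv' t = i₀ + 1) :
    Reduced p A₀ (t + 1) A' piv' where
  row j hj := by
    rcases Nat.lt_succ_iff_lt_or_eq.1 hj with hj | rfl
    · rcases h.row j hj with ⟨h1, h2⟩ | ⟨i, hi, h1, h2, h3⟩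
      · refine Or.inl ⟨by rw [hp j hj, h1], fun i hi => ?_⟩
        rw [hA' j (by omega) (by omega) i hi, h2 i hi, h2 i₀ hi₀]; simp
      · refine Or.inr ⟨i, hi, by rw [hp j hj, h1], ?_, ?_⟩
        · rw [hA' j (by omega) (by omega) i hi, hA't i hi, h3 t htr (by omega), h2]; simp
        · intro j' hj' hne'
          by_cases hjt : j' = t
          · rw [hjt, hA't i hi, h3 t htr (by omega)]; simp
          · rw [hA' j' hj' hjt i hi, hA't i hi, h3 t htr (by omega), h3 j' hj' hne']; simp
    · refine Or.inr ⟨i₀, hi₀, hpt, ?_, fun j' hj' hne' => ?_⟩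
      · rw [hA't i₀ hi₀, mul_inv_cancel₀ hne]
      · rw [hA' j' hj' hne' i₀ hi₀, hA't i₀ hi₀, mul_inv_cancel₀ hne]; simp
  span j hj := by
    obtain ⟨c, hc⟩ := h.span j hj
    -- The old rows are `A k = A' k + A k i₀ * A' t` for `k ≠ t`, and `A t = A t i₀ * A' t`.
    -- Collecting the multiples of `A' t` gives the new coefficient at `t`.
    refine ⟨Function.update c t (∑ k ∈ Finset.range p.r, c k * A k i₀), fun i hi => ?_⟩
    have e (k : ℕ) (hk : k ∈ Finset.range p.r) :
        c k * A k i = (if k = t then 0 else c k) * A' k i + c k * A k i₀ * A' t i := by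
      rw [Finset.mem_range] at hk
      split_ifs with h'
      · rw [h', hA't i hi]; field_simp; ring
      · rw [hA' k hk h' i hi]; ring
    rw [hc i hi, Finset.sum_congr rfl e, Finset.sum_add_distrib, ← Finset.sum_mul]
    have e2 (k : ℕ) : Function.update c t (∑ k ∈ Finset.range p.r, c k * A k i₀) k * A' k i =
        (if k = t then 0 else c k) * A' k i +
          if k = t then (∑ k ∈ Finset.range p.r, c k * A k i₀) * A' t i else 0 := by
      rw [Function.update_apply]
      split_ifs with h'
      · simp [h']
      · simp
    rw [Finset.sum_congr rfl fun k _ => e2 k, Finset.sum_add_distrib]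
    simp [htr]

/-- The row is updated in place. When column `k` is written, the other rows and the columns of row
`j` from `k` on are still the old ones, and `he` lets `e` rely on exactly this. -/
theorem rowProg_spec {σ : Store F} (hp : HasParams p σ) (hM : p.Fits M) {jE : NExpr} {e : FExpr}
    {j : ℕ} {g : ℕ → F} (hj : ∀ τ, Frame (rowProg jE e) σ τ → jE.val τ = j)
    (he : ∀ k < p.n, ∀ τ, Frame (rowProg jE e) σ τ → τ.nat 31 0 = k →
      (∀ j' i, i < p.n → (j' ≠ j ∨ k ≤ i) → mat p τ j' i = mat p σ j' i) → e.val τ = g k)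
    (hW : ∀ k < p.n, ht (g k) ≤ W) :
    Tr ht M W (rowProg jE e) σ fun τ =>
      ∀ j', ∀ i < p.n, mat p τ j' i = if j' = j then g i else mat p σ j' i := by
  refine Tr.forN p.n (fun N τ => ∀ j', ∀ i < p.n, mat p τ j' i =
    if j' = j ∧ i < N then g i else mat p σ j' i) rfl hp.n hM.n ?_ ?_ ?_
  · intro j' i _
    simp only [not_lt_zero, and_false, if_false]
    rfl
  · intro k τ hk hf hc hI
    have hp' : HasParams p τ := hp.of_eq (hf.nat 0 rfl)
    have hv := he k hk τ hf hc (fun j' i hi h => by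
      rw [hI j' i hi, if_neg]; omega)
    refine Tr.setF (by rw [hv]; exact hW k hk) ?_
    rw [hv]
    have hidx : (NExpr.add (.mul nE jE) (nv 31)).val τ = p.n * j + k := by
      simp [NExpr.val, hp'.n, hj τ hf, hc]
    rw [hidx]
    intro j' i hi
    simp only [mat, setN_fld, setF_fld_self, Function.update_apply, mul_add_inj hi hk]
    split_ifs with h1 h2 h2
    · rw [h1.2]
    · omega
    · exact (hI j' i hi).trans (if_pos (by omega))
    · exact (hI j' i hi).trans (if_neg (by omega))
  · intro τ _ hI j' i hi
    rw [hI j' i hi]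
    simp [hi]

/-- Pivot columns are stored shifted by one, which leaves the value `0` for a row without pivot. -/
theorem pivProg_spec {σ : Store F} (hp : HasParams p σ) (hM : p.Fits M) {t : ℕ}
    (ht' : σ.nat 32 0 = t) :
    Tr ht M W pivProg σ fun τ => (∀ j, j ≠ t → τ.nat 5 j = σ.nat 5 j) ∧
      ((τ.nat 5 t = 0 ∧ ∀ i < p.n, mat p σ t i = 0) ∨
        ∃ i < p.n, τ.nat 5 t = i + 1 ∧ mat p σ t i ≠ 0) := by
  refine Tr.seq (Tr.setN (Nat.zero_le _) ?_)
  refine Tr.forN p.n (fun N τ => (∀ j, j ≠ t → τ.nat 5 j = σ.nat 5 j) ∧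
      ((τ.nat 5 t = 0 ∧ ∀ i < N, mat p σ t i = 0) ∨
        ∃ i < p.n, τ.nat 5 t = i + 1 ∧ mat p σ t i ≠ 0)) rfl hp.n hM.n ?_ ?_ fun τ _ h => h
  · rw [setN_nat_ne _ _ _ (by decide), setN_nat_self]
    simp only [NExpr.val, ht']
    exact ⟨fun j hj => by simp [hj], Or.inl ⟨by simp, fun i hi => absurd hi (by omega)⟩⟩
  · intro k τ hk hf hc hI
    have hp' : HasParams p τ := hp.of_eq ((hf.nat 0 rfl).trans rfl)
    have e32 : τ.nat 32 0 = t := by rw [hf.nat 32 rfl]; exact ht'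
    have e1 : τ.fld 1 = σ.fld 1 := hf.fld 1 rfl
    have hv : (FExpr.get 1 (.add (.mul nE (nv 32)) (nv 31))).val τ = mat p σ t k := by
      simp [FExpr.val, NExpr.val, hp'.n, e32, hc, e1, mat]
    have hz : (NExpr.get 5 (nv 32)).val τ = τ.nat 5 t := by simp [NExpr.val, e32]
    refine Tr.ifZeroN (fun h => Tr.ifZeroF (fun h' => Tr.skip ?_) fun h' => ?_) fun h => Tr.skip ?_
    · rw [hv] at h'
      rw [setN_nat_ne _ _ _ (by decide)]
      refine ⟨hI.1, hI.2.imp (fun h1 => ⟨h1.1, fun i hi => ?_⟩) id⟩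
      rcases Nat.lt_succ_iff_lt_or_eq.1 hi with hi | rfl
      exacts [h1.2 i hi, h']
    · rw [hv] at h'
      have := hM.n
      refine Tr.setN (by simp only [NExpr.val, hc]; omega) ?_
      rw [setN_nat_ne _ _ _ (by decide), setN_nat_self]
      simp only [NExpr.val, hc, e32]
      exact ⟨fun j hj => by simp [hj, hI.1 j hj], Or.inr ⟨k, hk, by simp, h'⟩⟩
    · rw [hz] at h
      rw [setN_nat_ne _ _ _ (by decide)]
      exact ⟨hI.1, Or.inr (hI.2.resolve_left fun h1 => h h1.1)⟩

/-- The inverse of the pivot, and later the entry to be cleared, are saved in a scalar because the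
row update overwrites them. A new entry has the form `a - b * (c * e)` with four factors of height
at most `Y`, whence `4 * Y`. -/
theorem elimProg_spec (hh : Height ht) {σ : Store F} (hp : HasParams p σ) (hM : p.Fits M)
    {t i₀ Y : ℕ} (htr : t < p.r) (hi₀ : i₀ < p.n) (h32 : σ.nat 32 0 = t)
    (h5 : σ.nat 5 t = i₀ + 1) (hY : ∀ j < p.r, ∀ i < p.n, ht (mat p σ j i) ≤ Y)
    (hW : 4 * Y ≤ W) :
    Tr ht M W elimProg σ fun τ =>
      (∀ i < p.n, mat p τ t i = mat p σ t i * (mat p σ t i₀)⁻¹) ∧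
      (∀ j < p.r, j ≠ t → ∀ i < p.n, mat p τ j i = mat p σ j i - mat p σ j i₀ * mat p τ t i) ∧
      ∀ j < p.r, ∀ i < p.n, ht (mat p τ j i) ≤ 4 * Y := by
  set c := (mat p σ t i₀)⁻¹ with hc
  have hcY : ht c ≤ Y := (hh.inv_le _).trans (hY t htr i₀ hi₀)
  have h2Y : ∀ i < p.n, ht (mat p σ t i * c) ≤ 2 * Y := fun i hi => by
    have := hh.mul_le (mat p σ t i) c
    have := hY t htr i hi
    omega
  have h4Y : ∀ j < p.r, ∀ i < p.n,
      ht (mat p σ j i - mat p σ j i₀ * (mat p σ t i * c)) ≤ 4 * Y := fun j hj i hi => by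
    have := hh.sub_le (mat p σ j i) (mat p σ j i₀ * (mat p σ t i * c))
    have := hh.mul_le (mat p σ j i₀) (mat p σ t i * c)
    have := hY j hj i hi
    have := hY j hj i₀ hi₀
    have := h2Y i hi
    omega
  have hv : (FExpr.inv (.get 1 (.add (.mul nE (nv 32)) (.sub (.get 5 (nv 32)) (.lit 1))))).val σ =
      c := by
    simp [FExpr.val, NExpr.val, hp.n, h32, h5, mat, hc]
  refine Tr.seq (Tr.setF (by rw [hv]; omega) (Tr.seq ?_))
  rw [hv]
  refine Tr.mono (rowProg_spec
    (hp.of_eq (τ := σ.setF 12 ((NExpr.lit 0).val σ) c) rfl) hM (j := t) (g := fun i => mat p σ t i * c)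
    (fun τ hf => ?_) (fun k hk τ hf hc hI => ?_) (fun k hk => ?_)) ?_
  · show τ.nat 32 0 = t
    rw [hf.nat 32 rfl]; exact h32
  · have e32 : τ.nat 32 0 = t := by rw [hf.nat 32 rfl]; exact h32
    have hp' : HasParams p τ := hp.of_eq (hf.nat 0 rfl)
    have e12 : τ.fld 12 0 = c := by rw [hf.fld 12 rfl]; simp [NExpr.val]
    have e1 := hI t k hk (Or.inr le_rfl)
    simp only [FExpr.val, NExpr.val, e32, hp'.n, hc, e12]
    exact congrArg (· * c) e1
  · exact (h2Y k hk).trans (by omega)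
  intro τ hf hτ
  have hτt : ∀ i < p.n, mat p τ t i = mat p σ t i * c := fun i hi => by
    rw [hτ t i hi, if_pos rfl]
  have hτj : ∀ j, j ≠ t → ∀ i < p.n, mat p τ j i = mat p σ j i := fun j hj i hi => by
    rw [hτ j i hi, if_neg hj]; rfl
  have hpτ : HasParams p τ := hp.of_eq (hf.nat 0 rfl)
  have e5 : τ.nat 5 = σ.nat 5 := hf.nat 5 rfl
  have e32 : τ.nat 32 0 = t := by rw [hf.nat 32 rfl]; exact h32
  refine Tr.forN p.r (fun N υ => ∀ j < p.r, ∀ i < p.n, mat p υ j i =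
    if j < N ∧ j ≠ t then mat p σ j i - mat p σ j i₀ * (mat p σ t i * c) else mat p τ j i)
    rfl hpτ.r hM.r (fun j hj i hi => by rw [if_neg (by omega)]; rfl) ?_ ?_
  · intro k υ hk hg hck hI
    have hp' : HasParams p υ := hpτ.of_eq (hg.nat 0 rfl)
    have f5 : υ.nat 5 t = i₀ + 1 := by rw [hg.nat 5 rfl, e5, h5]
    have f32 : υ.nat 32 0 = t := by rw [hg.nat 32 rfl]; exact e32
    refine Tr.ifZeroN (fun h => Tr.skip ?_) fun h => ?_
    · simp only [NExpr.val, hck, f32] at h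
      intro j hj i hi
      refine (hI j hj i hi).trans ?_
      by_cases h' : j < k ∧ j ≠ t
      · rw [if_pos h', if_pos (by omega)]
      · rw [if_neg h', if_neg (by omega)]
    · simp only [NExpr.val, hck, f32] at h
      have hkt : k ≠ t := by omega
      have hυt : ∀ i < p.n, mat p υ t i = mat p σ t i * c := fun i hi => by
        rw [hI t htr i hi, if_neg (by simp), hτt i hi]
      have hυk : ∀ i < p.n, mat p υ k i = mat p σ k i := fun i hi => by
        rw [hI k hk i hi, if_neg (by omega), hτj k hkt i hi]
      have hv' : (FExpr.get 1 (.add (.mul nE (nv 33)) (.sub (.get 5 (nv 32)) (.lit 1)))).val υ =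
          mat p σ k i₀ := by
        rw [← hυk i₀ hi₀]
        simp [FExpr.val, NExpr.val, hp'.n, hck, f32, f5, mat]
      refine Tr.seq (Tr.setF (by rw [hv']; exact (hY k hk i₀ hi₀).trans (by omega)) ?_)
      rw [hv']
      refine (rowProg_spec (hp'.of_eq (τ := υ.setF 12 ((NExpr.lit 0).val υ) (mat p σ k i₀)) rfl) hM
        (j := k)
        (g := fun i => mat p σ k i - mat p σ k i₀ * (mat p σ t i * c))
        (fun ω hf => ?_) (fun i hi ω hf hc hJ => ?_)
        (fun i hi => (h4Y k hk i hi).trans hW)).mono ?_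
      · show ω.nat 33 0 = k
        rw [hf.nat 33 rfl]; exact hck
      · have g33 : ω.nat 33 0 = k := by rw [hf.nat 33 rfl]; exact hck
        have g32 : ω.nat 32 0 = t := by rw [hf.nat 32 rfl]; exact f32
        have g12 : ω.fld 12 0 = mat p σ k i₀ := by rw [hf.fld 12 rfl]; simp [NExpr.val]
        have gp : HasParams p ω := hp'.of_eq (hf.nat 0 rfl)
        have g1 : mat p ω k i = mat p σ k i := (hJ k i hi (Or.inr le_rfl)).trans (hυk i hi)
        have g2 : mat p ω t i = mat p σ t i * c :=
          (hJ t i hi (Or.inl (Ne.symm hkt))).trans (hυt i hi)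
        rw [← g1, ← g2]
        simp [FExpr.val, NExpr.val, gp.n, g33, g32, g12, hc, mat]
      · intro ω _ hω j hj i hi
        refine (hω j i hi).trans ?_
        by_cases h1 : j = k
        · rw [if_pos h1, if_pos (by omega), h1]
        · rw [if_neg h1]
          refine (hI j hj i hi).trans ?_
          by_cases h' : j < k ∧ j ≠ t
          · rw [if_pos h', if_pos (by omega)]
          · rw [if_neg h', if_neg (by omega)]
  · intro υ hg hυ
    have hυt : ∀ i < p.n, mat p υ t i = mat p σ t i * c := fun i hi => by
      rw [hυ t htr i hi, if_neg (by simp), hτt i hi]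
    have hυj : ∀ j < p.r, j ≠ t → ∀ i < p.n, mat p υ j i =
        mat p σ j i - mat p σ j i₀ * (mat p σ t i * c) := fun j hj hjt i hi => by
      rw [hυ j hj i hi, if_pos ⟨hj, hjt⟩]
    refine ⟨hυt, fun j hj hjt i hi => ?_, fun j hj i hi => ?_⟩
    · rw [hυt i hi, hυj j hj hjt i hi]
    · by_cases hjt : j = t
      · rw [hjt, hυt i hi]; exact (h2Y i hi).trans (by omega)
      · rw [hυj j hj hjt i hi]; exact h4Y j hj i hi

/-- Each of the at most `r` pivots multiplies the heights by at most `4`. The crude bound `4^r`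
suffices, being of the order of the square of `(d+1)^r`. -/
theorem gaussProg_spec (hh : Height ht) {σ : Store F} (hp : HasParams p σ) (hM : p.Fits M) {X : ℕ}
    (hX : ∀ j < p.r, ∀ i < p.n, ht (mat p σ j i) ≤ X) (hW : 4 ^ p.r * X ≤ W) :
    Tr ht M W gaussProg σ fun τ => Reduced p (mat p σ) p.r (mat p τ) (τ.nat 5) ∧
      ∀ j < p.r, ∀ i < p.n, ht (mat p τ j i) ≤ 4 ^ p.r * X := by
  refine Tr.forN p.r (fun t τ => Reduced p (mat p σ) t (mat p τ) (τ.nat 5) ∧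
      ∀ j < p.r, ∀ i < p.n, ht (mat p τ j i) ≤ 4 ^ t * X) rfl hp.r hM.r ?_ ?_ fun τ _ h => h
  · refine ⟨⟨fun j hj => absurd hj (by omega), fun j hj => ⟨fun k => if k = j then 1 else 0,
      fun i hi => ?_⟩⟩, fun j hj i hi => (hX j hj i hi).trans (by simp)⟩
    simp [hj, mat]
  · intro t τ htr hf hc hI
    have hp' : HasParams p τ := hp.of_eq (hf.nat 0 rfl)
    have hle : 4 ^ t * X ≤ 4 ^ (t + 1) * X := Nat.mul_le_mul_right _
      (Nat.pow_le_pow_right (by norm_num) (by omega))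
    refine Tr.seq ((pivProg_spec hp' hM hc).mono ?_)
    rintro υ hg ⟨h5, hpiv⟩
    have e32 : υ.nat 32 0 = t := by rw [hg.nat 32 rfl, hc]
    have em : mat p υ = mat p τ := by unfold mat; rw [hg.fld 1 rfl]
    have hz : (NExpr.get 5 (nv 32)).val υ = υ.nat 5 t := by simp [NExpr.val, e32]
    refine Tr.ifZeroN (fun h => Tr.skip ?_) fun h => ?_
    · rw [hz] at h
      rw [setN_nat_ne _ _ _ (by decide)]
      have e' : mat p (υ.setN 32 0 (t + 1)) = mat p τ := em
      rw [e']
      refine ⟨⟨fun j hj => ?_, hI.1.span⟩, fun j hj i hi => (hI.2 j hj i hi).trans hle⟩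
      rcases Nat.lt_succ_iff_lt_or_eq.1 hj with hj | rfl
      · rw [h5 j (by omega)]; exact hI.1.row j hj
      · rcases hpiv with hpiv | ⟨i, -, hi, -⟩
        · exact Or.inl hpiv
        · omega
    · rw [hz] at h
      obtain ⟨i₀, hi₀, hpt, hne⟩ := hpiv.resolve_left fun h' => h h'.1
      refine (elimProg_spec hh (hp'.of_eq (hg.nat 0 rfl)) hM htr hi₀ e32 hpt
        (Y := 4 ^ t * X) (by rw [em]; exact hI.2) ?_).mono ?_
      · refine le_trans ?_ hW
        calc 4 * (4 ^ t * X) = 4 ^ (t + 1) * X := by ring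
          _ ≤ 4 ^ p.r * X := Nat.mul_le_mul_right _ (Nat.pow_le_pow_right (by norm_num) htr)
      · rintro ω hg' ⟨h1, h2, h3⟩
        rw [em] at h1 h2
        rw [setN_nat_ne _ _ _ (by decide)]
        refine ⟨hI.1.step htr hi₀ hne h1 h2 (fun j hj => ?_) ?_, fun j hj i hi => ?_⟩
        · rw [hg'.nat 5 rfl, h5 j (by omega)]
        · rw [hg'.nat 5 rfl, hpt]
        · refine (h3 j hj i hi).trans (le_of_eq ?_)
          ring

end

/-! ### Values of powers of the variables -/

/-- The degree of the generator in variable `i` (variable `16`), into variable `17`. -/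
def degProg : Prog :=
  .seq (.setN 17 (.lit 0) (.lit 0))
    (forN 18 bE (.ifZeroF (.get 2 (.add (.mul bE (nv 16)) (nv 18))) .skip
      (.setN 17 (.lit 0) (nv 18))))

/-- One step of the linear recurrence for the values of `x_i ^ k` modulo `p_i`. -/
def recProg : Prog :=
  .seq (.setF 7 (.lit 0) .zero) (.seq
    (forN 19 (nv 17) (.setF 7 (.lit 0) (.sub (fv 7) (.mul
      (.get 2 (.add (.mul bE (nv 16)) (nv 19)))
      (.get 6 (.add (.mul hE (nv 16)) (.add (.sub (nv 18) (nv 17)) (nv 19))))))))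
    (.setF 6 (.add (.mul hE (nv 16)) (nv 18))
      (.mul (fv 7) (.inv (.get 2 (.add (.mul bE (nv 16)) (nv 17)))))))

def valProg : Prog :=
  forN 16 nE (.seq degProg (forN 18 hE (.ifZeroN (.sub (nv 17) (nv 18)) recProg
    (.ifZeroN (nv 18) (.setF 6 (.add (.mul hE (nv 16)) (nv 18)) .one)
      (.setF 6 (.add (.mul hE (nv 16)) (nv 18)) (.mul (.get 3 (nv 16))
        (.get 6 (.add (.mul hE (nv 16)) (.sub (nv 18) (.lit 1))))))))))

/-- Pascal's triangle. -/
def chooseProg : Prog :=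
  forN 20 bE (forN 21 bE (.ifZeroN (nv 21)
    (.setF 8 (.add (.mul bE (nv 20)) (nv 21)) .one)
    (.ifZeroN (nv 20) (.setF 8 (.add (.mul bE (nv 20)) (nv 21)) .zero)
      (.setF 8 (.add (.mul bE (nv 20)) (nv 21)) (.add
        (.get 8 (.add (.mul bE (.sub (nv 20) (.lit 1))) (.sub (nv 21) (.lit 1))))
        (.get 8 (.add (.mul bE (.sub (nv 20) (.lit 1))) (nv 21))))))))

/-! ### Correctness of the tables of reduced powers and binomial coefficients. -/

section

variable {F : Type u} [Field F] {ht : F → ℕ} {M W : ℕ} {p : Params}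

abbrev Params.H (p : Params) : ℕ := p.r * p.d + 1

/-- The sequences of values of the powers of the variables modulo the generators with coefficients
`c i`, of degrees `D i`, at the point `pt`. -/
structure PowRec (p : Params) (c : ℕ → ℕ → F) (pt : ℕ → F) (D : ℕ → ℕ) (h : ℕ → ℕ → F) : Prop where
  deg_le : ∀ i < p.n, D i ≤ p.d
  lead : ∀ i < p.n, c i (D i) ≠ 0
  above : ∀ i < p.n, ∀ k ≤ p.d, D i < k → c i k = 0
  zero : ∀ i < p.n, 0 < D i → h i 0 = 1
  succ : ∀ i < p.n, ∀ k, k + 1 < D i → h i (k + 1) = pt i * h i k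
  step : ∀ i < p.n, ∀ k, D i ≤ k → k < p.H → h i k =
    (0 - ∑ j ∈ Finset.range (D i), c i j * h i (k - D i + j)) * (c i (D i))⁻¹

theorem degProg_spec {σ : Store F} (hp : HasParams p σ) (hM : p.Fits M) {c : ℕ → ℕ → F}
    {pt : ℕ → F} {D : ℕ → ℕ} {h : ℕ → ℕ → F} (hR : PowRec p c pt D h) {i : ℕ} (hi : i < p.n)
    (h16 : σ.nat 16 0 = i) (hc : ∀ k < p.B, σ.fld 2 (p.B * i + k) = c i k) :
    Tr ht M W degProg σ fun τ => τ.nat 17 0 = D i := by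
  refine Tr.seq (Tr.setN (Nat.zero_le _) ?_)
  -- The stored index bounds all indices of nonzero coefficients seen so far, and is itself one of
  -- them unless it is still `0`. The default `0` is right for a nonzero constant.
  refine Tr.forN p.B (fun N τ => (∀ j < N, c i j ≠ 0 → j ≤ τ.nat 17 0) ∧
    (τ.nat 17 0 = 0 ∨ (τ.nat 17 0 < N ∧ c i (τ.nat 17 0) ≠ 0))) rfl ?_ hM.d ?_ ?_ ?_
  · simp only [NExpr.val]; rw [setN_nat_ne _ _ _ (by decide), setN_nat_ne _ _ _ (by decide), hp.d]
  · exact ⟨fun j hj => absurd hj (by omega), Or.inl (by simp [setN_nat_ne, NExpr.val])⟩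
  · intro k τ hk hf h18 hI
    have hp' : HasParams p τ := hp.of_eq ((hf.nat 0 rfl).trans rfl)
    have e16 : τ.nat 16 0 = i := by rw [hf.nat 16 rfl]; exact h16
    have hv : (FExpr.get 2 (.add (.mul bE (nv 16)) (nv 18))).val τ = c i k := by
      simp only [FExpr.val, NExpr.val, hp'.d, e16, h18, hf.fld 2 rfl]
      exact hc k hk
    refine Tr.ifZeroF (fun h => Tr.skip ?_) fun h => ?_
    · rw [hv] at h
      rw [setN_nat_ne _ _ _ (by decide)]
      refine ⟨fun j hj hj' => ?_, hI.2.imp id fun h' => ⟨by omega, h'.2⟩⟩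
      rcases Nat.lt_succ_iff_lt_or_eq.1 hj with hj | rfl
      · exact hI.1 j hj hj'
      · exact absurd h hj'
    · rw [hv] at h
      have := hM.d
      simp only [Params.B] at hk
      refine Tr.setN (by simp only [NExpr.val, h18]; omega) ?_
      rw [setN_nat_ne _ _ _ (by decide), setN_nat_self]
      simp only [NExpr.val, h18, Function.update_self]
      exact ⟨fun j hj _ => by omega, Or.inr ⟨by omega, h⟩⟩
  · rintro τ - ⟨h1, h2⟩
    have := hR.deg_le i hi
    refine le_antisymm ?_ (h1 _ (by simp only [Params.B]; omega) (hR.lead i hi))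
    rcases h2 with h2 | ⟨h2, h3⟩
    · omega
    · by_contra hlt
      exact h3 (hR.above i hi _ (by simp only [Params.B] at h2; omega) (by omega))

/-- A partial sum has at most `d` products of height `X + Y`, and `hW` has room for the initial zero
and the subtraction. The result after division is `h i k`, whose height is bounded by `hY` directly
and not through the sum. -/
theorem recProg_spec (hh : Height ht) {σ : Store F} (hp : HasParams p σ) (hM : p.Fits M)
    {c : ℕ → ℕ → F} {pt : ℕ → F} {D : ℕ → ℕ} {h : ℕ → ℕ → F} (hR : PowRec p c pt D h) {i k : ℕ}
    (hi : i < p.n) (h16 : σ.nat 16 0 = i) (h17 : σ.nat 17 0 = D i) (h18 : σ.nat 18 0 = k)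
    (hk : k < p.H) (hDk : D i ≤ k) (hc : ∀ k < p.B, σ.fld 2 (p.B * i + k) = c i k)
    (h6 : ∀ j < k, σ.fld 6 (p.H * i + j) = h i j) {X Y : ℕ}
    (hX : ∀ k < p.B, ht (c i k) ≤ X) (hY : ∀ k < p.H, ht (h i k) ≤ Y)
    (hW : (p.d + 2) * (X + Y) ≤ W) :
    Tr ht M W recProg σ fun τ => τ.fld 6 = Function.update (σ.fld 6) (p.H * i + k) (h i k) := by
  have hD := hR.deg_le i hi
  set t : ℕ → F := fun j => c i j * h i (k - D i + j) with ht0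
  have htX : ∀ j < D i, ht (t j) ≤ X + Y := fun j hj => by
    show ht (c i j * h i (k - D i + j)) ≤ X + Y
    have := hh.mul_le (c i j) (h i (k - D i + j))
    have := hX j (by simp only [Params.B]; omega)
    have := hY (k - D i + j) (by omega)
    omega
  have h0X : ht 0 ≤ X := (hh.zero_le _).trans (hX 0 (by simp [Params.B]))
  have hsum : ∀ N ≤ D i, ht (0 - ∑ j ∈ Finset.range N, t j) ≤ W := by
    intro N hN
    have h1 := hh.sub_le 0 (∑ j ∈ Finset.range N, t j)
    have h2 := hh.sum_le (X := X + Y) t N (fun k hk => htX k (by omega)) (by omega)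
    have h3 : (N + 1) * (X + Y) ≤ (p.d + 1) * (X + Y) := by gcongr; omega
    nlinarith
  refine Tr.seq (Tr.setF (by show ht 0 ≤ W; nlinarith) (Tr.seq ?_))
  refine Tr.forN (D i) (fun N τ => τ.fld 7 0 = 0 - ∑ j ∈ Finset.range N, t j) rfl h17
    (by have := hM.d; omega) (by simp [NExpr.val, FExpr.val]) ?_ ?_
  · intro j τ hj hf h19 hI
    have hp' : HasParams p τ := hp.of_eq ((hf.nat 0 rfl).trans rfl)
    have e16 : τ.nat 16 0 = i := by rw [hf.nat 16 rfl]; exact h16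
    have e17 : τ.nat 17 0 = D i := by rw [hf.nat 17 rfl]; exact h17
    have e18 : τ.nat 18 0 = k := by rw [hf.nat 18 rfl]; exact h18
    have e2 : τ.fld 2 (p.B * i + j) = c i j := by
      rw [hf.fld 2 rfl]; exact hc j (by simp only [Params.B]; omega)
    have e6 : τ.fld 6 (p.H * i + (k - D i + j)) = h i (k - D i + j) := by
      rw [hf.fld 6 rfl]; exact h6 _ (by omega)
    have hv : (FExpr.sub (fv 7) (.mul
      (.get 2 (.add (.mul bE (nv 16)) (nv 19)))
      (.get 6 (.add (.mul hE (nv 16)) (.add (.sub (nv 18) (nv 17)) (nv 19)))))).val τ =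
        0 - ∑ j ∈ Finset.range (j + 1), t j := by
      simp only [FExpr.val, NExpr.val, hI, hp'.d, hp'.r, e16, e17, e18, h19, e2, e6]
      rw [Finset.sum_range_succ]
      simp only [t]
      ring
    refine Tr.setF (by rw [hv]; exact hsum _ hj) ?_
    rw [hv]
    simp [NExpr.val]
  · intro τ hf hI
    have hp' : HasParams p τ := hp.of_eq ((hf.nat 0 rfl).trans rfl)
    have e16 : τ.nat 16 0 = i := by rw [hf.nat 16 rfl]; exact h16
    have e17 : τ.nat 17 0 = D i := by rw [hf.nat 17 rfl]; exact h17
    have e18 : τ.nat 18 0 = k := by rw [hf.nat 18 rfl]; exact h18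
    have e2 : τ.fld 2 (p.B * i + D i) = c i (D i) := by
      rw [hf.fld 2 rfl]; exact hc _ (by simp only [Params.B]; omega)
    have hv : (FExpr.mul (fv 7) (.inv (.get 2 (.add (.mul bE (nv 16)) (nv 17))))).val τ = h i k := by
      simp only [FExpr.val, NExpr.val, hI, hp'.d, e16, e17, e2]
      rw [hR.step i hi k hDk hk]
    refine Tr.setF (by rw [hv]; have := hY k hk; nlinarith) ?_
    rw [hv, setF_fld_self, hf.fld 6 rfl]
    simp only [NExpr.val, hp'.d, hp'.r, e16, e18]
    rfl

theorem valProg_spec (hh : Height ht) {σ : Store F} (hp : HasParams p σ) (hM : p.Fits M)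
    {c : ℕ → ℕ → F} {pt : ℕ → F} {D : ℕ → ℕ} {h : ℕ → ℕ → F} (hR : PowRec p c pt D h)
    (hc : ∀ i < p.n, ∀ k < p.B, σ.fld 2 (p.B * i + k) = c i k)
    (hpt : ∀ i < p.n, σ.fld 3 i = pt i) {X Y : ℕ}
    (hX : ∀ i < p.n, ∀ k < p.B, ht (c i k) ≤ X) (hY : ∀ i < p.n, ∀ k < p.H, ht (h i k) ≤ Y)
    (hW : (p.d + 2) * (X + Y) ≤ W) :
    Tr ht M W valProg σ fun τ => ∀ i < p.n, ∀ k < p.H, τ.fld 6 (p.H * i + k) = h i k := by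
  refine Tr.forN p.n (fun N τ => ∀ i < N, ∀ k < p.H, τ.fld 6 (p.H * i + k) = h i k) rfl hp.n hM.n
    (fun i hi => absurd hi (by omega)) ?_ fun τ _ h => h
  intro i τ hi hf h16 hI
  have hp' : HasParams p τ := hp.of_eq (hf.nat 0 rfl)
  have hcτ : ∀ k < p.B, τ.fld 2 (p.B * i + k) = c i k := by rw [hf.fld 2 rfl]; exact hc i hi
  refine Tr.seq ((degProg_spec hp' hM hR hi h16 hcτ).mono ?_)
  intro υ hg h17
  have hpυ : HasParams p υ := hp'.of_eq (hg.nat 0 rfl)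
  refine Tr.forN p.H (fun N τ => (∀ i' < i, ∀ k < p.H, τ.fld 6 (p.H * i' + k) = h i' k) ∧
    ∀ k < N, τ.fld 6 (p.H * i + k) = h i k) rfl ?_ hM.h ?_ ?_ ?_
  · simp only [NExpr.val]; rw [setN_nat_ne _ _ _ (by decide), hpυ.r, hpυ.d]
  · exact ⟨fun i' hi' k hk => (congrFun (hg.fld 6 rfl) _).trans (hI i' hi' k hk),
      fun k hk => absurd hk (by omega)⟩
  · intro k ω hk hf' h18 hJ
    have hpω : HasParams p ω := hpυ.of_eq (hf'.nat 0 rfl)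
    have e16 : ω.nat 16 0 = i := by rw [hf'.nat 16 rfl, hg.nat 16 rfl, h16]
    have e17 : ω.nat 17 0 = D i := by rw [hf'.nat 17 rfl, h17]
    have e2 : ∀ k < p.B, ω.fld 2 (p.B * i + k) = c i k := by
      rw [hf'.fld 2 rfl, hg.fld 2 rfl]; exact hcτ
    have e3 : ω.fld 3 i = pt i := by rw [hf'.fld 3 rfl, hg.fld 3 rfl, hf.fld 3 rfl, hpt i hi]
    have hYk := hY i hi k hk
    have hYW : Y ≤ W := by nlinarith
    have fin (ψ : Store F) (e6 : ψ.fld 6 = Function.update (ω.fld 6) (p.H * i + k) (h i k)) :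
        (∀ i' < i, ∀ k < p.H, ψ.fld 6 (p.H * i' + k) = h i' k) ∧
          ∀ j < k + 1, ψ.fld 6 (p.H * i + j) = h i j := by
      rw [e6]
      refine ⟨fun i' hi' k' hk' => ?_, fun j hj => ?_⟩
      · rw [Function.update_apply, if_neg, hJ.1 i' hi' k' hk']
        rw [mul_add_inj hk' hk]; omega
      · rw [Function.update_apply]
        split_ifs with h'
        · rw [((mul_add_inj (by omega) hk).1 h').2]
        · exact hJ.2 j (by rcases Nat.lt_succ_iff_lt_or_eq.1 hj with h'' | h''
                           · exact h''
                           · exact absurd (by rw [h'']) h')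
    have hidx : (NExpr.add (.mul hE (nv 16)) (nv 18)).val ω = p.H * i + k := by
      simp only [NExpr.val, hpω.d, hpω.r, e16, h18]
    refine Tr.ifZeroN (fun hz => ?_) fun hz => Tr.ifZeroN (fun hz' => ?_) fun hz' => ?_
    · simp only [NExpr.val, e17, h18] at hz
      exact (recProg_spec hh hpω hM hR hi e16 e17 h18 hk (by omega) e2 hJ.2 (hX i hi) (hY i hi)
        hW).mono fun ψ _ h6 => fin _ h6
    · simp only [NExpr.val, e17, h18] at hz hz'
      have hv : FExpr.one.val ω = h i k := by rw [hz', hR.zero i hi (by omega)]; rfl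
      refine Tr.setF (by rw [hv]; omega) (fin _ ?_)
      rw [hv, hidx, setN_fld, setF_fld_self]
    · simp only [NExpr.val, e17, h18] at hz hz'
      obtain ⟨k', rfl⟩ : ∃ k', k = k' + 1 := ⟨k - 1, by omega⟩
      have hv : (FExpr.mul (.get 3 (nv 16))
          (.get 6 (.add (.mul hE (nv 16)) (.sub (nv 18) (.lit 1))))).val ω = h i (k' + 1) := by
        have := hJ.2 k' (by omega)
        simp only [FExpr.val, NExpr.val, hpω.d, hpω.r, e16, h18, Nat.add_sub_cancel, e3]
        rw [hR.succ i hi k' (by omega), ← this]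
      refine Tr.setF (by rw [hv]; omega) (fin _ ?_)
      rw [hv, hidx, setN_fld, setF_fld_self]
  · intro ω _ hJ i' hi' k hk
    rcases Nat.lt_succ_iff_lt_or_eq.1 hi' with h' | h'
    · exact hJ.1 i' h' k hk
    · rw [h']; exact hJ.2 k hk

/-- Pascal's rule works in every characteristic, while factorials need not be invertible in `F`. -/
theorem chooseProg_spec {σ : Store F} (hp : HasParams p σ) (hM : p.Fits M)
    (hW : ∀ m < p.B, ∀ k < p.B, ht (Nat.choose m k : F) ≤ W) :
    Tr ht M W chooseProg σ fun τ => ∀ m < p.B, ∀ k < p.B,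
      τ.fld 8 (p.B * m + k) = (Nat.choose m k : F) := by
  refine Tr.forN p.B (fun N τ => ∀ m < N, ∀ k < p.B, τ.fld 8 (p.B * m + k) = (Nat.choose m k : F))
    rfl ?_ hM.d (fun i hi => absurd hi (by omega)) ?_ fun τ _ h => h
  · simp only [NExpr.val]; rw [setN_nat_ne _ _ _ (by decide), hp.d]
  intro m τ hm hf h20 hI
  have hp' : HasParams p τ := hp.of_eq (hf.nat 0 rfl)
  refine Tr.forN p.B (fun N τ => (∀ m' < m, ∀ k < p.B, τ.fld 8 (p.B * m' + k) = (Nat.choose m' k : F))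
    ∧ ∀ k < N, τ.fld 8 (p.B * m + k) = (Nat.choose m k : F)) rfl ?_ hM.d
    ⟨hI, fun k hk => absurd hk (by omega)⟩ ?_ ?_
  · simp only [NExpr.val]; rw [setN_nat_ne _ _ _ (by decide), hp'.d]
  · intro k ω hk hf' h21 hJ
    have hpω : HasParams p ω := hp'.of_eq (hf'.nat 0 rfl)
    have e20 : ω.nat 20 0 = m := by rw [hf'.nat 20 rfl, h20]
    have hidx : (NExpr.add (.mul bE (nv 20)) (nv 21)).val ω = p.B * m + k := by
      simp only [NExpr.val, hpω.d, e20, h21]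
    have fin (e : FExpr) (he : e.val ω = (Nat.choose m k : F)) :
        Tr ht M W (.setF 8 (.add (.mul bE (nv 20)) (nv 21)) e) ω fun τ =>
          (∀ m' < m, ∀ k < p.B, (τ.setN 21 0 (k + 1)).fld 8 (p.B * m' + k) = (Nat.choose m' k : F))
          ∧ ∀ j < k + 1, (τ.setN 21 0 (k + 1)).fld 8 (p.B * m + j) = (Nat.choose m j : F) := by
      refine Tr.setF (by rw [he]; exact hW m hm k hk) ?_
      rw [he, hidx]
      simp only [setN_fld, setF_fld_self]
      refine ⟨fun i' hi' k' hk' => ?_, fun j hj => ?_⟩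
      · rw [Function.update_apply, if_neg, hJ.1 i' hi' k' hk']
        rw [mul_add_inj hk' hk]; omega
      · rw [Function.update_apply]
        split_ifs with h'
        · rw [((mul_add_inj (by omega) hk).1 h').2]
        · exact hJ.2 j (by rcases Nat.lt_succ_iff_lt_or_eq.1 hj with h'' | h''
                           · exact h''
                           · exact absurd (by rw [h'']) h')
    refine Tr.ifZeroN (fun hz => ?_) fun hz => Tr.ifZeroN (fun hz' => ?_) fun hz' => ?_
    · simp only [NExpr.val, h21] at hz
      exact fin _ (by simp [hz, FExpr.val])
    · simp only [NExpr.val, h21, e20] at hz hz'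
      refine fin _ ?_
      obtain ⟨k', rfl⟩ : ∃ k', k = k' + 1 := ⟨k - 1, by omega⟩
      simp [hz', FExpr.val]
    · simp only [NExpr.val, h21, e20] at hz hz'
      refine fin _ ?_
      obtain ⟨k', rfl⟩ : ∃ k', k = k' + 1 := ⟨k - 1, by omega⟩
      obtain ⟨m', rfl⟩ : ∃ m', m = m' + 1 := ⟨m - 1, by omega⟩
      simp only [FExpr.val, NExpr.val, hpω.d, h21, e20, Nat.add_sub_cancel]
      rw [Nat.choose_succ_succ, Nat.cast_add]
      congr 1
      · exact hJ.1 m' (by omega) k' (by omega)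
      · exact hJ.1 m' (by omega) (k' + 1) hk
  · intro ω _ hJ i' hi' k hk
    rcases Nat.lt_succ_iff_lt_or_eq.1 hi' with h' | h'
    · exact hJ.1 i' h' k hk
    · rw [h']; exact hJ.2 k hk

end

/-! ### The values of the products of the linear forms -/

/-- The powers of the coefficients of variable `i` (variable `22`). -/
def apowProg : Prog :=
  forN 23 rE (forN 24 bE (.ifZeroN (nv 24)
    (.setF 10 (.add (.mul bE (nv 23)) (nv 24)) .one)
    (.setF 10 (.add (.mul bE (nv 23)) (nv 24)) (.mul
      (.get 10 (.add (.mul bE (nv 23)) (.sub (nv 24) (.lit 1))))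
      (.get 1 (.add (.mul nE (nv 23)) (nv 22)))))))

/-- The coefficient of the contribution of monomial `k` (variable `26`) to monomial `m`
(variable `25`), and the degree of `k`. -/
def coefProg : Prog :=
  .seq (.setF 11 (.lit 0) .one) (.seq (.setN 27 (.lit 0) (.lit 0))
    (forN 28 rE (.seq
      (.setF 11 (.lit 0) (.mul (fv 11) (.mul
        (.get 8 (.add (.mul bE (digE (nv 25) (nv 28))) (digE (nv 26) (nv 28))))
        (.get 10 (.add (.mul bE (nv 28)) (digE (nv 26) (nv 28)))))))
      (.setN 27 (.lit 0) (.add (nv 27) (digE (nv 26) (nv 28)))))))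

def phiStepProg : Prog :=
  forN 25 kE (.seq (.setF 7 (.lit 0) .zero) (.seq
    (forN 26 kE (.seq coefProg (.setF 7 (.lit 0) (.add (fv 7) (.mul
      (.mul (fv 11) (.get 6 (.add (.mul hE (nv 22)) (nv 27))))
      (.get 9 (.add (.mul kE (nv 22)) (.sub (nv 25) (nv 26)))))))))
    (.setF 9 (.add (.mul kE (.add (nv 22) (.lit 1))) (nv 25)) (fv 7))))

def phiProg : Prog :=
  .seq (forN 25 kE (.ifZeroN (nv 25) (.setF 9 (nv 25) .one) (.setF 9 (nv 25) .zero)))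
    (forN 22 nE (.seq apowProg phiStepProg))

/-- Pair the coefficients at the output gate with the values of the monomials. -/
def finalProg : Prog :=
  .seq (.setF 7 (.lit 0) .zero) (.seq
    (forN 25 kE (.setF 7 (.lit 0) (.add (fv 7) (.mul
      (.get 5 (.add (.mul kE outE) (nv 25)))
      (.get 9 (.add (.mul kE nE) (nv 25)))))))
    (.setF 4 (.lit 0) (fv 7)))

theorem dig_lt {B : ℕ} (hB : 0 < B) (x j : ℕ) : dig B x j < B := Nat.mod_lt _ hB

/-! ### Correctness of the recursion over the variables and of the final pairing. -/

section

variable {F : Type u} [Field F] {ht : F → ℕ} {M W : ℕ} {p : Params}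

/-- The digit sum. -/
def digSum (p : Params) (k : ℕ) : ℕ := ∑ j ∈ Finset.range p.r, dig p.B k j

/-- The coefficient with which monomial `k` in variable `i` contributes to monomial `m`. -/
def coefU (p : Params) (A h : ℕ → ℕ → F) (i m k : ℕ) : F :=
  (∏ j ∈ Finset.range p.r,
    ((Nat.choose (dig p.B m j) (dig p.B k j) : F) * A j i ^ dig p.B k j)) * h i (digSum p k)

/-- The recursion for the values of the products of powers of the linear forms. -/
structure PhiRec (p : Params) (A h Φ : ℕ → ℕ → F) : Prop where
  zero : ∀ m < p.K, Φ 0 m = if m = 0 then 1 else 0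
  succ : ∀ i < p.n, ∀ m < p.K, Φ (i + 1) m =
    ∑ k ∈ Finset.range p.K, coefU p A h i m k * Φ i (m - k)

theorem digSum_lt (k : ℕ) : digSum p k < p.H := by
  have : digSum p k ≤ ∑ _j ∈ Finset.range p.r, p.d :=
    Finset.sum_le_sum fun j _ => by
      have := dig_lt (B := p.B) (by simp [Params.B]) k j
      simp only [Params.B] at this ⊢; omega
  simp only [Finset.sum_const, Finset.card_range, smul_eq_mul] at this
  simp only [Params.H]; omega

theorem apowProg_spec {σ : Store F} (hp : HasParams p σ) (hM : p.Fits M) {i : ℕ}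
    (h22 : σ.nat 22 0 = i)
    (hW : ∀ j < p.r, ∀ e < p.B, ht (mat p σ j i ^ e) ≤ W) :
    Tr ht M W apowProg σ fun τ => ∀ j < p.r, ∀ e < p.B,
      τ.fld 10 (p.B * j + e) = mat p σ j i ^ e := by
  refine Tr.forN p.r (fun N τ => ∀ j < N, ∀ e < p.B, τ.fld 10 (p.B * j + e) = mat p σ j i ^ e)
    rfl hp.r hM.r (fun i hi => absurd hi (by omega)) ?_ fun τ _ h => h
  intro j τ hj hf h23 hI
  have hp' : HasParams p τ := hp.of_eq (hf.nat 0 rfl)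
  refine Tr.forN p.B (fun N τ => (∀ j' < j, ∀ e < p.B, τ.fld 10 (p.B * j' + e) = mat p σ j' i ^ e)
    ∧ ∀ e < N, τ.fld 10 (p.B * j + e) = mat p σ j i ^ e) rfl ?_ hM.d
    ⟨hI, fun k hk => absurd hk (by omega)⟩ ?_ ?_
  · simp only [NExpr.val]; rw [setN_nat_ne _ _ _ (by decide), hp'.d]
  · intro e ω he hf' h24 hJ
    have hpω : HasParams p ω := hp'.of_eq (hf'.nat 0 rfl)
    have e23 : ω.nat 23 0 = j := by rw [hf'.nat 23 rfl, h23]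
    have e22 : ω.nat 22 0 = i := by rw [hf'.nat 22 rfl, hf.nat 22 rfl, h22]
    have e1 : ω.fld 1 = σ.fld 1 := by rw [hf'.fld 1 rfl, hf.fld 1 rfl]
    have hidx : (NExpr.add (.mul bE (nv 23)) (nv 24)).val ω = p.B * j + e := by
      simp only [NExpr.val, hpω.d, e23, h24]
    have fin (E : FExpr) (hE : E.val ω = mat p σ j i ^ e) :
        Tr ht M W (.setF 10 (.add (.mul bE (nv 23)) (nv 24)) E) ω fun τ =>
          (∀ j' < j, ∀ k < p.B, (τ.setN 24 0 (e + 1)).fld 10 (p.B * j' + k) = mat p σ j' i ^ k)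
          ∧ ∀ k < e + 1, (τ.setN 24 0 (e + 1)).fld 10 (p.B * j + k) = mat p σ j i ^ k := by
      refine Tr.setF (by rw [hE]; exact hW j hj e he) ?_
      rw [hE, hidx]
      simp only [setN_fld, setF_fld_self]
      refine ⟨fun i' hi' k' hk' => ?_, fun k hk => ?_⟩
      · rw [Function.update_apply, if_neg, hJ.1 i' hi' k' hk']
        rw [mul_add_inj hk' he]; omega
      · rw [Function.update_apply]
        split_ifs with h'
        · rw [((mul_add_inj (by omega) he).1 h').2]
        · exact hJ.2 k (by rcases Nat.lt_succ_iff_lt_or_eq.1 hk with h'' | h''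
                           · exact h''
                           · exact absurd (by rw [h'']) h')
    refine Tr.ifZeroN (fun hz => ?_) fun hz => ?_
    · simp only [NExpr.val, h24] at hz
      exact fin _ (by simp [hz, FExpr.val])
    · simp only [NExpr.val, h24] at hz
      refine fin _ ?_
      obtain ⟨e', rfl⟩ : ∃ e', e = e' + 1 := ⟨e - 1, by omega⟩
      have := hJ.2 e' (by omega)
      simp only [FExpr.val, NExpr.val, hpω.d, hpω.n, h24, e22, e23, Nat.add_sub_cancel, this, e1]
      rw [pow_succ]; rfl
  · intro ω _ hJ i' hi' k hk
    rcases Nat.lt_succ_iff_lt_or_eq.1 hi' with h' | h'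
    · exact hJ.1 i' h' k hk
    · rw [h']; exact hJ.2 k hk

theorem coefProg_spec (hh : Height ht) {σ : Store F} (hp : Ctx p σ) (hM : p.Fits M) {m k : ℕ}
    (h25 : σ.nat 25 0 = m) (h26 : σ.nat 26 0 = k) {a : ℕ → ℕ → F}
    (h8 : ∀ m < p.B, ∀ k < p.B, σ.fld 8 (p.B * m + k) = (Nat.choose m k : F))
    (h10 : ∀ j < p.r, ∀ e < p.B, σ.fld 10 (p.B * j + e) = a j e) {Z : ℕ}
    (hZ : ∀ m < p.B, ∀ k < p.B, ∀ j < p.r, ht ((Nat.choose m k : F) * a j k) ≤ Z)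
    (hZ1 : ht (1 : F) ≤ Z)
    (hW : (p.r + 1) * Z ≤ W) :
    Tr ht M W coefProg σ fun τ => τ.nat 27 0 = digSum p k ∧
      τ.fld 11 0 = ∏ j ∈ Finset.range p.r,
        ((Nat.choose (dig p.B m j) (dig p.B k j) : F) * a j (dig p.B k j)) := by
  set t : ℕ → F := fun j => (Nat.choose (dig p.B m j) (dig p.B k j) : F) * a j (dig p.B k j) with ht0
  have hB : 0 < p.B := by simp [Params.B]
  have hprod : ∀ N ≤ p.r, ht (∏ j ∈ Finset.range N, t j) ≤ W := by
    intro N hN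
    refine (hh.prod_le t N (fun j hj => hZ _ (dig_lt hB _ _) _ (dig_lt hB _ _) j (by omega))
      ((hh.zero_le _).trans hZ1)).trans (le_trans ?_ hW)
    gcongr
  refine Tr.seq (Tr.setF (by show ht 1 ≤ W; nlinarith) (Tr.seq (Tr.setN (Nat.zero_le _) ?_)))
  refine Tr.forN p.r (fun N τ => τ.nat 27 0 = ∑ j ∈ Finset.range N, dig p.B k j ∧
    τ.fld 11 0 = ∏ j ∈ Finset.range N, t j) rfl hp.r hM.r ⟨rfl, ?_⟩ ?_ fun τ _ h => h
  · simp [NExpr.val, FExpr.val]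
  rintro j τ hj hf h28 ⟨hI, hJ⟩
  have hp' : Ctx p τ := hp.of_eq ((hf.nat 0 rfl).trans rfl) ((hf.nat 6 rfl).trans rfl)
  have e25 : τ.nat 25 0 = m := by rw [hf.nat 25 rfl]; exact h25
  have e26 : τ.nat 26 0 = k := by rw [hf.nat 26 rfl]; exact h26
  have e8 : τ.fld 8 = σ.fld 8 := hf.fld 8 rfl
  have e10 : τ.fld 10 = σ.fld 10 := hf.fld 10 rfl
  have d1 : (digE (nv 25) (nv 28)).val τ = dig p.B m j := by
    simp [NExpr.val, e25, h28, hp'.pw j hj.le, hp'.d, dig]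
  have d2 : (digE (nv 26) (nv 28)).val τ = dig p.B k j := by
    simp [NExpr.val, e26, h28, hp'.pw j hj.le, hp'.d, dig]
  have hv : (FExpr.mul (fv 11) (.mul
        (.get 8 (.add (.mul bE (digE (nv 25) (nv 28))) (digE (nv 26) (nv 28))))
        (.get 10 (.add (.mul bE (nv 28)) (digE (nv 26) (nv 28)))))).val τ =
      ∏ j ∈ Finset.range (j + 1), t j := by
    rw [Finset.prod_range_succ]
    have f8 : (FExpr.get 8 (.add (.mul bE (digE (nv 25) (nv 28))) (digE (nv 26) (nv 28)))).val τ =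
        (Nat.choose (dig p.B m j) (dig p.B k j) : F) := by
      rw [← h8 _ (dig_lt hB _ _) _ (dig_lt hB _ _), ← e8, ← d1, ← d2]
      simp only [FExpr.val, NExpr.val, hp'.d]
    have f10 : (FExpr.get 10 (.add (.mul bE (nv 28)) (digE (nv 26) (nv 28)))).val τ =
        a j (dig p.B k j) := by
      rw [← h10 j hj _ (dig_lt hB _ _), ← e10, ← d2]
      simp only [FExpr.val, NExpr.val, hp'.d, h28]
    show τ.fld 11 0 * (_ * _) = _
    rw [f8, f10, hJ]
  refine Tr.seq (Tr.setF (by rw [hv]; exact hprod _ hj) ?_)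
  rw [hv]
  have hv' : (NExpr.add (nv 27) (digE (nv 26) (nv 28))).val
      (τ.setF 11 ((NExpr.lit 0).val τ) (∏ j ∈ Finset.range (j + 1), t j)) =
      ∑ j ∈ Finset.range (j + 1), dig p.B k j := by
    rw [Finset.sum_range_succ, ← hI, ← d2]
    simp only [NExpr.val, setF_nat]
  refine Tr.setN ?_ ?_
  · rw [hv']
    have h1 : ∑ j ∈ Finset.range (j + 1), dig p.B k j ≤ digSum p k :=
      Finset.sum_le_sum_of_subset (Finset.range_subset_range.2 hj)
    have h2 := digSum_lt (p := p) k
    have h3 := hM.h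
    simp only [Params.H] at h2
    omega
  · rw [hv', setN_nat_ne _ _ _ (by decide)]
    simp [NExpr.val]

/-- Row `i + 1` of array `9` is computed from row `i` alone. The hypotheses on heights are put on
the summands, since every partial sum passes through the accumulator. -/
theorem phiStepProg_spec (hh : Height ht) {σ : Store F} (hp : Ctx p σ) (hM : p.Fits M) {i : ℕ}
    (h22 : σ.nat 22 0 = i) (hi : i < p.n) {A h Φ : ℕ → ℕ → F} (hΦ : PhiRec p A h Φ)
    (h8 : ∀ m < p.B, ∀ k < p.B, σ.fld 8 (p.B * m + k) = (Nat.choose m k : F))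
    (h10 : ∀ j < p.r, ∀ e < p.B, σ.fld 10 (p.B * j + e) = A j i ^ e)
    (h6 : ∀ k < p.H, σ.fld 6 (p.H * i + k) = h i k)
    (h9 : ∀ i' ≤ i, ∀ m < p.K, σ.fld 9 (p.K * i' + m) = Φ i' m) {Z V : ℕ}
    (hZ : ∀ m < p.B, ∀ k < p.B, ∀ j < p.r, ht ((Nat.choose m k : F) * A j i ^ k) ≤ Z)
    (hZ1 : ht (1 : F) ≤ Z) (hW : (p.r + 1) * Z ≤ W)
    (hV : ∀ m < p.K, ∀ k < p.K, ht (coefU p A h i m k * Φ i (m - k)) ≤ V)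
    (hW' : (p.K + 1) * V ≤ W) (hV0 : ht (0 : F) ≤ V) :
    Tr ht M W phiStepProg σ fun τ => ∀ i' ≤ i + 1, ∀ m < p.K, τ.fld 9 (p.K * i' + m) = Φ i' m := by
  refine Tr.forN p.K (fun N τ => (∀ i' < i + 1, ∀ m < p.K, τ.fld 9 (p.K * i' + m) = Φ i' m) ∧
    ∀ m < N, τ.fld 9 (p.K * (i + 1) + m) = Φ (i + 1) m) rfl ?_ hM.K ?_ ?_ ?_
  · show (σ.nat 6 (σ.nat 0 1)) = _
    rw [hp.r, hp.K]
  · exact ⟨fun i' hi' => h9 i' (by omega), fun m hm => absurd hm (by omega)⟩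
  · intro m τ hm hf h25 hI
    have hp' : Ctx p τ := hp.of_eq (hf.nat 0 rfl) (hf.nat 6 rfl)
    set t : ℕ → F := fun k => coefU p A h i m k * Φ i (m - k) with ht0
    have hsum : ∀ N ≤ p.K, ht (∑ k ∈ Finset.range N, t k) ≤ W := by
      intro N hN
      refine (hh.sum_le t N (fun k hk => hV m hm k (by omega)) hV0).trans (le_trans ?_ hW')
      gcongr
    refine Tr.seq (Tr.setF (by show ht 0 ≤ W; nlinarith) (Tr.seq ?_))
    refine Tr.forN p.K (fun N υ => υ.fld 7 0 = ∑ k ∈ Finset.range N, t k) rfl ?_ hM.K ?_ ?_ ?_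
    · show (τ.nat 6 (τ.nat 0 1)) = _
      rw [hp'.r, hp'.K]
    · simp [NExpr.val, FExpr.val]
    · intro k υ hk hg h26 hJ
      have hpυ : Ctx p υ := hp'.of_eq ((hg.nat 0 rfl).trans rfl) ((hg.nat 6 rfl).trans rfl)
      have e25 : υ.nat 25 0 = m := by rw [hg.nat 25 rfl]; exact h25
      have e8 : υ.fld 8 = σ.fld 8 := by rw [hg.fld 8 rfl]; exact hf.fld 8 rfl
      have e10 : υ.fld 10 = σ.fld 10 := by rw [hg.fld 10 rfl]; exact hf.fld 10 rfl
      refine Tr.seq ((coefProg_spec hh hpυ hM e25 h26 (by rw [e8]; exact h8)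
        (by rw [e10]; exact h10) hZ hZ1 hW).mono ?_)
      rintro ω hf' ⟨h27, h11⟩
      have hpω : Ctx p ω := hpυ.of_eq (hf'.nat 0 rfl) (hf'.nat 6 rfl)
      have g22 : ω.nat 22 0 = i := by
        rw [hf'.nat 22 rfl, hg.nat 22 rfl]; exact (congrFun (hf.nat 22 rfl) 0).trans h22
      have g25 : ω.nat 25 0 = m := by rw [hf'.nat 25 rfl, e25]
      have g26 : ω.nat 26 0 = k := by rw [hf'.nat 26 rfl, h26]
      have g7 : ω.fld 7 0 = ∑ k ∈ Finset.range k, t k := by rw [hf'.fld 7 rfl, hJ]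
      have g6 : ω.fld 6 (p.H * i + digSum p k) = h i (digSum p k) := by
        rw [hf'.fld 6 rfl, hg.fld 6 rfl]
        exact (congrFun (hf.fld 6 rfl) _).trans (h6 _ (digSum_lt k))
      have g9 : ω.fld 9 (p.K * i + (m - k)) = Φ i (m - k) := by
        rw [hf'.fld 9 rfl, hg.fld 9 rfl]
        exact hI.1 i (by omega) _ (by omega)
      have hv : (FExpr.add (fv 7) (.mul
          (.mul (fv 11) (.get 6 (.add (.mul hE (nv 22)) (nv 27))))
          (.get 9 (.add (.mul kE (nv 22)) (.sub (nv 25) (nv 26)))))).val ω =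
          ∑ k ∈ Finset.range (k + 1), t k := by
        simp only [FExpr.val, NExpr.val, g7, h11, hpω.r, hpω.d, hpω.K, g22, h27, g25, g26, g6, g9]
        rw [Finset.sum_range_succ]
        rfl
      refine Tr.setF (by rw [hv]; exact hsum _ hk) ?_
      rw [hv]
      simp [NExpr.val]
    · intro υ hg hJ
      have hpυ : Ctx p υ := hp'.of_eq ((hg.nat 0 rfl).trans rfl) ((hg.nat 6 rfl).trans rfl)
      have e25 : υ.nat 25 0 = m := by rw [hg.nat 25 rfl]; exact h25
      have g22 : υ.nat 22 0 = i := by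
        rw [hg.nat 22 rfl]; exact (congrFun (hf.nat 22 rfl) 0).trans h22
      have hv : (fv 7).val υ = Φ (i + 1) m := by
        rw [hΦ.succ i hi m hm, ← hJ]; rfl
      refine Tr.setF (by rw [hv, hΦ.succ i hi m hm]; exact hsum _ le_rfl) ?_
      have hidx : (NExpr.add (.mul kE (.add (nv 22) (.lit 1))) (nv 25)).val υ =
          p.K * (i + 1) + m := by
        simp only [NExpr.val, hpυ.r, hpυ.K, g22, e25]
      have e9 : υ.fld 9 = τ.fld 9 := hg.fld 9 rfl
      rw [hv, hidx, setN_fld, setF_fld_self, e9]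
      refine ⟨fun i' hi' k' hk' => ?_, fun k hk => ?_⟩
      · rw [Function.update_apply, if_neg, hI.1 i' hi' k' hk']
        rw [mul_add_inj hk' hm]; omega
      · rw [Function.update_apply]
        split_ifs with h'
        · rw [((mul_add_inj (by omega) hm).1 h').2]
        · exact hI.2 k (by rcases Nat.lt_succ_iff_lt_or_eq.1 hk with h'' | h''
                           · exact h''
                           · exact absurd (by rw [h'']) h')
  · intro τ _ hI i' hi' m hm
    rcases Nat.lt_succ_iff_lt_or_eq.1 (Nat.lt_succ_of_le hi') with h' | h'
    · exact hI.1 i' h' m hm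
    · rw [h']; exact hI.2 m hm

theorem phiProg_spec (hh : Height ht) {σ : Store F} (hp : Ctx p σ) (hM : p.Fits M)
    {h Φ : ℕ → ℕ → F} (hΦ : PhiRec p (mat p σ) h Φ)
    (h8 : ∀ m < p.B, ∀ k < p.B, σ.fld 8 (p.B * m + k) = (Nat.choose m k : F))
    (h6 : ∀ i < p.n, ∀ k < p.H, σ.fld 6 (p.H * i + k) = h i k) {Z V : ℕ}
    (hA : ∀ i < p.n, ∀ j < p.r, ∀ e < p.B, ht (mat p σ j i ^ e) ≤ Z)
    (hZ : ∀ i < p.n, ∀ m < p.B, ∀ k < p.B, ∀ j < p.r,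
      ht ((Nat.choose m k : F) * mat p σ j i ^ k) ≤ Z)
    (hZ1 : ht (1 : F) ≤ Z) (hW : (p.r + 1) * Z ≤ W)
    (hV : ∀ i < p.n, ∀ m < p.K, ∀ k < p.K, ht (coefU p (mat p σ) h i m k * Φ i (m - k)) ≤ V)
    (hW' : (p.K + 1) * V ≤ W) (hV0 : ht (0 : F) ≤ V) :
    Tr ht M W phiProg σ fun τ => ∀ i ≤ p.n, ∀ m < p.K, τ.fld 9 (p.K * i + m) = Φ i m := by
  have hZW : Z ≤ W := by nlinarith
  refine Tr.seq (Tr.forN p.K (fun N τ => ∀ m < N, τ.fld 9 m = Φ 0 m) rfl ?_ hM.K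
    (fun m hm => absurd hm (by omega)) ?_ ?_)
  · show (σ.nat 6 (σ.nat 0 1)) = _
    rw [hp.r, hp.K]
  · intro m τ hm hf h25 hI
    have fin (e : FExpr) (he : e.val τ = Φ 0 m) (hW : ht (e.val τ) ≤ W) :
        Tr ht M W (.setF 9 (nv 25) e) τ fun τ' =>
          ∀ k < m + 1, (τ'.setN 25 0 (m + 1)).fld 9 k = Φ 0 k := by
      refine Tr.setF hW ?_
      intro k hk
      rw [he, setN_fld, setF_fld_self, Function.update_apply]
      simp only [NExpr.val, h25]
      split_ifs with h'
      · rw [h']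
      · exact hI k (by omega)
    refine Tr.ifZeroN (fun hz => ?_) fun hz => ?_
    · simp only [NExpr.val, h25] at hz
      exact fin _ (by rw [hΦ.zero m hm, if_pos hz]; rfl) (hZ1.trans hZW)
    · simp only [NExpr.val, h25] at hz
      exact fin _ (by rw [hΦ.zero m hm, if_neg hz]; rfl) ((hh.zero_le 1).trans (hZ1.trans hZW))
  · intro σ' hf0 h0
    have hp0 : Ctx p σ' := hp.of_eq (hf0.nat 0 rfl) (hf0.nat 6 rfl)
    have em : mat p σ' = mat p σ := by unfold mat; rw [hf0.fld 1 rfl]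
    refine Tr.forN p.n (fun N τ => ∀ i ≤ N, ∀ m < p.K, τ.fld 9 (p.K * i + m) = Φ i m) rfl
      hp0.n hM.n ?_ ?_ fun τ _ h => h
    · intro i hi m hm
      obtain rfl : i = 0 := by omega
      simpa using h0 m hm
    · intro i τ hi hf h22 hI
      have hpτ : Ctx p τ := hp0.of_eq (hf.nat 0 rfl) (hf.nat 6 rfl)
      have emτ : mat p τ = mat p σ := by rw [← em]; unfold mat; rw [hf.fld 1 rfl]
      refine Tr.seq ((apowProg_spec hpτ.toHasParams hM h22
        (by rw [emτ]; exact fun j hj e he => (hA i hi j hj e he).trans hZW)).mono ?_)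
      rw [emτ]
      intro υ hg h10
      have hpυ : Ctx p υ := hpτ.of_eq (hg.nat 0 rfl) (hg.nat 6 rfl)
      refine (phiStepProg_spec hh hpυ hM (by rw [hg.nat 22 rfl, h22]) hi hΦ ?_ h10 ?_ ?_
        (hZ i hi) hZ1 hW (hV i hi) hW' hV0).mono fun _ _ h => h
      · rw [hg.fld 8 rfl, hf.fld 8 rfl, hf0.fld 8 rfl]; exact h8
      · rw [hg.fld 6 rfl, hf.fld 6 rfl, hf0.fld 6 rfl]; exact h6 i hi
      · rw [hg.fld 9 rfl]; exact hI

theorem finalProg_spec (hh : Height ht) {σ : Store F} (hp : Ctx p σ) (hM : p.Fits M)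
    {g f : ℕ → F} (h5 : ∀ m < p.K, σ.fld 5 (p.K * p.out + m) = g m)
    (h9 : ∀ m < p.K, σ.fld 9 (p.K * p.n + m) = f m) {V : ℕ}
    (hV : ∀ m < p.K, ht (g m * f m) ≤ V) (hV0 : ht (0 : F) ≤ V) (hW : (p.K + 1) * V ≤ W) :
    Tr ht M W finalProg σ fun τ => τ.fld 4 0 = ∑ m ∈ Finset.range p.K, g m * f m := by
  have hsum : ∀ N ≤ p.K, ht (∑ k ∈ Finset.range N, g k * f k) ≤ W := by
    intro N hN
    refine (hh.sum_le _ N (fun k hk => hV k (by omega)) hV0).trans (le_trans ?_ hW)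
    gcongr
  refine Tr.seq (Tr.setF (by have := hsum 0 (Nat.zero_le _); rwa [Finset.sum_range_zero] at this) (Tr.seq ?_))
  refine Tr.forN p.K (fun N υ => υ.fld 7 0 = ∑ k ∈ Finset.range N, g k * f k) rfl ?_ hM.K ?_ ?_ ?_
  · show (σ.nat 6 (σ.nat 0 1)) = _
    rw [hp.r, hp.K]
  · simp [NExpr.val, FExpr.val]
  · intro m τ hm hf h25 hI
    have hp' : Ctx p τ := hp.of_eq ((hf.nat 0 rfl).trans rfl) ((hf.nat 6 rfl).trans rfl)
    have e5 : τ.fld 5 (p.K * p.out + m) = g m := (congrFun (hf.fld 5 rfl) _).trans (h5 m hm)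
    have e9 : τ.fld 9 (p.K * p.n + m) = f m := (congrFun (hf.fld 9 rfl) _).trans (h9 m hm)
    have hv : (FExpr.add (fv 7) (.mul
        (.get 5 (.add (.mul kE outE) (nv 25)))
        (.get 9 (.add (.mul kE nE) (nv 25))))).val τ =
        ∑ k ∈ Finset.range (m + 1), g k * f k := by
      simp only [FExpr.val, NExpr.val, hI, hp'.r, hp'.n, hp'.out, hp'.K, h25, e5, e9]
      rw [Finset.sum_range_succ]
    refine Tr.setF (by rw [hv]; exact hsum _ hm) ?_
    rw [hv]
    simp [NExpr.val]
  · intro τ _ hI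
    have hv : (fv 7).val τ = ∑ k ∈ Finset.range p.K, g k * f k := hI
    refine Tr.setF (by rw [hv]; exact hsum _ le_rfl) ?_
    rw [hv, setF_fld_self]
    simp [NExpr.val]

end

/-! ### Normal forms modulo a univariate ideal -/

section

variable {F : Type u} [Field F]

/-- The remainder modulo `q` as a linear map. -/
def modHom (q : Polynomial F) : Polynomial F →ₗ[F] Polynomial F :=
  Polynomial.modByMonicHom (q * Polynomial.C q.leadingCoeff⁻¹)

/-- Division by `q` is defined as division by its monic multiple, so the remainder inherits
linearity from `Polynomial.modByMonicHom`. -/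
theorem modHom_apply (q f : Polynomial F) : modHom q f = f % q := rfl

theorem mod_eq_sum_range {q : Polynomial F} (hq : q ≠ 0) (f : Polynomial F) :
    f % q = ∑ k ∈ Finset.range q.natDegree, Polynomial.monomial k ((f % q).coeff k) := by
  ext k
  rw [Polynomial.finsetSum_coeff]
  simp only [Polynomial.coeff_monomial, Finset.sum_ite_eq', Finset.mem_range]
  split_ifs with h
  · rfl
  · apply Polynomial.coeff_eq_zero_of_degree_lt
    refine (Polynomial.degree_mod_lt f hq).trans_le ?_
    rw [Polynomial.degree_eq_natDegree hq]
    exact_mod_cast not_lt.1 h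

variable {n : ℕ} (p : Fin n → Polynomial F)

/-- The normal form of a monomial. -/
def redMono (e : Fin n →₀ ℕ) : MvPolynomial (Fin n) F :=
  ∏ i, Polynomial.aeval (MvPolynomial.X i) ((Polynomial.X ^ e i : Polynomial F) % p i)

/-- The normal form, as a linear map. -/
def normal : MvPolynomial (Fin n) F →ₗ[F] MvPolynomial (Fin n) F :=
  (MvPolynomial.basisMonomials (Fin n) F).constr F (redMono p)

theorem monomial_eq_smul_basis (e : Fin n →₀ ℕ) (c : F) :
    MvPolynomial.monomial e c = c • MvPolynomial.basisMonomials (Fin n) F e := by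
  simp [MvPolynomial.coe_basisMonomials, MvPolynomial.smul_monomial]

theorem normal_monomial (e : Fin n →₀ ℕ) (c : F) :
    normal p (MvPolynomial.monomial e c) = c • redMono p e := by
  rw [monomial_eq_smul_basis, map_smul, normal, Module.Basis.constr_basis]

theorem aeval_X_monomial (i : Fin n) (k : ℕ) (a : F) :
    Polynomial.aeval (MvPolynomial.X i : MvPolynomial (Fin n) F) (Polynomial.monomial k a) =
      MvPolynomial.monomial (Finsupp.single i k) a := by
  rw [Polynomial.aeval_monomial, ← MvPolynomial.C_mul_X_pow_eq_monomial]
  rfl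

/-- A factor in `x_i` alone changes only the `i`-th univariate remainder. Both sides are linear in
`Q`, so monomials suffice. -/
theorem normal_monomial_mul_aeval (e : Fin n →₀ ℕ) (c : F) (i : Fin n) (Q : Polynomial F) :
    normal p (MvPolynomial.monomial e c * Polynomial.aeval (MvPolynomial.X i) Q) =
      c • (Polynomial.aeval (MvPolynomial.X i) ((Polynomial.X ^ e i * Q) % p i) *
        ∏ j ∈ Finset.univ.erase i,
          Polynomial.aeval (MvPolynomial.X j) ((Polynomial.X ^ e j : Polynomial F) % p j)) := by
  induction Q using Polynomial.induction_on' with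
  | add f g hf hg =>
    rw [map_add, mul_add, map_add, hf, hg, mul_add, Polynomial.add_mod, map_add, add_mul, smul_add]
  | monomial k a =>
    rw [aeval_X_monomial, MvPolynomial.monomial_mul, normal_monomial, redMono,
      ← Finset.mul_prod_erase _ _ (Finset.mem_univ i)]
    have h1 : (Polynomial.X ^ e i * Polynomial.monomial k a : Polynomial F) =
        a • Polynomial.X ^ (e i + k) := by
      rw [← Polynomial.C_mul_X_pow_eq_monomial, Polynomial.smul_eq_C_mul]; ring
    have h2 : (a • Polynomial.X ^ (e i + k) : Polynomial F) % p i =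
        a • ((Polynomial.X ^ (e i + k) : Polynomial F) % p i) := by
      rw [← modHom_apply, ← modHom_apply, map_smul]
    rw [h1, h2, map_smul, smul_mul_assoc, smul_smul]
    congr 2
    · simp
    · refine Finset.prod_congr rfl fun j hj => ?_
      have : j ≠ i := Finset.ne_of_mem_erase hj
      simp [Ne.symm this]

/-- On a multiple of `p_i` the `i`-th factor is the remainder of a multiple of `p_i`, which is zero.
-/
theorem normal_eq_zero {q : MvPolynomial (Fin n) F} (hq : q ∈ univIdeal p) : normal p q = 0 := by
  obtain ⟨c, rfl⟩ := Ideal.mem_span_range_iff_exists_fun.1 hq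
  rw [map_sum]
  refine Finset.sum_eq_zero fun i _ => ?_
  induction c i using MvPolynomial.induction_on' with
  | monomial e a =>
    rw [normal_monomial_mul_aeval, EuclideanDomain.mod_eq_zero.2 (dvd_mul_left _ _)]
    simp
  | add f g hf hg => rw [add_mul, map_add, hf, hg, add_zero]

/-- In the quotient by the ideal, `x_i^(e_i)` and its remainder modulo `p_i` agree, hence so do
their products. -/
theorem sub_normal_mem (f : MvPolynomial (Fin n) F) : f - normal p f ∈ univIdeal p := by
  induction f using MvPolynomial.induction_on' with
  | add f g hf hg =>
    rw [map_add, add_sub_add_comm]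
    exact Ideal.add_mem _ hf hg
  | monomial e c =>
    rw [normal_monomial, ← Ideal.Quotient.eq]
    have h (i : Fin n) : Ideal.Quotient.mk (univIdeal p) (Polynomial.aeval (MvPolynomial.X i)
        ((Polynomial.X ^ e i : Polynomial F) % p i)) =
        Ideal.Quotient.mk (univIdeal p) (MvPolynomial.X i ^ e i) := by
      have h1 := congrArg (Polynomial.aeval (MvPolynomial.X i : MvPolynomial (Fin n) F))
        (EuclideanDomain.mod_add_div (Polynomial.X ^ e i) (p i))
      rw [map_add, map_mul, map_pow, Polynomial.aeval_X] at h1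
      rw [← h1, map_add, map_mul]
      have : Ideal.Quotient.mk (univIdeal p) (Polynomial.aeval (MvPolynomial.X i) (p i)) = 0 :=
        Ideal.Quotient.eq_zero_iff_mem.2 (Ideal.subset_span ⟨i, rfl⟩)
      rw [this]; simp
    rw [MvPolynomial.monomial_eq, MvPolynomial.smul_eq_C_mul, map_mul, map_mul, redMono, map_prod]
    simp_rw [h]
    rw [← map_prod, Finsupp.prod_fintype _ _ (by simp)]

/-- Expanding the product, each monomial arises by choosing in every variable one exponent of a
remainder modulo `p_i`. -/
theorem lt_natDegree_of_mem_support_redMono (hp : ∀ i, p i ≠ 0) {e m : Fin n →₀ ℕ}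
    (hm : m ∈ (redMono p e).support) (i : Fin n) : m i < (p i).natDegree := by
  classical
  rw [MvPolynomial.mem_support_iff] at hm
  have h1 : redMono p e = ∏ i, ∑ k ∈ Finset.range (p i).natDegree, MvPolynomial.monomial
      (Finsupp.single i k) (((Polynomial.X ^ e i : Polynomial F) % p i).coeff k) := by
    refine Finset.prod_congr rfl fun i _ => ?_
    conv_lhs => rw [mod_eq_sum_range (hp i)]
    rw [map_sum]
    exact Finset.sum_congr rfl fun k _ => aeval_X_monomial i k _
  rw [h1, Finset.prod_univ_sum, MvPolynomial.coeff_sum] at hm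
  obtain ⟨x, hx, hne⟩ := Finset.exists_ne_zero_of_sum_ne_zero hm
  have h2 : ∏ i, MvPolynomial.monomial (Finsupp.single i (x i))
      (((Polynomial.X ^ e i : Polynomial F) % p i).coeff (x i)) =
      MvPolynomial.monomial (∑ i, Finsupp.single i (x i))
        (∏ i, ((Polynomial.X ^ e i : Polynomial F) % p i).coeff (x i)) := by
    rw [MvPolynomial.monomial_sum_index, map_prod]
    simp only [← Finset.prod_mul_distrib]
    refine Finset.prod_congr rfl fun i _ => ?_
    rw [MvPolynomial.C_mul_monomial, mul_one]
  rw [h2, MvPolynomial.coeff_monomial] at hne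
  have h3 : ∑ i, Finsupp.single i (x i) = m := by
    by_contra h; rw [if_neg h] at hne; exact hne rfl
  have h4 : m i = x i := by
    rw [← h3, Finsupp.finsetSum_apply]
    simp [Finsupp.single_apply]
  rw [h4]
  exact Finset.mem_range.1 (Fintype.mem_piFinset.1 hx i)

theorem lt_natDegree_of_mem_support_normal (hp : ∀ i, p i ≠ 0) (f : MvPolynomial (Fin n) F)
    {m : Fin n →₀ ℕ} (hm : m ∈ (normal p f).support) (i : Fin n) : m i < (p i).natDegree := by
  rw [f.as_sum, map_sum, MvPolynomial.mem_support_iff, MvPolynomial.coeff_sum] at hm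
  obtain ⟨e, -, he⟩ := Finset.exists_ne_zero_of_sum_ne_zero hm
  rw [normal_monomial, MvPolynomial.coeff_smul, smul_eq_mul] at he
  exact lt_natDegree_of_mem_support_redMono p hp
    (MvPolynomial.mem_support_iff.2 (right_ne_zero_of_mul he)) i

theorem X_pow_mod {q : Polynomial F} (hq : q ≠ 0) {k : ℕ} (hk : k < q.natDegree) :
    (Polynomial.X ^ k : Polynomial F) % q = Polynomial.X ^ k := by
  rw [Polynomial.mod_eq_self_iff hq, Polynomial.degree_X_pow, Polynomial.degree_eq_natDegree hq]
  exact_mod_cast hk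

theorem normal_eq_self (hp : ∀ i, p i ≠ 0) {R : MvPolynomial (Fin n) F}
    (hR : ∀ i, ∀ m ∈ R.support, m i < (p i).natDegree) : normal p R = R := by
  conv_lhs => rw [R.as_sum, map_sum]
  conv_rhs => rw [R.as_sum]
  refine Finset.sum_congr rfl fun m hm => ?_
  rw [normal_monomial, redMono, MvPolynomial.monomial_eq, MvPolynomial.smul_eq_C_mul,
    Finsupp.prod_fintype _ _ (by simp)]
  congr 1
  refine Finset.prod_congr rfl fun i _ => ?_
  rw [X_pow_mod (hp i) (hR i m hm), map_pow, Polynomial.aeval_X]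

theorem isRemainder_normal (hp : ∀ i, p i ≠ 0) (f : MvPolynomial (Fin n) F) :
    IsRemainder p f (normal p f) :=
  ⟨sub_normal_mem p f, fun i _ hm => lt_natDegree_of_mem_support_normal p hp f hm i⟩

/-- The map `normal` kills `f - R` and fixes `R`. -/
theorem IsRemainder.eq_normal {p : Fin n → Polynomial F} (hp : ∀ i, p i ≠ 0)
    {f R : MvPolynomial (Fin n) F} (h : IsRemainder p f R) : R = normal p f := by
  have h1 := normal_eq_zero p h.1
  rw [map_sub, normal_eq_self p hp h.2, sub_eq_zero] at h1
  exact h1.symm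

/-- The value at `a` of `x ^ k` modulo `q`. -/
def powVal (q : Polynomial F) (a : F) (k : ℕ) : F :=
  ((Polynomial.X ^ k : Polynomial F) % q).eval a

theorem eval_normal (pt : Fin n → F) (f : MvPolynomial (Fin n) F) :
    MvPolynomial.eval pt (normal p f) =
      ∑ e ∈ f.support, f.coeff e * ∏ i, powVal (p i) (pt i) (e i) := by
  conv_lhs => rw [f.as_sum, map_sum, map_sum]
  refine Finset.sum_congr rfl fun e _ => ?_
  rw [normal_monomial, MvPolynomial.smul_eval, redMono, map_prod]
  congr 1
  refine Finset.prod_congr rfl fun i _ => ?_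
  rw [powVal, ← Polynomial.coe_aeval_eq_eval, ← MvPolynomial.coe_aeval_eq_eval]
  show (MvPolynomial.aeval pt) _ = _
  rw [← Polynomial.aeval_algHom_apply, MvPolynomial.aeval_X]

/-! ### The recurrence for the values of powers -/

theorem powVal_of_lt {q : Polynomial F} (hq : q ≠ 0) (a : F) {k : ℕ} (hk : k < q.natDegree) :
    powVal q a k = a ^ k := by
  rw [powVal, X_pow_mod hq hk, Polynomial.eval_pow, Polynomial.eval_X]

/-- The polynomial `X^m * q` has remainder zero; expand it and use that the remainder is linear. -/
theorem sum_coeff_mul_powVal (q : Polynomial F) (a : F) (m : ℕ) :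
    ∑ j ∈ Finset.range (q.natDegree + 1), q.coeff j * powVal q a (m + j) = 0 := by
  have h1 : ((Polynomial.X ^ m * q) % q).eval a = 0 := by
    rw [EuclideanDomain.mod_eq_zero.2 (dvd_mul_left _ _), Polynomial.eval_zero]
  have h2 : (Polynomial.X ^ m * q : Polynomial F) =
      ∑ j ∈ Finset.range (q.natDegree + 1), q.coeff j • (Polynomial.X ^ (m + j) : Polynomial F) := by
    conv_lhs => rw [q.as_sum_range_C_mul_X_pow]
    rw [Finset.mul_sum]
    refine Finset.sum_congr rfl fun j _ => ?_
    rw [Polynomial.smul_eq_C_mul]; ring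
  have h3 : (Polynomial.X ^ m * q : Polynomial F) % q =
      ∑ j ∈ Finset.range (q.natDegree + 1), q.coeff j • ((Polynomial.X ^ (m + j) : Polynomial F) % q) := by
    rw [h2, ← modHom_apply, map_sum]
    simp only [map_smul, modHom_apply]
  rw [h3, Polynomial.eval_finsetSum] at h1
  simpa only [Polynomial.eval_smul, smul_eq_mul, powVal] using h1

/-- For a nonzero constant `q` the sum is empty and the value is `0`, in accordance with the ideal
being everything. -/
theorem powVal_step {q : Polynomial F} (hq : q ≠ 0) (a : F) {k : ℕ} (hk : q.natDegree ≤ k) :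
    powVal q a k = (0 - ∑ j ∈ Finset.range q.natDegree,
      q.coeff j * powVal q a (k - q.natDegree + j)) * (q.coeff q.natDegree)⁻¹ := by
  have h := sum_coeff_mul_powVal q a (k - q.natDegree)
  rw [Finset.sum_range_succ, Nat.sub_add_cancel hk] at h
  have hl : q.coeff q.natDegree ≠ 0 := by simpa using hq
  rw [zero_sub, ← eq_neg_of_add_eq_zero_right h]
  field_simp

end

/-! ### Exponent vectors and their codes -/

/-- The exponent vector with code `x`. -/
def digF (B r x : ℕ) : Fin r →₀ ℕ := Finsupp.equivFunOnFinite.symm fun j => dig B x j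

@[simp] theorem digF_apply (B r x : ℕ) (j : Fin r) : digF B r x j = dig B x j := rfl

/-- The code of an exponent vector. -/
def cod {r : ℕ} (B : ℕ) (e : Fin r →₀ ℕ) : ℕ := ∑ j, e j * B ^ (j : ℕ)

section

variable {B r : ℕ}

theorem cod_lt {e : Fin r →₀ ℕ} (he : ∀ j, e j < B) : cod B e < B ^ r := by
  have := (finFunctionFinEquiv (fun j => (⟨e j, he j⟩ : Fin B))).isLt
  rwa [finFunctionFinEquiv_apply] at this

theorem digF_cod {e : Fin r →₀ ℕ} (he : ∀ j, e j < B) : digF B r (cod B e) = e := by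
  ext j
  have h := finFunctionFinEquiv.symm_apply_apply (fun j => (⟨e j, he j⟩ : Fin B))
  have h2 := congrArg Fin.val (congrFun h j)
  rw [finFunctionFinEquiv_symm_apply_val, finFunctionFinEquiv_apply] at h2
  exact h2

theorem cod_digF {x : ℕ} (hx : x < B ^ r) : cod B (digF B r x) = x := by
  have h := finFunctionFinEquiv.apply_symm_apply (⟨x, hx⟩ : Fin (B ^ r))
  have h2 := congrArg Fin.val h
  rw [finFunctionFinEquiv_apply] at h2
  simp only [finFunctionFinEquiv_symm_apply_val] at h2
  exact h2

theorem cod_add (e e' : Fin r →₀ ℕ) : cod B (e + e') = cod B e + cod B e' := by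
  simp [cod, add_mul, Finset.sum_add_distrib]

/-- Codes are additive, and the difference of the exponent vectors still has all entries below `B`.
-/
theorem digF_sub (hB : 0 < B) {x y : ℕ} (hx : x < B ^ r) (hy : y < B ^ r)
    (h : digF B r y ≤ digF B r x) : digF B r (x - y) = digF B r x - digF B r y := by
  have h1 : cod B (digF B r x - digF B r y) = x - y := by
    have := cod_add (B := B) (digF B r x - digF B r y) (digF B r y)
    rw [tsub_add_cancel_of_le h, cod_digF hx, cod_digF hy] at this
    omega
  rw [← h1, digF_cod]
  intro j
  exact (tsub_le_self).trans_lt (dig_lt hB _ _)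

theorem digF_le_iff {x y : ℕ} : digF B r y ≤ digF B r x ↔ ∀ j < r, dig B y j ≤ dig B x j :=
  ⟨fun h j hj => h ⟨j, hj⟩, fun h j => h j j.isLt⟩

-- If two exponent vectors add up to one with entries below `B`, their own entries are below `B`. So
-- the truncated coefficients of a product depend only on truncated coefficients of the factors,
-- however large the degrees are.
open Classical in
theorem coeff_digF_mul {F : Type u} [Field F] (hB : 0 < B) (P Q : MvPolynomial (Fin r) F) {x : ℕ}
    (hx : x < B ^ r) :
    (P * Q).coeff (digF B r x) = ∑ y ∈ Finset.range (B ^ r),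
      if ∀ j < r, dig B y j ≤ dig B x j then
        P.coeff (digF B r y) * Q.coeff (digF B r (x - y)) else 0 := by
  rw [MvPolynomial.coeff_mul, ← Finset.sum_filter]
  have hlt (a b : Fin r →₀ ℕ) (h : a + b = digF B r x) (j : Fin r) : a j < B :=
    lt_of_le_of_lt (by rw [← digF_apply B r x j, ← h]; simp) (dig_lt hB x j)
  refine Finset.sum_nbij' (fun a => cod B a.1) (fun y => (digF B r y, digF B r x - digF B r y))
    ?_ ?_ ?_ ?_ ?_
  · rintro ⟨a, b⟩ hab
    rw [Finset.HasAntidiagonal.mem_antidiagonal] at hab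
    have ha := hlt a b hab
    simp only [Finset.mem_filter, Finset.mem_range]
    refine ⟨cod_lt ha, digF_le_iff.1 ?_⟩
    rw [digF_cod ha, ← hab]
    exact le_self_add
  · intro y hy
    simp only [Finset.mem_filter, Finset.mem_range] at hy
    rw [Finset.HasAntidiagonal.mem_antidiagonal]
    exact add_tsub_cancel_of_le (digF_le_iff.2 hy.2)
  · rintro ⟨a, b⟩ hab
    rw [Finset.HasAntidiagonal.mem_antidiagonal] at hab
    simp only [digF_cod (hlt a b hab), ← hab, add_tsub_cancel_left]
  · intro y hy
    simp only [Finset.mem_filter, Finset.mem_range] at hy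
    exact cod_digF hy.1
  · rintro ⟨a, b⟩ hab
    rw [Finset.HasAntidiagonal.mem_antidiagonal] at hab
    have ha := hlt a b hab
    have hle : digF B r (cod B a) ≤ digF B r x := by
      rw [digF_cod ha, ← hab]; exact le_self_add
    simp only
    rw [digF_sub hB hx (cod_lt ha) hle, digF_cod ha, ← hab, add_tsub_cancel_left]

theorem digF_zero : digF B r 0 = 0 := by
  ext j; simp [dig]

theorem digF_pow (hB : 2 ≤ B) (j : Fin r) : digF B r (B ^ (j : ℕ)) = Finsupp.single j 1 := by
  have h : cod B (Finsupp.single j 1 : Fin r →₀ ℕ) = B ^ (j : ℕ) := by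
    simp [cod, Finsupp.single_apply]
  rw [← h, digF_cod]
  intro i
  rw [Finsupp.single_apply]
  split_ifs <;> omega

theorem digF_inj {x y : ℕ} (hx : x < B ^ r) (hy : y < B ^ r) : digF B r x = digF B r y ↔ x = y :=
  ⟨fun h => by rw [← cod_digF hx, h, cod_digF hy], fun h => by rw [h]⟩

end

/-! ### Substitution of the pivots and of the linear forms -/

section

variable {F : Type u} [Field F] {n r : ℕ}

open Classical in
/-- The substitution of `∑ y_j` over the rows `j` with pivot `i` for `x_i`. -/
def pivSubst (F : Type u) [Field F] (n r : ℕ) (piv : ℕ → ℕ) :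
    MvPolynomial (Fin n) F →ₐ[F] MvPolynomial (Fin r) F :=
  MvPolynomial.aeval fun i => ∑ j : Fin r, if piv j = i + 1 then MvPolynomial.X j else 0

theorem pivSubst_eq_killCompl {piv : ℕ → ℕ} {f : Fin r → Fin n} (hf : Function.Injective f)
    (h : ∀ j : Fin r, piv j = f j + 1) : pivSubst F n r piv = MvPolynomial.killCompl hf := by
  classical
  refine MvPolynomial.algHom_ext fun i => ?_
  rw [pivSubst, MvPolynomial.aeval_X, MvPolynomial.killCompl, MvPolynomial.aeval_X]
  have e (j : Fin r) : piv j = i + 1 ↔ f j = i := by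
    rw [h j, Fin.ext_iff]; omega
  simp only [e]
  split_ifs with hi
  · obtain ⟨j, rfl⟩ := hi
    rw [Equiv.ofInjective_symm_apply]
    simp [hf.eq_iff]
  · exact Finset.sum_eq_zero fun j _ => if_neg fun h' => hi ⟨j, h'⟩

/-- With distinct pivots, different variables never go to the same `y_j`, so no coefficients are
added up. The vector `e'` does not depend on `q`; preservation of its degree later shows that
truncation loses nothing of `f`. -/
theorem coeff_pivSubst {piv : ℕ → ℕ} (hn : ∀ j < r, piv j ≤ n)
    (hinj : ∀ j < r, ∀ j' < r, piv j ≠ 0 → piv j = piv j' → j = j') (e : Fin r →₀ ℕ) :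
    (∀ q, (pivSubst F n r piv q).coeff e = 0) ∨
      ∃ e' : Fin n →₀ ℕ, e'.degree = e.degree ∧ ∀ q, (pivSubst F n r piv q).coeff e = q.coeff e' := by
  classical
  let J := {j : Fin r // piv j ≠ 0}
  let f : J → Fin n := fun j => ⟨piv j.1 - 1, by have := hn j.1 j.1.isLt; have := j.2; omega⟩
  have hf : Function.Injective f := by
    rintro ⟨j, hj⟩ ⟨j', hj'⟩ h
    simp only [f, Fin.mk.injEq] at h
    exact Subtype.ext (Fin.ext (hinj j j.isLt j' j'.isLt hj (by omega)))
  -- Delete the variables that are no pivots, name the others by their rows, and include these rows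
  -- among all `r`.
  have hcomp : pivSubst F n r piv =
      (MvPolynomial.rename (Subtype.val : J → Fin r)).comp (MvPolynomial.killCompl hf) := by
    refine MvPolynomial.algHom_ext fun i => ?_
    rw [AlgHom.comp_apply, pivSubst, MvPolynomial.aeval_X, MvPolynomial.killCompl,
      MvPolynomial.aeval_X]
    split_ifs with hi
    · obtain ⟨j, rfl⟩ := hi
      rw [Equiv.ofInjective_symm_apply, MvPolynomial.rename_X, Finset.sum_eq_single j.1]
      · rw [if_pos]
        have := j.2
        simp only [f]; omega
      · intro j' _ hne
        rw [if_neg]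
        intro h'
        have := j.2
        simp only [f] at h'
        exact hne (Fin.ext (hinj j' j'.isLt j.1 j.1.isLt (by omega) (by omega)))
      · simp
    · rw [map_zero]
      refine Finset.sum_eq_zero fun j _ => if_neg fun h' => hi ⟨⟨j, by omega⟩, ?_⟩
      simp only [f]
      exact Fin.ext (by simp only; omega)
  by_cases he : ∃ v : J →₀ ℕ, v.mapDomain Subtype.val = e
  · obtain ⟨v, rfl⟩ := he
    refine Or.inr ⟨v.mapDomain f, ?_, fun q => ?_⟩
    · rw [Finsupp.degree_mapDomain, Finsupp.degree_mapDomain]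
    · rw [hcomp, AlgHom.comp_apply,
        MvPolynomial.coeff_rename_mapDomain _ Subtype.val_injective, MvPolynomial.coeff_killCompl]
  · refine Or.inl fun q => ?_
    rw [hcomp, AlgHom.comp_apply]
    exact MvPolynomial.coeff_rename_eq_zero _ _ _ fun v hv => absurd ⟨v, hv⟩ he

/-- The substitution of the linear forms with coefficient matrix `A`. -/
def formSubst (n r : ℕ) (A : ℕ → ℕ → F) : MvPolynomial (Fin r) F →ₐ[F] MvPolynomial (Fin n) F :=
  MvPolynomial.aeval fun j : Fin r => linForm fun i : Fin n => A j i

/-- The composite is an algebra homomorphism, so it is enough that it fixes the reduced rows, which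
span the given forms. Row `k` goes to `y_k`, having `1` in its own pivot column and `0` in the
others, and then back to itself. -/
theorem formSubst_pivSubst {p : Params} {A₀ A : ℕ → ℕ → F} {piv : ℕ → ℕ}
    (h : Reduced p A₀ p.r A piv) {q : MvPolynomial (Fin p.n) F}
    (hq : q ∈ Algebra.adjoin F
      (Set.range fun j : Fin p.r => linForm fun i : Fin p.n => A₀ j i)) :
    formSubst p.n p.r A (pivSubst F p.n p.r piv q) = q := by
  classical
  let E := AlgHom.equalizer ((formSubst p.n p.r A).comp (pivSubst F p.n p.r piv)) (AlgHom.id F _)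
  have hrow : ∀ k : Fin p.r, linForm (fun i : Fin p.n => A k i) ∈ E := by
    intro k
    rw [AlgHom.mem_equalizer, AlgHom.comp_apply, AlgHom.id_apply]
    rcases h.row k k.isLt with ⟨-, h2⟩ | ⟨i, hi, h1, h2, -⟩
    · have : linForm (fun i : Fin p.n => A k i) = 0 := by
        simp only [linForm]
        exact Finset.sum_eq_zero fun i _ => by rw [h2 i i.isLt]; simp
      rw [this, map_zero, map_zero]
    · have e : pivSubst F p.n p.r piv (linForm fun i : Fin p.n => A k i) = MvPolynomial.X k := by
        simp only [linForm, map_sum, map_mul, MvPolynomial.algHom_C, pivSubst,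
          MvPolynomial.aeval_X, Finset.mul_sum]
        rw [Finset.sum_comm, Finset.sum_eq_single k]
        · rw [Finset.sum_eq_single ⟨i, hi⟩]
          · rw [if_pos (by simpa using h1)]; simp [h2]
          · intro i' _ hne
            rw [if_neg, mul_zero]
            intro h'
            exact hne (Fin.ext (by simp only; omega))
          · simp
        · intro j _ hne
          refine Finset.sum_eq_zero fun i' _ => ?_
          split_ifs with h'
          · rcases h.row j j.isLt with ⟨h0, -⟩ | ⟨i'', _, h3, -, h4⟩
            · omega
            · obtain rfl : i'' = i' := by omega
              rw [h4 k k.isLt fun h => hne (Fin.ext h.symm)]; simp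
          · simp
        · simp
      rw [e, formSubst, MvPolynomial.aeval_X]
  have hle : Algebra.adjoin F (Set.range fun j : Fin p.r => linForm fun i : Fin p.n => A₀ j i) ≤ E := by
    rw [Algebra.adjoin_le_iff]
    rintro _ ⟨j, rfl⟩
    obtain ⟨c, hc⟩ := h.span j j.isLt
    have e : linForm (fun i : Fin p.n => A₀ j i) =
        ∑ k : Fin p.r, c k • linForm (fun i : Fin p.n => A k i) := by
      simp only [linForm, Finset.smul_sum]
      rw [Finset.sum_comm]
      refine Finset.sum_congr rfl fun i _ => ?_
      rw [hc i i.isLt, ← Fin.sum_univ_eq_sum_range (fun k => c k * A k i), map_sum, Finset.sum_mul]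
      refine Finset.sum_congr rfl fun k _ => ?_
      rw [MvPolynomial.smul_eq_C_mul, map_mul, mul_assoc]
    simp only [e]
    exact sum_mem fun k _ => Subalgebra.smul_mem _ (hrow k) _
  exact hle hq

end

/-! ### Partial evaluation of products of linear forms -/

section

variable {F : Type u} [Field F] {n : ℕ} (h : ℕ → ℕ → F)

/-- The linear functional `x^e ↦ ∏_{j < i} h j (e j)`. -/
def partVal (n : ℕ) (h : ℕ → ℕ → F) (i : ℕ) : MvPolynomial (Fin n) F →ₗ[F] F :=
  (MvPolynomial.basisMonomials (Fin n) F).constr F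
    fun e => ∏ j : Fin n, if (j : ℕ) < i then h j (e j) else 1

theorem partVal_monomial (i : ℕ) (e : Fin n →₀ ℕ) (c : F) :
    partVal n h i (MvPolynomial.monomial e c) =
      c * ∏ j : Fin n, if (j : ℕ) < i then h j (e j) else 1 := by
  rw [monomial_eq_smul_basis, map_smul, partVal, Module.Basis.constr_basis, smul_eq_mul]

/-- As `q` does not involve `x_i`, the exponent of `x_i` in each monomial of the product is `t`, and
the functional factors over the variables. -/
theorem partVal_succ {i : ℕ} (hi : i < n) (t : ℕ) {q : MvPolynomial (Fin n) F}
    (hq : q ∈ MvPolynomial.supported F {j : Fin n | (j : ℕ) < i}) :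
    partVal n h (i + 1) (MvPolynomial.X ⟨i, hi⟩ ^ t * q) = h i t * partVal n h i q := by
  rw [q.as_sum, Finset.mul_sum, map_sum, map_sum, Finset.mul_sum]
  refine Finset.sum_congr rfl fun e he => ?_
  have hei : e ⟨i, hi⟩ = 0 := by
    by_contra hne
    have h1 : (⟨i, hi⟩ : Fin n) ∈ q.vars :=
      (MvPolynomial.mem_vars_iff_mem_support _).2 ⟨e, he, Finsupp.mem_support_iff.2 hne⟩
    have := MvPolynomial.mem_supported.1 hq h1
    simp at this
  rw [MvPolynomial.X_pow_eq_monomial, MvPolynomial.monomial_mul, partVal_monomial,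
    partVal_monomial, one_mul, mul_left_comm, ← Finset.mul_prod_erase _ _ (Finset.mem_univ ⟨i, hi⟩),
    ← Finset.mul_prod_erase _ _ (Finset.mem_univ (⟨i, hi⟩ : Fin n))]
  simp only [Finsupp.add_apply, Finsupp.single_eq_same, hei, add_zero, lt_add_iff_pos_right,
    zero_lt_one, if_true, lt_self_iff_false, if_false, one_mul]
  congr 2
  refine Finset.prod_congr rfl fun j hj => ?_
  have hne : j ≠ ⟨i, hi⟩ := Finset.ne_of_mem_erase hj
  have hne' : (j : ℕ) ≠ i := fun h => hne (Fin.ext h)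
  rw [Finsupp.single_apply, if_neg (Ne.symm hne), zero_add]
  by_cases hji : (j : ℕ) < i
  · rw [if_pos hji, if_pos (by omega)]
  · rw [if_neg hji, if_neg (by omega)]

/-- The part of a linear form in the variables of index less than `i`. -/
def partForm (n : ℕ) (a : ℕ → F) (i : ℕ) : MvPolynomial (Fin n) F :=
  ∑ j : Fin n, if (j : ℕ) < i then MvPolynomial.C (a j) * MvPolynomial.X j else 0

theorem partForm_succ (a : ℕ → F) {i : ℕ} (hi : i < n) :
    partForm n a (i + 1) = partForm n a i + MvPolynomial.C (a i) * MvPolynomial.X ⟨i, hi⟩ := by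
  have e (j : Fin n) : (if (j : ℕ) < i + 1 then MvPolynomial.C (a j) * MvPolynomial.X j else 0 :
      MvPolynomial (Fin n) F) = (if (j : ℕ) < i then MvPolynomial.C (a j) * MvPolynomial.X j else 0) +
      if j = ⟨i, hi⟩ then MvPolynomial.C (a i) * MvPolynomial.X ⟨i, hi⟩ else 0 := by
    rcases lt_trichotomy (j : ℕ) i with h | h | h
    · rw [if_pos (by omega), if_pos h, if_neg (by rintro rfl; simp at h), add_zero]
    · obtain rfl : j = ⟨i, hi⟩ := Fin.ext h
      simp
    · rw [if_neg (by omega), if_neg (by omega), if_neg (by rintro rfl; simp at h), add_zero]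
  rw [partForm, Finset.sum_congr rfl fun j _ => e j, Finset.sum_add_distrib, partForm]
  simp

theorem partForm_mem (a : ℕ → F) (i : ℕ) :
    partForm n a i ∈ MvPolynomial.supported F {j : Fin n | (j : ℕ) < i} := by
  refine sum_mem fun j _ => ?_
  split_ifs with hj
  · exact mul_mem (Subalgebra.algebraMap_mem _ _) (MvPolynomial.X_mem_supported.2 hj)
  · exact zero_mem _

theorem partForm_self (a : ℕ → F) : partForm n a n = linForm fun i : Fin n => a i := by
  simp [partForm, linForm]

/-- The partial value of the product of powers of the linear forms with code `m`. -/
def phiVal (p : Params) (A h : ℕ → ℕ → F) (i m : ℕ) : F :=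
  partVal p.n h i (∏ j : Fin p.r, partForm p.n (A j) i ^ dig p.B m j)

/-- Write each partial form as `ℓ_j + a_j x_i` and expand by the binomial theorem. The vector of the
exponents chosen for `x_i` is `k`, the total exponent of `x_i` is its digit sum, and `m - k` is left
for the shorter forms. -/
theorem phiVal_rec (p : Params) (A h : ℕ → ℕ → F) : PhiRec p A h (phiVal p A h) where
  zero m hm := by
    have h0 (j : Fin p.r) : partForm p.n (A j) 0 = 0 := by simp [partForm]
    simp only [phiVal, h0]
    split_ifs with hm0
    · have : ∏ j : Fin p.r, (0 : MvPolynomial (Fin p.n) F) ^ dig p.B m j =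
          MvPolynomial.monomial 0 1 := by
        rw [hm0]; simp [dig]
      rw [this, partVal_monomial]; simp
    · have : ∃ j : Fin p.r, dig p.B m j ≠ 0 := by
        by_contra hc
        push Not at hc
        apply hm0
        rw [← cod_digF (B := p.B) (r := p.r) hm]
        simp [cod, hc]
      obtain ⟨j, hj⟩ := this
      rw [Finset.prod_eq_zero (Finset.mem_univ j) (zero_pow hj), map_zero]
  succ i hi m hm := by
    classical
    have hB : 0 < p.B := Nat.succ_pos _
    set ℓ : Fin p.r → MvPolynomial (Fin p.n) F := fun j => partForm p.n (A j) i with hℓ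
    set x : MvPolynomial (Fin p.n) F := MvPolynomial.X ⟨i, hi⟩ with hx
    have hpow (j : Fin p.r) : partForm p.n (A j) (i + 1) ^ dig p.B m j =
        ∑ t : Fin p.B, MvPolynomial.C ((Nat.choose (dig p.B m j) t : F) * A j i ^ (t : ℕ)) *
          (x ^ (t : ℕ) * ℓ j ^ (dig p.B m j - t)) := by
      rw [partForm_succ _ hi, add_comm, add_pow, Fin.sum_univ_eq_sum_range
        (fun t => MvPolynomial.C ((Nat.choose (dig p.B m j) t : F) * A j i ^ t) *
          (x ^ t * ℓ j ^ (dig p.B m j - t))) p.B]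
      have hlt := dig_lt hB m j
      -- The binomial sum is extended to all digits below `B`, which makes the index set the same
      -- for every `j`; the added binomial coefficients vanish.
      refine Finset.sum_subset_zero_on_sdiff (Finset.range_subset_range.2 hlt) ?_ ?_
      · intro t ht
        simp only [Finset.mem_sdiff, Finset.mem_range] at ht
        rw [Nat.choose_eq_zero_of_lt (by omega)]; simp
      · intro t _
        rw [mul_pow, map_mul, map_natCast, map_pow]; ring
    have hterm (k : ℕ) (hk : k < p.K) : partVal p.n h (i + 1) (∏ j : Fin p.r,
        (MvPolynomial.C ((Nat.choose (dig p.B m j) (dig p.B k j) : F) * A j i ^ dig p.B k j) *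
          (x ^ dig p.B k j * ℓ j ^ (dig p.B m j - dig p.B k j)))) =
        coefU p A h i m k * phiVal p A h i (m - k) := by
      rw [Finset.prod_mul_distrib, Finset.prod_mul_distrib, ← map_prod, Finset.prod_pow_eq_pow_sum,
        ← MvPolynomial.smul_eq_C_mul, map_smul, hx, partVal_succ h hi _ (prod_mem fun j _ =>
          pow_mem (partForm_mem _ _) _), smul_eq_mul, coefU, digSum, ← mul_assoc,
        Fin.prod_univ_eq_prod_range
          (fun j => (Nat.choose (dig p.B m j) (dig p.B k j) : F) * A j i ^ dig p.B k j),
        Fin.sum_univ_eq_sum_range (fun j => dig p.B k j)]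
      by_cases hle : digF p.B p.r k ≤ digF p.B p.r m
      · congr 1
        rw [phiVal]
        congr 1
        refine Finset.prod_congr rfl fun j _ => ?_
        have := DFunLike.congr_fun (digF_sub hB hm hk hle) j
        rw [Finsupp.tsub_apply] at this
        simp only [digF_apply] at this
        rw [this]
      -- If some digit of `k` exceeds that of `m`, a binomial coefficient is zero. So the
      -- meaningless entry at the truncated difference `m - k` does no harm and no comparison of
      -- digits is needed.
      · rw [digF_le_iff] at hle
        push Not at hle
        obtain ⟨j, hj, hlt⟩ := hle
        rw [Finset.prod_eq_zero (Finset.mem_range.2 hj)]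
        · simp
        · rw [Nat.choose_eq_zero_of_lt hlt]; simp
    -- The product of sums becomes a sum over all functions from rows to digits, reindexed by their
    -- codes.
    rw [phiVal, Finset.prod_congr rfl fun j _ => hpow j, Finset.prod_univ_sum, map_sum,
      Fintype.piFinset_univ, ← finFunctionFinEquiv.symm.sum_comp]
    rw [← Fin.sum_univ_eq_sum_range (fun k => coefU p A h i m k * phiVal p A h i (m - k))]
    refine Finset.sum_congr rfl fun k _ => ?_
    rw [← hterm k k.isLt]
    simp only [finFunctionFinEquiv_symm_apply_val]
    rfl

theorem partVal_self (q : MvPolynomial (Fin n) F) :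
    partVal n h n q = ∑ e ∈ q.support, q.coeff e * ∏ j : Fin n, h j (e j) := by
  conv_lhs => rw [q.as_sum, map_sum]
  refine Finset.sum_congr rfl fun e _ => ?_
  rw [partVal_monomial]
  simp

/-- Both sides are linear in the monomials of `g`. By `hg` all exponents of `g` are digits, so its
support embeds into the codes, and other codes contribute zero. -/
theorem partVal_formSubst (p : Params) (A h : ℕ → ℕ → F) {g : MvPolynomial (Fin p.r) F}
    (hg : ∀ e, g.coeff e ≠ 0 → ∀ j, e j < p.B) :
    partVal p.n h p.n (formSubst p.n p.r A g) =
      ∑ m ∈ Finset.range p.K, g.coeff (digF p.B p.r m) * phiVal p A h p.n m := by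
  classical
  have e1 (e : Fin p.r →₀ ℕ) : partVal p.n h p.n
      (formSubst p.n p.r A (MvPolynomial.monomial e (g.coeff e))) =
      g.coeff e * partVal p.n h p.n (∏ j : Fin p.r, partForm p.n (A j) p.n ^ e j) := by
    rw [formSubst, MvPolynomial.aeval_monomial, Finsupp.prod_fintype _ _ (by simp),
      ← Algebra.smul_def, map_smul, smul_eq_mul]
    simp only [partForm_self]
  conv_lhs => rw [g.as_sum, map_sum, map_sum]
  rw [Finset.sum_congr rfl fun e _ => e1 e]
  refine Finset.sum_bij_ne_zero (fun e _ _ => cod p.B e) ?_ ?_ ?_ ?_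
  · intro e he _
    exact Finset.mem_range.2 (cod_lt (hg e (MvPolynomial.mem_support_iff.1 he)))
  · intro e he _ e' he' _ hee
    rw [← digF_cod (hg e (MvPolynomial.mem_support_iff.1 he)), hee,
      digF_cod (hg e' (MvPolynomial.mem_support_iff.1 he'))]
  · intro m hm hne
    rw [Finset.mem_range] at hm
    refine ⟨digF p.B p.r m, MvPolynomial.mem_support_iff.2 (left_ne_zero_of_mul hne), ?_, cod_digF hm⟩
    exact hne
  · intro e he _
    have := digF_cod (hg e (MvPolynomial.mem_support_iff.1 he))
    rw [phiVal, this]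
    congr 3
    ext1 j
    rw [← digF_apply, this]

end

/-! ### The height of a rational number -/

/-- The largest of the numerator and the denominator. -/
def ratMax (q : ℚ) : ℕ := max q.num.natAbs q.den

/-- The height of a rational number. -/
def ratHt (q : ℚ) : ℕ := (ratMax q).size + 1

/-- Passing to lowest terms only replaces numerator and denominator by divisors, so any
representation as a fraction gives a bound. -/
theorem ratMax_le {q : ℚ} {z : ℤ} {D N : ℕ} (hD : 0 < D) (hq : q * D = z) (hz : z.natAbs ≤ N)
    (hN : D ≤ N) : ratMax q ≤ N := by
  have hD' : (D : ℚ) ≠ 0 := by positivity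
  have hq' : q = Rat.divInt z D := by
    rw [Rat.divInt_eq_div, eq_div_iff (by exact_mod_cast hD')]
    exact_mod_cast hq
  refine max_le ?_ ?_
  · by_cases hz0 : z = 0
    · rw [hq', hz0]; simp
    · have h1 := Rat.num_dvd z (b := (D : ℤ)) (by exact_mod_cast hD.ne')
      rw [← hq'] at h1
      exact (Nat.le_of_dvd (Int.natAbs_pos.2 hz0) (Int.natAbs_dvd_natAbs.2 h1)).trans hz
  · have h1 := Rat.den_dvd z D
    rw [← hq'] at h1
    exact (Nat.le_of_dvd hD (by exact_mod_cast h1)).trans hN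

theorem one_le_ratMax (q : ℚ) : 1 ≤ ratMax q := le_max_of_le_right q.pos

theorem size_mul_le (a b : ℕ) : (a * b).size ≤ a.size + b.size := by
  rw [Nat.size_le, pow_add]
  exact Nat.mul_lt_mul'' (Nat.lt_size_self a) (Nat.lt_size_self b)

/-- The summand `1` in `ratHt` pays for the factor `2` that an addition costs. -/
theorem ratHt_add_aux {q a b : ℚ} (h : ratMax q ≤ 2 * (ratMax a * ratMax b)) :
    ratHt q ≤ ratHt a + ratHt b := by
  have h1 := Nat.size_le_size h
  have h2 := size_mul_le 2 (ratMax a * ratMax b)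
  have h3 := size_mul_le (ratMax a) (ratMax b)
  have h4 : (2 : ℕ).size = 2 := by decide
  simp only [ratHt]
  have h5 : (2 * (ratMax a * ratMax b)).size ≤ (ratMax a * ratMax b).size + 1 := by
    rw [Nat.size_le, pow_succ, mul_comm]
    exact Nat.mul_lt_mul_of_pos_right (Nat.lt_size_self _) (by norm_num)
  omega

theorem ratMax_add_le (a b : ℚ) : ratMax (a + b) ≤ 2 * (ratMax a * ratMax b) := by
  have ha : (a.den : ℚ) ≠ 0 := by exact_mod_cast a.den_ne_zero
  have hb : (b.den : ℚ) ≠ 0 := by exact_mod_cast b.den_ne_zero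
  have h1 : a.num.natAbs ≤ ratMax a := le_max_left _ _
  have h2 : b.num.natAbs ≤ ratMax b := le_max_left _ _
  have h3 : a.den ≤ ratMax a := le_max_right _ _
  have h4 : b.den ≤ ratMax b := le_max_right _ _
  refine ratMax_le (D := a.den * b.den) (z := a.num * b.den + b.num * a.den)
    (Nat.mul_pos a.pos b.pos) ?_ ?_ ?_
  · have ea : a * a.den = a.num := Rat.mul_den_eq_num a
    have eb : b * b.den = b.num := Rat.mul_den_eq_num b
    push_cast
    rw [← ea, ← eb]; ring
  · refine (Int.natAbs_add_le _ _).trans ?_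
    rw [Int.natAbs_mul, Int.natAbs_mul, Int.natAbs_natCast, Int.natAbs_natCast]
    have := Nat.mul_le_mul h1 h4
    have := Nat.mul_le_mul h3 h2
    nlinarith
  · have := Nat.mul_le_mul h3 h4
    omega

theorem ratMax_neg (a : ℚ) : ratMax (-a) = ratMax a := by simp [ratMax]

theorem ratMax_mul_le (a b : ℚ) : ratMax (a * b) ≤ ratMax a * ratMax b := by
  have h1 : a.num.natAbs ≤ ratMax a := le_max_left _ _
  have h2 : b.num.natAbs ≤ ratMax b := le_max_left _ _
  have h3 : a.den ≤ ratMax a := le_max_right _ _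
  have h4 : b.den ≤ ratMax b := le_max_right _ _
  refine ratMax_le (D := a.den * b.den) (z := a.num * b.num)
    (Nat.mul_pos a.pos b.pos) ?_ ?_ (Nat.mul_le_mul h3 h4)
  · have ea : a * a.den = a.num := Rat.mul_den_eq_num a
    have eb : b * b.den = b.num := Rat.mul_den_eq_num b
    push_cast
    rw [← ea, ← eb]; ring
  · rw [Int.natAbs_mul]
    exact Nat.mul_le_mul h1 h2

theorem ratMax_inv_le (a : ℚ) : ratMax a⁻¹ ≤ ratMax a := by
  by_cases ha : a = 0
  · simp [ha]
  have hn : a.num ≠ 0 := Rat.num_ne_zero.2 ha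
  have hn' : (a.num : ℚ) ≠ 0 := by exact_mod_cast hn
  refine ratMax_le (D := a.num.natAbs) (z := a.num.sign * a.den) (Int.natAbs_pos.2 hn) ?_ ?_
    (le_max_left _ _)
  · have ea : a * a.den = a.num := Rat.mul_den_eq_num a
    have h1 : ((a.num.natAbs : ℕ) : ℚ) = a.num.sign * a.num := by
      have := Int.sign_mul_self_eq_abs a.num
      rw [← Int.cast_natCast, Int.natCast_natAbs, ← this]; push_cast; rfl
    rw [h1, ← ea]
    push_cast
    field_simp
  · rw [Int.natAbs_mul, Int.natAbs_sign_of_ne_zero hn, one_mul, Int.natAbs_natCast]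
    exact le_max_right _ _

theorem lt_two_pow_of_ratHt_le {q : ℚ} {X : ℕ} (h : ratHt q ≤ X) : ratMax q ≤ 2 ^ X := by
  have h1 : ratMax q < 2 ^ (ratMax q).size := Nat.lt_size_self _
  exact h1.le.trans (Nat.pow_le_pow_right (by norm_num) (by simp only [ratHt] at h; omega))

/-- One common multiple of the denominators clears the whole family, and its size is a product of
small numbers. -/
theorem exists_int_mul_prod_den {ι : Type} (s : Finset ι) (f : ι → ℚ) {j : ι} (hj : j ∈ s) {b : ℕ}
    (hb : ∀ i ∈ s, ratMax (f i) ≤ b) :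
    ∃ z : ℤ, f j * ((∏ i ∈ s, (f i).den : ℕ) : ℚ) = z ∧ z.natAbs ≤ b * b ^ s.card := by
  obtain ⟨c, hc⟩ := Finset.dvd_prod_of_mem (fun i => (f i).den) hj
  refine ⟨(f j).num * c, ?_, ?_⟩
  · rw [hc]; push_cast
    rw [← mul_assoc, Rat.mul_den_eq_num]
  · rw [Int.natAbs_mul, Int.natAbs_natCast]
    have h1 : c ≤ ∏ i ∈ s, (f i).den := by
      rw [hc]; exact Nat.le_mul_of_pos_left _ (f j).pos
    have h2 : ∏ i ∈ s, (f i).den ≤ b ^ s.card :=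
      Finset.prod_le_pow_card _ _ _ fun i hi => (le_max_right _ _).trans (hb i hi)
    exact Nat.mul_le_mul ((le_max_left _ _).trans (hb j hj)) (h1.trans h2)

theorem prod_den_pos {ι : Type} (s : Finset ι) (f : ι → ℚ) : 0 < ∏ i ∈ s, (f i).den :=
  Finset.prod_pos fun i _ => (f i).pos

theorem prod_den_le {ι : Type} (s : Finset ι) (f : ι → ℚ) {b : ℕ}
    (hb : ∀ i ∈ s, ratMax (f i) ≤ b) : ∏ i ∈ s, (f i).den ≤ b ^ s.card :=
  Finset.prod_le_pow_card _ _ _ fun i hi => (le_max_right _ _).trans (hb i hi)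

/-- Common denominators in a linear recursion. -/
theorem rat_rec_common_den {n K b : ℕ} (hb : 1 ≤ b) {Φ : ℕ → ℕ → ℚ} {u : ℕ → ℕ → ℕ → ℚ}
    {g : ℕ → ℕ → ℕ} (hg : ∀ m < K, ∀ k < K, g m k < K) (h0 : ∀ m < K, ratMax (Φ 0 m) ≤ b)
    (hu : ∀ i < n, ∀ m < K, ∀ k < K, ratMax (u i m k) ≤ b)
    (hr : ∀ i < n, ∀ m < K, Φ (i + 1) m = ∑ k ∈ Finset.range K, u i m k * Φ i (g m k)) :
    ∀ i ≤ n, ∃ D : ℕ, 0 < D ∧ D ≤ b * b ^ K * ((K + 1) * (b * b ^ (K * K))) ^ i ∧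
      ∀ m < K, ∃ z : ℤ, Φ i m * D = z ∧
        z.natAbs ≤ b * b ^ K * ((K + 1) * (b * b ^ (K * K))) ^ i := by
  intro i
  induction i with
  | zero =>
    intro _
    have hb' : ∀ m ∈ Finset.range K, ratMax (Φ 0 m) ≤ b := fun m hm => h0 m (Finset.mem_range.1 hm)
    refine ⟨∏ m ∈ Finset.range K, (Φ 0 m).den, prod_den_pos _ _, ?_, fun m hm => ?_⟩
    · have := prod_den_le _ _ hb'
      rw [Finset.card_range] at this
      rw [pow_zero, mul_one]
      exact this.trans (Nat.le_mul_of_pos_left _ hb)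
    · obtain ⟨z, h1, h2⟩ := exists_int_mul_prod_den _ _ (Finset.mem_range.2 hm) hb'
      exact ⟨z, h1, by simpa using h2⟩
  | succ i ih =>
    intro hi
    obtain ⟨D, hD, hDN, hz⟩ := ih (by omega)
    set N := b * b ^ K * ((K + 1) * (b * b ^ (K * K))) ^ i
    set s := Finset.range K ×ˢ Finset.range K
    set f : ℕ × ℕ → ℚ := fun a => u i a.1 a.2
    have hs : s.card = K * K := by simp [s]
    have hb' : ∀ a ∈ s, ratMax (f a) ≤ b := fun a ha => by
      simp only [s, Finset.mem_product, Finset.mem_range] at ha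
      exact hu i hi a.1 ha.1 a.2 ha.2
    have hN : b * b ^ K * ((K + 1) * (b * b ^ (K * K))) ^ (i + 1) =
        (K + 1) * (b * b ^ (K * K) * N) := by
      rw [pow_succ]; ring
    have hbK : 1 ≤ b ^ (K * K) := Nat.one_le_pow _ _ hb
    -- One step multiplies the common denominator by the denominators of all `K * K` coefficients.
    -- The numerators gain in addition the factor `b` for a numerator of a coefficient and a factor
    -- at most `K + 1` for the number of summands. The bound grows by the same factor at every step,
    -- so its logarithm grows linearly.
    refine ⟨(∏ a ∈ s, (f a).den) * D, Nat.mul_pos (prod_den_pos _ _) hD, ?_, fun m hm => ?_⟩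
    · have := prod_den_le s f hb'
      rw [hs] at this
      rw [hN]
      calc (∏ a ∈ s, (f a).den) * D ≤ b ^ (K * K) * N := Nat.mul_le_mul this hDN
        _ ≤ b * b ^ (K * K) * N := Nat.mul_le_mul_right _ (Nat.le_mul_of_pos_left _ hb)
        _ ≤ _ := Nat.le_mul_of_pos_left _ (by omega)
    · have hk : ∀ k, ∃ z : ℤ, k < K → u i m k * Φ i (g m k) * ((∏ a ∈ s, (f a).den : ℕ) * D : ℚ) = z ∧
          z.natAbs ≤ b * b ^ (K * K) * N := by
        intro k
        by_cases hkK : k < K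
        · obtain ⟨z, h1, h2⟩ := hz (g m k) (hg m hm k hkK)
          obtain ⟨z', h3, h4⟩ := exists_int_mul_prod_den s f (j := (m, k))
            (by simp [s, hm, hkK]) hb'
          rw [hs] at h4
          refine ⟨z' * z, fun _ => ⟨?_, ?_⟩⟩
          · push_cast at h3 ⊢
            rw [← h1, ← h3]
            simp only [f]; ring
          · rw [Int.natAbs_mul]; exact Nat.mul_le_mul h4 h2
        · exact ⟨0, fun h => absurd h hkK⟩
      choose z hz' using hk
      refine ⟨∑ k ∈ Finset.range K, z k, ?_, ?_⟩
      · rw [hr i hi m hm, Finset.sum_mul, Int.cast_sum]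
        refine Finset.sum_congr rfl fun k hk => ?_
        rw [← (hz' k (Finset.mem_range.1 hk)).1, Nat.cast_mul]
      · rw [hN]
        refine (Int.natAbs_sum_le _ _).trans ?_
        refine (Finset.sum_le_card_nsmul _ _ (b * b ^ (K * K) * N) fun k hk =>
          (hz' k (Finset.mem_range.1 hk)).2).trans ?_
        rw [Finset.card_range, smul_eq_mul]
        exact Nat.mul_le_mul_right _ (by omega)

theorem height_ratHt : Height ratHt where
  pos _ := Nat.succ_pos _
  zero_le a := Nat.succ_le_succ (Nat.size_le_size (by simpa [ratMax] using one_le_ratMax a))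
  one_le a := Nat.succ_le_succ (Nat.size_le_size (by simpa [ratMax] using one_le_ratMax a))
  add_le a b := ratHt_add_aux (ratMax_add_le a b)
  sub_le a b := ratHt_add_aux (by
    rw [sub_eq_add_neg, ← ratMax_neg b]; exact ratMax_add_le a (-b))
  mul_le a b := ratHt_add_aux ((ratMax_mul_le a b).trans (by omega))
  inv_le a := Nat.succ_le_succ (Nat.size_le_size (ratMax_inv_le a))
  rec_le n K X Φ u g hg h0 hu hr i hi m hm := by
    have hX : 1 ≤ X := (Nat.succ_pos _).trans_le (h0 m hm)
    obtain ⟨D, hD, hDN, hz⟩ := rat_rec_common_den (b := 2 ^ X) Nat.one_le_two_pow hg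
      (fun m hm => lt_two_pow_of_ratHt_le (h0 m hm))
      (fun i hi m hm k hk => lt_two_pow_of_ratHt_le (hu i hi m hm k hk)) hr i hi
    obtain ⟨z, h1, h2⟩ := hz m hm
    have h3 := ratMax_le hD h1 h2 hDN
    -- The number of summands is also written as a power of two, so that the whole bound becomes a
    -- single power with an exponent linear in `X`.
    have hK : K + 1 ≤ 2 ^ X * 2 ^ (X * K) := by
      have h4 : K < 2 ^ K := Nat.lt_two_pow_self
      have h5 : 2 ^ K ≤ 2 ^ (X * K) := Nat.pow_le_pow_right (by norm_num) (Nat.le_mul_of_pos_left _ hX)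
      have h6 : 1 ≤ 2 ^ X := Nat.one_le_two_pow
      nlinarith
    have h4 : 2 ^ X * (2 ^ X) ^ K * ((K + 1) * (2 ^ X * (2 ^ X) ^ (K * K))) ^ i ≤
        2 ^ (X + X * K + (X + X * K + (X + X * (K * K))) * n) := by
      calc _ ≤ 2 ^ X * (2 ^ X) ^ K * ((2 ^ X * 2 ^ (X * K)) * (2 ^ X * (2 ^ X) ^ (K * K))) ^ i := by
            gcongr
        _ = 2 ^ (X + X * K + (X + X * K + (X + X * (K * K))) * i) := by
            rw [← pow_mul, ← pow_mul, ← pow_add, ← pow_add, ← pow_add, ← pow_mul,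
              ← pow_add]
        _ ≤ _ := by gcongr; norm_num
    have h5 : (ratMax (Φ i m)).size ≤ X + X * K + (X + X * K + (X + X * (K * K))) * n + 1 := by
      rw [Nat.size_le, pow_succ]
      have := h3.trans h4
      have : 0 < 2 ^ (X + X * K + (X + X * K + (X + X * (K * K))) * n) := by positivity
      omega
    simp only [ratHt]
    have e : X + X * K + (X + X * K + (X + X * (K * K))) * n = X * ((K + 1) + (2 + K + K * K) * n) := by
      ring
    rw [e] at h5
    have h6 : (K + 1) + (2 + K + K * K) * n + 2 ≤ 10 * (n + 1) * (K + 1) ^ 2 := by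
      ring_nf; nlinarith [Nat.zero_le (n * K ^ 2), Nat.zero_le (n * K), Nat.zero_le (K ^ 2)]
    calc _ ≤ X * ((K + 1) + (2 + K + K * K) * n) + 2 := by omega
      _ ≤ X * ((K + 1) + (2 + K + K * K) * n + 2) := by nlinarith
      _ ≤ X * (10 * (n + 1) * (K + 1) ^ 2) := Nat.mul_le_mul_left _ h6
      _ = _ := by ring

theorem ratSize_le_ratHt (q : ℚ) : ratSize q ≤ 2 * ratHt q := by
  have h1 : q.num.natAbs.size ≤ (ratMax q).size := Nat.size_le_size (le_max_left _ _)
  have h2 : q.den.size ≤ (ratMax q).size := Nat.size_le_size (le_max_right _ _)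
  simp only [ratSize, ratHt]; omega

theorem ratHt_le_ratSize (q : ℚ) : ratHt q ≤ ratSize q + 1 := by
  simp only [ratSize, ratHt, ratMax]
  rcases max_choice q.num.natAbs q.den with h | h <;> rw [h] <;> omega

/-! ### Heights of the values of powers and of the binomial coefficients -/

section

variable {F : Type u} [Field F] {ht : F → ℕ}

/-- The window of `D` consecutive values is a vector on which the recurrence acts by a companion
matrix, so `rec_le` applies with width `D`. The factor `D + 3` covers both the initial powers of
`a`, of exponent below `D`, and the matrix entries, which involve three heights. -/
theorem Height.powVal_le (hh : Height ht) {q : Polynomial F} (hq : q ≠ 0) {a : F} {X : ℕ}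
    (ha : ht a ≤ X) (hX : ∀ k, ht (q.coeff k) ≤ X) (t : ℕ) :
    ht (powVal q a t) ≤ 10 * (t + 1) * (q.natDegree + 1) ^ 2 * ((q.natDegree + 3) * X) := by
  have hX1 : 1 ≤ X := (hh.pos a).trans ha
  have h0 : ht 0 ≤ X := (hh.zero_le _).trans ha
  have h1 : ht 1 ≤ X := (hh.one_le _).trans ha
  set D := q.natDegree with hD
  rcases Nat.eq_zero_or_pos D with hD0 | hDpos
  -- For degree `0` there is no window; all values are zero.
  · rw [powVal_step hq a (by omega), ← hD, hD0, Finset.range_zero, Finset.sum_empty, sub_zero,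
      zero_mul]
    nlinarith [Nat.zero_le t]
  refine hh.rec_le t D ((D + 3) * X) (fun t m => powVal q a (t + m))
    (fun _ m k => if m + 1 < D then (if k = m + 1 then 1 else 0)
      else (0 - q.coeff k) * (q.coeff D)⁻¹) (fun _ k => k) (fun _ _ _ h => h) ?_ ?_ ?_ t le_rfl 0 hDpos
  · intro m hm
    simp only [zero_add]
    rw [powVal_of_lt hq a hm]
    have := hh.pow_le a m
    have : (m + 1) * ht a ≤ (D + 3) * X := Nat.mul_le_mul (by omega) ha
    omega
  · intro _ _ m _ k _
    have h3X : 3 * X ≤ (D + 3) * X := Nat.mul_le_mul_right _ (by omega)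
    split_ifs
    · omega
    · omega
    · have e1 := hh.mul_le (0 - q.coeff k) (q.coeff D)⁻¹
      have e2 := hh.sub_le 0 (q.coeff k)
      have e3 := hh.inv_le (q.coeff D)
      have e4 := hX k
      have e5 := hX D
      omega
  · intro i _ m hm
    by_cases hmD : m + 1 < D
    · simp only [if_pos hmD, ite_mul, one_mul, zero_mul, Finset.sum_ite_eq', Finset.mem_range]
      congr 1
      omega
    · simp only [if_neg hmD]
      obtain rfl : m = D - 1 := by omega
      rw [powVal_step hq a (by omega), zero_sub, neg_mul, Finset.sum_mul, ← Finset.sum_neg_distrib]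
      refine Finset.sum_congr rfl fun k _ => ?_
      rw [show i + 1 + (D - 1) - q.natDegree + k = i + k by omega]
      ring

/-- Pascal's rule is a recursion with coefficients `0` and `1`. Column `k` depends only on columns
`k` and `k - 1`, so the triangle may be cut off at width `B`. -/
theorem Height.choose_le (hh : Height ht) {X : ℕ} (h1 : ht (1 : F) ≤ X) {B m k : ℕ}
    (hk : k < B) : ht (Nat.choose m k : F) ≤ 10 * (m + 1) * (B + 1) ^ 2 * X := by
  have hb : ∀ a : F, a = 0 ∨ a = 1 → ht a ≤ X := by
    rintro a (rfl | rfl)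
    exacts [(hh.zero_le _).trans h1, h1]
  refine hh.rec_le m B X (fun t k => (Nat.choose t k : F))
    (fun _ k j => if j = k ∨ j + 1 = k then 1 else 0) (fun _ k => k) (fun _ _ _ h => h) ?_ ?_ ?_
    m le_rfl k hk
  · intro k _
    rcases k with _ | k
    · exact hb _ (by simp)
    · exact hb _ (by simp)
  · intro _ _ k _ j _
    exact hb _ (by split_ifs <;> simp)
  · intro t _ k hk
    rcases k with _ | k
    · simp [show 0 < B by omega]
    · have e (j : ℕ) : (if j = k + 1 ∨ j + 1 = k + 1 then (1 : F) else 0) * (Nat.choose t j : F) =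
          (if j = k + 1 then (Nat.choose t j : F) else 0) +
            if j = k then (Nat.choose t j : F) else 0 := by
        by_cases h1 : j = k + 1
        · rw [if_pos (Or.inl h1), if_pos h1, if_neg (by omega)]; simp
        · by_cases h2 : j = k
          · rw [if_pos (Or.inr (by omega)), if_neg h1, if_pos h2]; simp
          · rw [if_neg (by omega), if_neg h1, if_neg h2]; simp
      rw [Finset.sum_congr rfl fun j _ => e j, Finset.sum_add_distrib]
      simp only [Finset.sum_ite_eq', Finset.mem_range, hk, if_true, show k < B by omega]
      rw [Nat.choose_succ_succ, Nat.cast_add, add_comm]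

end

/-! ### The input in memory -/

section

variable {F : Type u} [Field F] {ht : F → ℕ} {M W : ℕ}

/-- The parameters of an input, for a given number of linear forms. -/
def Input.params (I : Input F) (r : ℕ) : Params := ⟨I.n, r, I.d, I.circuit.size, I.circuit.out⟩

/-- The input except for the linear forms is in memory. -/
structure Input.Loaded (I : Input F) (r : ℕ) (σ : Store F) : Prop extends
    HasParams (I.params r) σ where
  code : ∀ m : Fin I.circuit.size, σ.nat 1 m = (I.circuit.gate m).code
  fst : ∀ m : Fin I.circuit.size, σ.nat 2 m = (I.circuit.gate m).fst
  snd : ∀ m : Fin I.circuit.size, σ.nat 3 m = (I.circuit.gate m).snd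
  scalar : ∀ m : Fin I.circuit.size, σ.fld 0 m = (I.circuit.gate m).scalar
  gen : ∀ i : Fin I.n, ∀ k < I.d + 1, σ.fld 2 ((I.d + 1) * i + k) = (I.p i).coeff k
  pt : ∀ i : Fin I.n, σ.fld 3 i = I.pt i

theorem Input.Loaded.of_eq {I : Input F} {r : ℕ} {σ τ : Store F} (h : I.Loaded r σ)
    (h0 : τ.nat 0 = σ.nat 0) (h1 : τ.nat 1 = σ.nat 1) (h2 : τ.nat 2 = σ.nat 2)
    (h3 : τ.nat 3 = σ.nat 3) (f0 : τ.fld 0 = σ.fld 0) (f2 : τ.fld 2 = σ.fld 2)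
    (f3 : τ.fld 3 = σ.fld 3) : I.Loaded r τ where
  toHasParams := h.toHasParams.of_eq h0
  code := by rw [h1]; exact h.code
  fst := by rw [h2]; exact h.fst
  snd := by rw [h3]; exact h.snd
  scalar := by rw [f0]; exact h.scalar
  gen := by rw [f2]; exact h.gen
  pt := by rw [f3]; exact h.pt

/-- The coefficient with code `x` at gate `m` after the substitution given by the pivots. -/
def Input.gateCoeff (I : Input F) (r : ℕ) (piv : ℕ → ℕ) (m x : ℕ) : F :=
  if h : m < I.circuit.size then
    (pivSubst F I.n r piv (I.circuit.gatePoly ⟨m, h⟩)).coeff (digF (I.d + 1) r x)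
  else 0

/-- Degrees at inner gates may exceed `d`, but truncation is compatible with addition and with
`coeff_digF_mul`. The hypothesis `hd` makes the base at least `2`, so that the exponent `1` is a
digit and `y_j` has code `(d+1)^j`. -/
theorem Input.gateTable (I : Input F) (hd : 1 ≤ I.d) {r : ℕ} {σ : Store F} (h : I.Loaded r σ) :
    GateTable (I.params r) σ (I.gateCoeff r (σ.nat 5)) where
  rec_eq m hm := by
    classical
    replace hm : m < I.circuit.size := hm
    have h1 := h.code ⟨m, hm⟩
    have h2 := h.fst ⟨m, hm⟩
    have h3 := h.snd ⟨m, hm⟩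
    have h4 := h.scalar ⟨m, hm⟩
    have hpow : 0 < (I.d + 1) ^ r := Nat.pow_pos (Nat.succ_pos _)
    have hG (x : ℕ) : I.gateCoeff r (σ.nat 5) m x = (pivSubst F I.n r (σ.nat 5)
        (I.circuit.gatePoly ⟨m, hm⟩)).coeff (digF (I.d + 1) r x) := dif_pos hm
    have hG' (j : Fin m) (x : ℕ) : I.gateCoeff r (σ.nat 5) j x = (pivSubst F I.n r (σ.nat 5)
        (I.circuit.gatePoly ⟨j, j.isLt.trans hm⟩)).coeff (digF (I.d + 1) r x) :=
      dif_pos (j.isLt.trans hm)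
    simp only [hG]
    rw [Circuit.gatePoly]
    cases hgate : I.circuit.gate ⟨m, hm⟩ with
    | const a =>
      rw [hgate] at h1 h4
      refine Or.inl ⟨h1, fun x hx => ?_⟩
      simp only
      rw [MvPolynomial.algHom_C, MvPolynomial.algebraMap_eq, MvPolynomial.coeff_C, h4,
        ← digF_zero (B := I.d + 1)]
      simp only [digF_inj hpow hx, Gate.scalar, eq_comm]
    | var i =>
      rw [hgate] at h1 h2
      refine Or.inr (Or.inl ⟨h1, fun x hx => ?_⟩)
      simp only
      rw [pivSubst, MvPolynomial.aeval_X, MvPolynomial.coeff_sum, h2]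
      refine Eq.trans ?_ (Fin.sum_univ_eq_sum_range (fun j =>
        if σ.nat 5 j = Gate.fst (.var i : Gate F I.n m) + 1 ∧ x = (I.d + 1) ^ j then (1 : F) else 0) r)
      refine Finset.sum_congr rfl fun j _ => ?_
      have hj : (I.d + 1) ^ (j : ℕ) < (I.d + 1) ^ r := Nat.pow_lt_pow_right (by omega) j.isLt
      by_cases hp : σ.nat 5 j = i + 1
      · have hiff : Finsupp.single j 1 = digF (I.d + 1) r x ↔ x = (I.d + 1) ^ (j : ℕ) := by
          rw [← digF_pow (B := I.d + 1) (by omega) j, digF_inj hj hx, eq_comm]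
        rw [if_pos hp, MvPolynomial.coeff_X]
        simp only [Gate.fst, hp, true_and, hiff]
      · rw [if_neg hp, if_neg (fun h => hp h.1)]; simp
    | add j k =>
      rw [hgate] at h1 h2 h3
      refine Or.inr (Or.inr (Or.inl ⟨h1, ?_, ?_, fun x hx => ?_⟩))
      · rw [h2]; exact j.isLt
      · rw [h3]; exact k.isLt
      · rw [h2, h3]
        simp only [Gate.fst, Gate.snd, hG', map_add, MvPolynomial.coeff_add]
    | mul j k =>
      rw [hgate] at h1 h2 h3
      refine Or.inr (Or.inr (Or.inr ⟨h1, ?_, ?_, fun x hx => ?_⟩))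
      · rw [h2]; exact j.isLt
      · rw [h3]; exact k.isLt
      · rw [h2, h3]
        simp only [Gate.fst, Gate.snd, hG', map_mul]
        exact coeff_digF_mul (B := I.d + 1) (r := r) (Nat.succ_pos _) _ _ hx

/-- Bounds for the heights of the data at the circuit, the generators and the point. -/
structure Input.HeightLE (I : Input F) (ht : F → ℕ) (X : ℕ) : Prop where
  one : ht (1 : F) ≤ X
  gate : ∀ m e, ht ((I.circuit.gatePoly m).coeff e) ≤ X
  gen : ∀ i k, ht ((I.p i).coeff k) ≤ X
  pt : ∀ i, ht (I.pt i) ≤ X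

/-- The nonzero pivots are column indices, and distinct. -/
structure PivOK (n r : ℕ) (piv : ℕ → ℕ) : Prop where
  le : ∀ j < r, piv j ≤ n
  inj : ∀ j < r, ∀ j' < r, piv j ≠ 0 → piv j = piv j' → j = j'

theorem Reduced.pivOK {p : Params} {A₀ A : ℕ → ℕ → F} {piv : ℕ → ℕ}
    (h : Reduced p A₀ p.r A piv) : PivOK p.n p.r piv where
  le j hj := by
    rcases h.row j hj with ⟨h1, -⟩ | ⟨i, hi, h1, -⟩ <;> omega
  inj j hj j' hj' hne he := by
    obtain ⟨i, hi, h1, h2, h3⟩ := (h.row j hj).resolve_left fun h' => hne h'.1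
    rcases h.row j' hj' with ⟨h1', -⟩ | ⟨i', hi', h1', h2', h3'⟩
    · omega
    · obtain rfl : i = i' := by omega
      by_contra hjj
      rw [h3 j' hj' (Ne.symm hjj)] at h2'
      exact zero_ne_one h2'

/-- The bound comes from the promise on the gates and not from following the evaluation, during
which sizes could double at every multiplication. -/
theorem Input.HeightLE.gateCoeff_le (hh : Height ht) {I : Input F} {X r : ℕ} (h : I.HeightLE ht X)
    {piv : ℕ → ℕ} (hpiv : PivOK I.n r piv) (m x : ℕ) : ht (I.gateCoeff r piv m x) ≤ X := by
  have h0 : ht (0 : F) ≤ X := (hh.zero_le _).trans h.one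
  rw [Input.gateCoeff]
  split_ifs with hm
  · rcases coeff_pivSubst (F := F) hpiv.le hpiv.inj (digF (I.d + 1) r x) with h1 | ⟨e, -, h1⟩
    · rw [h1]; exact h0
    · rw [h1]; exact h.gate _ _
  · exact h0

theorem Input.Loaded.symProg_spec (hh : Height ht) {I : Input F} {r X : ℕ} {σ : Store F}
    (h : I.Loaded r σ) (hc : Ctx (I.params r) σ) (hd : 1 ≤ I.d) (hM : (I.params r).Fits M)
    (hpiv : PivOK I.n r (σ.nat 5)) (hX : I.HeightLE ht X) (hW : (M + 1) * (2 * X) ≤ W) :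
    Tr ht M W symProg σ fun τ => ∀ m < I.circuit.size, ∀ x < (I.d + 1) ^ r,
      τ.fld 5 ((I.d + 1) ^ r * m + x) = I.gateCoeff r (σ.nat 5) m x := by
  refine UnivRem.symProg_spec hh hc hM (I.gateTable hd h) (X := X)
    (fun m _ x _ => hX.gateCoeff_le hh hpiv m x) ?_ ?_ ?_
  · rintro a (rfl | rfl)
    exacts [(hh.zero_le _).trans hX.one, hX.one]
  · have := hM.r
    refine le_trans ?_ hW
    nlinarith
  · have := hM.K
    refine le_trans ?_ hW
    gcongr

end

/-! ### The main program -/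

/-- The remainder at the point, from the circuit and the linear forms. -/
def mainProg : Prog :=
  .seq powProg (.seq gaussProg (.seq symProg (.seq valProg (.seq chooseProg
    (.seq phiProg finalProg)))))

section

variable {F : Type u} [Field F] {ht : F → ℕ} {M W : ℕ}

/-- The substitution does not raise the total degree, so every exponent occurring in the image of
`f` is a digit and the table at the output gate is complete. -/
theorem coeff_pivSubst_degree_le {n r d : ℕ} {piv : ℕ → ℕ} (hpiv : PivOK n r piv)
    {f : MvPolynomial (Fin n) F} (hf : f.totalDegree ≤ d) {e : Fin r →₀ ℕ}
    (he : (pivSubst F n r piv f).coeff e ≠ 0) (j : Fin r) : e j < d + 1 := by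
  rcases coeff_pivSubst (F := F) hpiv.le hpiv.inj e with h | ⟨e', h1, h2⟩
  · exact absurd (h f) he
  · rw [h2] at he
    have h3 := MvPolynomial.le_totalDegree (MvPolynomial.mem_support_iff.2 he)
    have h4 := Finsupp.le_degree j e
    rw [← h1] at h4
    have h5 : (e'.sum fun _ k => k) = e'.degree := rfl
    omega

/-- The value of `x_i ^ k` modulo the generator, at the point. -/
def Input.pv (I : Input F) (i k : ℕ) : F :=
  if hi : i < I.n then powVal (I.p ⟨i, hi⟩) (I.pt ⟨i, hi⟩) k else 0

/-- The coefficients of the generators. -/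
def Input.genCoeff (I : Input F) (i k : ℕ) : F :=
  if hi : i < I.n then (I.p ⟨i, hi⟩).coeff k else 0

theorem Input.powRec (I : Input F) (hp : ∀ i, I.p i ≠ 0) (hd : ∀ i, (I.p i).natDegree ≤ I.d)
    (r : ℕ) : PowRec (I.params r) I.genCoeff (fun i => if hi : i < I.n then I.pt ⟨i, hi⟩ else 0)
      (fun i => if hi : i < I.n then (I.p ⟨i, hi⟩).natDegree else 0) I.pv where
  deg_le i hi := by
    replace hi : i < I.n := hi
    simp only [dif_pos hi]; exact hd _
  lead i hi := by
    replace hi : i < I.n := hi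
    simp only [dif_pos hi, Input.genCoeff, Polynomial.coeff_natDegree, ne_eq,
      Polynomial.leadingCoeff_eq_zero]
    exact hp _
  above i hi k _ hk := by
    replace hi : i < I.n := hi
    simp only [dif_pos hi, Input.genCoeff] at hk ⊢
    exact Polynomial.coeff_eq_zero_of_natDegree_lt hk
  zero i hi h0 := by
    replace hi : i < I.n := hi
    simp only [dif_pos hi, Input.pv] at h0 ⊢
    rw [powVal_of_lt (hp _) _ h0, pow_zero]
  succ i hi k hk := by
    replace hi : i < I.n := hi
    simp only [dif_pos hi, Input.pv] at hk ⊢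
    rw [powVal_of_lt (hp _) _ hk, powVal_of_lt (hp _) _ (by omega), pow_succ']
  step i hi k hk _ := by
    replace hi : i < I.n := hi
    simp only [dif_pos hi, Input.pv, Input.genCoeff] at hk ⊢
    exact powVal_step (hp _) _ hk

/-- With `h = I.pv` the functional `partVal` over all variables is evaluation of the normal form at
the point. It is applied to `f` rewritten in the reduced forms. -/
theorem Input.sum_gateCoeff (I : Input F) {r : ℕ} {A₀ A : ℕ → ℕ → F} {piv : ℕ → ℕ}
    (hR : Reduced (I.params r) A₀ r A piv)
    (hmem : I.circuit.poly ∈ Algebra.adjoin F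
      (Set.range fun j : Fin r => linForm fun i : Fin I.n => A₀ j i))
    (hdeg : I.circuit.poly.totalDegree ≤ I.d) :
    ∑ m ∈ Finset.range ((I.d + 1) ^ r), I.gateCoeff r piv I.circuit.out m *
      phiVal (I.params r) A I.pv I.n m = MvPolynomial.eval I.pt (normal I.p I.circuit.poly) := by
  have h1 := partVal_formSubst (I.params r) A I.pv (g := pivSubst F I.n r piv I.circuit.poly)
    (fun e he j => coeff_pivSubst_degree_le (hR.pivOK) hdeg he j)
  have h2 : formSubst I.n r A (pivSubst F I.n r piv I.circuit.poly) = I.circuit.poly :=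
    formSubst_pivSubst (p := I.params r) hR hmem
  have h3 : partVal I.n I.pv I.n I.circuit.poly =
      MvPolynomial.eval I.pt (normal I.p I.circuit.poly) := by
    rw [partVal_self, eval_normal]
    refine Finset.sum_congr rfl fun e _ => ?_
    congr 1
    exact Finset.prod_congr rfl fun i _ => dif_pos i.isLt
  rw [← h3]
  refine Eq.trans (Finset.sum_congr rfl fun m _ => ?_)
    (h1.symm.trans (congrArg (partVal I.n I.pv I.n) h2))
  rw [Input.gateCoeff, dif_pos I.circuit.out.isLt]
  rfl

/-- Comparison of the powers of a number that is at least `10`. -/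
structure PowLE (M X : ℕ) (P : ℕ → ℕ) : Prop where
  zero : P 0 = X
  succ : ∀ k, M * P k = P (k + 1)
  mono : ∀ i k, i ≤ k → P i ≤ P k
  ten : ∀ k, 10 * P k ≤ P (k + 1)

theorem powLE {M : ℕ} (hM : 10 ≤ M) (X : ℕ) : PowLE M X fun k => M ^ k * X where
  zero := by simp
  succ k := by ring
  mono i k h := Nat.mul_le_mul_right _ (Nat.pow_le_pow_right (by omega) h)
  ten k := by
    have : M ^ (k + 1) * X = M * (M ^ k * X) := by ring
    rw [this]
    exact Nat.mul_le_mul_right _ hM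

theorem mainProg_spec (hh : Height ht) {I : Input F} {r X : ℕ} {σ : Store F} (h : I.Loaded r σ)
    (hd : 1 ≤ I.d) (hdeg : I.circuit.poly.totalDegree ≤ I.d) (hp : ∀ i, I.p i ≠ 0)
    (hpd : ∀ i, (I.p i).natDegree ≤ I.d) (hM : (I.params r).Fits M) (hnM : I.n + 1 ≤ M) (h10 : 10 ≤ M)
    (h4 : 4 ^ r ≤ M ^ 2) (hX : I.HeightLE ht X)
    (hform : ∀ j < r, ∀ i < I.n, ht (mat (I.params r) σ j i) ≤ X)
    (hmem : I.circuit.poly ∈ Algebra.adjoin F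
      (Set.range fun j : Fin r => linForm fun i : Fin I.n => mat (I.params r) σ j i))
    (hW : M ^ 18 * X ≤ W) :
    Tr ht M W mainProg σ fun τ =>
      τ.fld 4 0 = MvPolynomial.eval I.pt (normal I.p I.circuit.poly) := by
  -- Only the four comparison rules for `P k = M^k * X` are kept in view. Most estimates below then
  -- become linear in the values `P k`.
  obtain ⟨P, hP⟩ : ∃ P : ℕ → ℕ, P = fun k => M ^ k * X := ⟨_, rfl⟩
  obtain ⟨P0, Ps, Pm, Pt⟩ : PowLE M X P := hP ▸ powLE h10 X
  have hPk (k : ℕ) : P k = M ^ k * X := by rw [hP]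
  rw [← hPk] at hW
  set p := I.params r with hpdef
  have hX1 : 1 ≤ X := (hh.pos _).trans hX.one
  have h0X : ht (0 : F) ≤ X := (hh.zero_le _).trans hX.one
  have hrM : r ≤ M := hM.r
  have hdM : I.d + 1 ≤ M := hM.d
  have hKM : (I.d + 1) ^ r ≤ M := hM.K
  have hHM : r * I.d + 1 ≤ M := hM.h
  have twoM {a Y : ℕ} (ha : a ≤ M) : (a + 1) * Y ≤ 2 * (M * Y) := by
    rw [← mul_assoc]; exact Nat.mul_le_mul_right _ (by omega)
  have hpv : ∀ i < p.n, ∀ k < p.H, ht (I.pv i k) ≤ P 6 := by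
    intro i hi k hk
    replace hi : i < I.n := hi
    replace hk : k < r * I.d + 1 := hk
    rw [Input.pv, dif_pos hi]
    refine (hh.powVal_le (hp ⟨i, hi⟩) (hX.pt _) (hX.gen _) k).trans ?_
    have hD := hpd ⟨i, hi⟩
    calc 10 * (k + 1) * ((I.p ⟨i, hi⟩).natDegree + 1) ^ 2 * (((I.p ⟨i, hi⟩).natDegree + 3) * X)
        ≤ M * M * M ^ 2 * ((M * M) * X) := by gcongr <;> nlinarith
      _ = P 6 := by simp only [hPk]; ring
  have hch : ∀ m < p.B, ∀ k < p.B, ht (Nat.choose m k : F) ≤ P 6 := by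
    intro m hm k hk
    replace hm : m < I.d + 1 := hm
    refine (hh.choose_le hX.one hk).trans ?_
    calc 10 * (m + 1) * (I.d + 1 + 1) ^ 2 * X ≤ M * M * (M * M) ^ 2 * X := by gcongr <;> nlinarith
      _ = P 6 := by simp only [hPk]; ring
  refine Tr.seq ((powProg_spec h.toHasParams hM).mono ?_)
  intro σ₁ f₁ hc₁
  have em₁ : mat p σ₁ = mat p σ := by unfold mat; rw [f₁.fld 1 rfl]
  refine Tr.seq ((gaussProg_spec hh hc₁.toHasParams hM (X := X) (by rw [em₁]; exact hform) ?_).mono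
    ?_)
  · calc 4 ^ r * X ≤ P 2 := hPk 2 ▸ Nat.mul_le_mul_right _ h4
      _ ≤ P 18 := Pm _ _ (by norm_num)
      _ ≤ W := hW
  rintro σ₂ f₂ ⟨hR, hY⟩
  have hc₂ : Ctx p σ₂ := hc₁.frame f₂ rfl rfl
  have hl₂ : I.Loaded r σ₂ := h.of_eq ((f₂.nat 0 rfl).trans (f₁.nat 0 rfl))
    ((f₂.nat 1 rfl).trans (f₁.nat 1 rfl)) ((f₂.nat 2 rfl).trans (f₁.nat 2 rfl))
    ((f₂.nat 3 rfl).trans (f₁.nat 3 rfl)) ((f₂.fld 0 rfl).trans (f₁.fld 0 rfl))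
    ((f₂.fld 2 rfl).trans (f₁.fld 2 rfl)) ((f₂.fld 3 rfl).trans (f₁.fld 3 rfl))
  rw [em₁] at hR
  replace hY : ∀ j < r, ∀ i < I.n, ht (mat p σ₂ j i) ≤ P 2 := fun j hj i hi =>
    (hY j hj i hi).trans (hPk 2 ▸ Nat.mul_le_mul_right _ h4)
  refine Tr.seq ((hl₂.symProg_spec hh hc₂ hd hM hR.pivOK hX ?_).mono ?_)
  · have e1 := Ps 0
    have e2 := Pt 0
    have e3 := Pt 1
    have e4 := Pm 2 18 (by norm_num)
    rw [P0] at e1 e2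
    have e5 : (M + 1) * (2 * X) = 2 * (M * X) + 2 * X := by ring
    norm_num only at e1 e2 e3
    omega
  intro σ₃ f₃ h5
  have hc₃ : Ctx p σ₃ := hc₂.frame f₃ rfl rfl
  refine Tr.seq ((valProg_spec hh hc₃.toHasParams hM (I.powRec hp hpd r) ?_ ?_
    (X := X) (Y := P 6) ?_ hpv ?_).mono ?_)
  · intro i hi k hk
    replace hi : i < I.n := hi
    rw [f₃.fld 2 rfl, Input.genCoeff, dif_pos hi]
    exact hl₂.gen ⟨i, hi⟩ k hk
  · intro i hi
    replace hi : i < I.n := hi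
    rw [f₃.fld 3 rfl, dif_pos hi]
    exact hl₂.pt ⟨i, hi⟩
  · intro i hi k _
    replace hi : i < I.n := hi
    rw [Input.genCoeff, dif_pos hi]
    exact hX.gen _ _
  · have e0 : (I.d + 2) * (X + P 6) ≤ 2 * (M * (X + P 6)) := twoM hdM
    have e : M * (X + P 6) = M * X + M * P 6 := mul_add ..
    have e1 := Ps 6
    have e2 := Ps 0
    have e3 := Pm 1 7 (by norm_num)
    have e4 := Pt 7
    have e5 := Pm 8 18 (by norm_num)
    rw [P0] at e2
    norm_num only at e1 e2 e4
    refine e0.trans ?_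
    omega
  intro σ₄ f₄ h6
  have hc₄ : Ctx p σ₄ := hc₃.frame f₄ rfl rfl
  refine Tr.seq ((chooseProg_spec hc₄.toHasParams hM fun m hm k hk =>
    (hch m hm k hk).trans ((Pm 6 18 (by norm_num)).trans hW)).mono ?_)
  intro σ₅ f₅ h8
  have hc₅ : Ctx p σ₅ := hc₄.frame f₅ rfl rfl
  have em₅ : mat p σ₅ = mat p σ₂ := by
    unfold mat; rw [f₅.fld 1 rfl, f₄.fld 1 rfl, f₃.fld 1 rfl]
  have hpowA : ∀ i < p.n, ∀ j < p.r, ∀ e < p.B, ht (mat p σ₂ j i ^ e) ≤ P 3 := by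
    intro i hi j hj e he
    replace he : e < I.d + 1 := he
    refine (hh.pow_le _ _).trans ?_
    rw [show P 3 = M * P 2 from (Ps 2).symm]
    exact Nat.mul_le_mul (by omega) (hY j hj i hi)
  have hZ : ∀ i < p.n, ∀ m < p.B, ∀ k < p.B, ∀ j < p.r,
      ht ((Nat.choose m k : F) * mat p σ₂ j i ^ k) ≤ P 7 := by
    intro i hi m hm k hk j hj
    have e1 := hh.mul_le (Nat.choose m k : F) (mat p σ₂ j i ^ k)
    have e2 := hch m hm k hk
    have e3 := hpowA i hi j hj k hk
    have e4 := Pm 3 6 (by norm_num)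
    have e5 : 10 * P 6 ≤ P 7 := Pt 6
    omega
  -- A product of `r` factors of height `P 7` has height at most `2 * P 8`, and the value `I.pv`
  -- adds at most `P 6`.
  have hU : ∀ i < p.n, ∀ m < p.K, ∀ k < p.K, ht (coefU p (mat p σ₂) I.pv i m k) ≤ P 10 := by
    intro i hi m _ k _
    have hB : 0 < p.B := Nat.succ_pos _
    have e1 := hh.prod_le (X := P 7) (fun j => (Nat.choose (dig p.B m j) (dig p.B k j) : F) *
      mat p σ₂ j i ^ dig p.B k j) r (fun j hj => hZ i hi _ (dig_lt hB _ _) _ (dig_lt hB _ _) j hj)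
      (h0X.trans (P0 ▸ Pm 0 7 (by norm_num)))
    have e2 := hpv i hi _ (digSum_lt k)
    have e3 := hh.mul_le (∏ j ∈ Finset.range r, ((Nat.choose (dig p.B m j) (dig p.B k j) : F) *
      mat p σ₂ j i ^ dig p.B k j)) (I.pv i (digSum p k))
    have e4 : (r + 1) * P 7 ≤ 2 * (M * P 7) := twoM hrM
    have e5 : M * P 7 = P 8 := Ps 7
    have e6 := Pm 6 8 (by norm_num)
    have e7 : 10 * P 8 ≤ P 9 := Pt 8
    have e8 := Pm 9 10 (by norm_num)
    refine e3.trans ?_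
    omega
  have hΦr := phiVal_rec p (mat p σ₂) I.pv
  -- Here subadditivity would be exponential in `n`; `rec_le` costs six powers of `M` instead.
  have hΦ : ∀ i ≤ p.n, ∀ m < p.K, ht (phiVal p (mat p σ₂) I.pv i m) ≤ P 16 := by
    intro i hi m hm
    refine (hh.rec_le p.n p.K (P 10) (phiVal p (mat p σ₂) I.pv) (coefU p (mat p σ₂) I.pv)
      (fun m k => m - k) (fun m hm k _ => by omega) ?_ hU hΦr.succ i hi m hm).trans ?_
    · intro m hm
      rw [hΦr.zero m hm]
      have := Pm 0 10 (by norm_num)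
      rw [P0] at this
      split_ifs
      · exact hX.one.trans this
      · exact h0X.trans this
    · calc 10 * (I.n + 1) * ((I.d + 1) ^ r + 1) ^ 2 * P 10 ≤ (M * M) * (M * M) ^ 2 * P 10 := by
            gcongr
            nlinarith
        _ = P 16 := by simp only [hPk]; ring
  have hV : ∀ i < p.n, ∀ m < p.K, ∀ k < p.K,
      ht (coefU p (mat p σ₂) I.pv i m k * phiVal p (mat p σ₂) I.pv i (m - k)) ≤ P 16 + P 10 := by
    intro i hi m hm k hk
    have e1 := hh.mul_le (coefU p (mat p σ₂) I.pv i m k) (phiVal p (mat p σ₂) I.pv i (m - k))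
    have e2 := hU i hi m hm k hk
    have e3 := hΦ i (le_of_lt hi) (m - k) (by omega)
    omega
  have hVW : ((I.d + 1) ^ r + 1) * (P 16 + P 10) ≤ W := by
    have e0 : ((I.d + 1) ^ r + 1) * (P 16 + P 10) ≤ 2 * (M * (P 16 + P 10)) := twoM hKM
    have e : M * (P 16 + P 10) = M * P 16 + M * P 10 := mul_add ..
    have e1 : M * P 16 = P 17 := Ps 16
    have e2 : M * P 10 = P 11 := Ps 10
    have e3 := Pm 11 17 (by norm_num)
    have e4 : 10 * P 17 ≤ P 18 := Pt 17
    refine e0.trans ?_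
    omega
  have hXP : X ≤ P 10 := P0 ▸ Pm 0 10 (by norm_num)
  refine Tr.seq ((phiProg_spec hh hc₅ hM (h := I.pv) (Z := P 7) (V := P 16 + P 10)
    (by rw [em₅]; exact hΦr) h8 ?_ ?_ ?_ ?_ ?_ ?_ hVW ?_).mono ?_)
  · rw [f₅.fld 6 rfl]; exact h6
  · rw [em₅]; exact fun i hi j hj e he => (hpowA i hi j hj e he).trans (Pm 3 7 (by norm_num))
  · rw [em₅]; exact hZ
  · exact hX.one.trans (P0 ▸ Pm 0 7 (by norm_num))
  · have e4 : (r + 1) * P 7 ≤ 2 * (M * P 7) := twoM hrM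
    have e5 : M * P 7 = P 8 := Ps 7
    have e7 : 10 * P 8 ≤ P 9 := Pt 8
    have e8 := Pm 9 18 (by norm_num)
    refine e4.trans ?_
    omega
  · rw [em₅]; exact hV
  · omega
  intro σ₆ f₆ h9
  have hc₆ : Ctx p σ₆ := hc₅.frame f₆ rfl rfl
  refine (finalProg_spec hh hc₆ hM (g := I.gateCoeff r (σ₂.nat 5) I.circuit.out)
    (f := phiVal p (mat p σ₂) I.pv I.n) ?_ (h9 I.n le_rfl) (V := P 16 + P 10) ?_ (by omega)
    hVW).mono ?_
  · rw [f₆.fld 5 rfl, f₅.fld 5 rfl, f₄.fld 5 rfl]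
    exact h5 I.circuit.out I.circuit.out.isLt
  · intro m hm
    have e1 := hh.mul_le (I.gateCoeff r (σ₂.nat 5) I.circuit.out m) (phiVal p (mat p σ₂) I.pv I.n m)
    have e2 : ht (I.gateCoeff r (σ₂.nat 5) I.circuit.out m) ≤ X :=
      hX.gateCoeff_le hh hR.pivOK I.circuit.out m
    have e3 := hΦ I.n le_rfl m hm
    omega
  · intro τ _ hτ
    rw [hτ]
    exact I.sum_gateCoeff hR hmem hdeg

end

/-! ### The case of degree one -/

/-- The coefficients of the linear part of the polynomial of the circuit, as the only form. -/
def linProg : Prog :=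
  .seq powProg (forN 30 nE (.seq (.setN 5 (.lit 0) (.add (nv 30) (.lit 1)))
    (.seq symProg (.setF 1 (nv 30) (.get 5 (.add (.mul kE outE) (.lit 1)))))))

section

variable {F : Type u} [Field F] {ht : F → ℕ} {M W : ℕ}

theorem coeff_killCompl {σ τ : Type} {f : σ → τ} (hf : Function.Injective f)
    (q : MvPolynomial τ F) (e : σ →₀ ℕ) :
    (MvPolynomial.killCompl hf q).coeff e = q.coeff (e.mapDomain f) := by
  classical
  induction q using MvPolynomial.induction_on' with
  | monomial m c =>
    rw [MvPolynomial.coeff_monomial]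
    by_cases hm : ∃ s : σ →₀ ℕ, s.mapDomain f = m
    · obtain ⟨s, rfl⟩ := hm
      rw [MvPolynomial.killCompl_monomial_mapDomain, MvPolynomial.coeff_monomial]
      simp only [(Finsupp.mapDomain_injective hf).eq_iff]
    · rw [if_neg fun h => hm ⟨e, h.symm⟩,
        MvPolynomial.killCompl_monomial_eq_zero_of_not_subset, MvPolynomial.coeff_zero]
      intro hs
      exact hm ⟨m.comapDomain f hf.injOn, Finsupp.mapDomain_comapDomain f hf m hs⟩
  | add a b ha hb => simp only [map_add, MvPolynomial.coeff_add, ha, hb]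

/-- With variable `i` as the only pivot, all other variables are set to zero, and code `1` is the
exponent vector of `y_0`. -/
theorem Input.gateCoeff_single (I : Input F) {B : ℕ} (hd : I.d + 1 = B) (hB : 2 ≤ B) {piv : ℕ → ℕ}
    (i : Fin I.n) (h : piv 0 = i + 1) :
    I.gateCoeff 1 piv I.circuit.out 1 = I.circuit.poly.coeff (Finsupp.single i 1) := by
  have hf : Function.Injective fun _ : Fin 1 => i := fun _ _ _ => Subsingleton.elim _ _
  have hj := digF_pow (B := B) (r := 1) hB 0
  simp only [Fin.val_zero, pow_zero] at hj
  rw [Input.gateCoeff, dif_pos I.circuit.out.isLt, hd, hj,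
    pivSubst_eq_killCompl hf (fun j => by rw [Subsingleton.elim j 0]; exact h), coeff_killCompl,
    Finsupp.mapDomain_single]
  rfl

/-- An affine polynomial is a constant plus its linear part. -/
theorem mem_adjoin_of_totalDegree_le_one {n : ℕ} {f : MvPolynomial (Fin n) F}
    (hf : f.totalDegree ≤ 1) : f ∈ Algebra.adjoin F
      (Set.range fun _ : Fin 1 => linForm fun i => f.coeff (Finsupp.single i 1)) := by
  classical
  have e : f = algebraMap F _ (f.coeff 0) + linForm fun i => f.coeff (Finsupp.single i 1) := by
    ext m
    rw [MvPolynomial.algebraMap_eq, MvPolynomial.coeff_add, MvPolynomial.coeff_C, linForm,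
      MvPolynomial.coeff_sum]
    simp only [MvPolynomial.coeff_C_mul, MvPolynomial.coeff_X, mul_ite, mul_one, mul_zero]
    rcases Nat.lt_trichotomy m.degree 1 with h | h | h
    · obtain rfl : m = 0 := by rw [← Finsupp.degree_eq_zero_iff]; omega
      simp
    · obtain ⟨i, rfl⟩ := (Finsupp.sum_eq_one_iff m).1 h
      have h0 : (0 : Fin n →₀ ℕ) ≠ Finsupp.single i 1 := by simp [eq_comm]
      rw [if_neg h0, zero_add, Finset.sum_eq_single i]
      · simp
      · intro j _ hj
        rw [if_neg fun h' => hj (Finsupp.single_left_injective one_ne_zero h')]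
      · simp
    · have h1 : f.coeff m = 0 :=
        MvPolynomial.coeff_eq_zero_of_totalDegree_lt (lt_of_le_of_lt hf h)
      rw [h1, if_neg (by rintro rfl; simp at h), Finset.sum_eq_zero, add_zero]
      intro i _
      rw [if_neg (by rintro rfl; simp at h)]
  set A := Algebra.adjoin F
    (Set.range fun _ : Fin 1 => linForm fun i => f.coeff (Finsupp.single i 1)) with hA
  have key := A.add_mem (A.algebraMap_mem (f.coeff 0)) (Algebra.subset_adjoin ⟨0, rfl⟩ :
    linForm (fun i => f.coeff (Finsupp.single i 1)) ∈ A)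
  rwa [← e] at key

/-- Each coefficient of the linear part is found by one evaluation of the circuit with a single
pivot and two coefficients per gate. The original forms are not used. -/
theorem linProg_spec (hh : Height ht) {I : Input F} {X : ℕ} {σ : Store F} (h : I.Loaded 1 σ)
    (hd : I.d = 1) (hM : (I.params 1).Fits M) (hnM : I.n + 1 ≤ M) (hX : I.HeightLE ht X)
    (hW : (M + 1) * (2 * X) ≤ W) :
    Tr ht M W linProg σ fun τ => I.Loaded 1 τ ∧
      ∀ i : Fin I.n, τ.fld 1 i = I.circuit.poly.coeff (Finsupp.single i 1) := by
  have hXW : X ≤ W := le_trans (by nlinarith) hW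
  refine Tr.seq ((powProg_spec h.toHasParams hM).mono ?_)
  intro σ₁ f₁ hc₁
  have hl {P : Prog} {σ τ : Store F} (h : I.Loaded 1 σ) (f : Frame P σ τ)
      (h0 : ∀ a < 4, P.modN a = false) (h1 : ∀ a < 4, a ≠ 1 → P.modF a = false) : I.Loaded 1 τ :=
    h.of_eq (f.nat 0 (h0 0 (by decide))) (f.nat 1 (h0 1 (by decide))) (f.nat 2 (h0 2 (by decide)))
      (f.nat 3 (h0 3 (by decide))) (f.fld 0 (h1 0 (by decide) (by decide)))
      (f.fld 2 (h1 2 (by decide) (by decide))) (f.fld 3 (h1 3 (by decide) (by decide)))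
  have hl₁ : I.Loaded 1 σ₁ := hl h f₁ (by decide) (by decide)
  refine Tr.forN I.n (fun k τ => ∀ i : Fin I.n, (i : ℕ) < k →
    τ.fld 1 i = I.circuit.poly.coeff (Finsupp.single i 1)) rfl hl₁.n hM.n
    (fun i hi => absurd hi (by omega)) ?_
    fun τ hf hI => ⟨hl hl₁ hf (by decide) (by decide), fun i => hI i i.isLt⟩
  intro k τ hk hf hc hI
  have hlτ : I.Loaded 1 τ := hl hl₁ hf (by decide) (by decide)
  have hcτ : Ctx (I.params 1) τ := hc₁.frame hf rfl rfl
  have hv : (NExpr.add (nv 30) (.lit 1)).val τ = k + 1 := by simp [NExpr.val, hc]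
  refine Tr.seq (Tr.setN (by rw [hv]; omega) ?_)
  rw [hv]
  simp only [NExpr.val]
  have hl₂ : I.Loaded 1 (τ.setN 5 0 (k + 1)) :=
    hlτ.of_eq (setN_nat_ne _ _ _ (by decide)) (setN_nat_ne _ _ _ (by decide))
      (setN_nat_ne _ _ _ (by decide)) (setN_nat_ne _ _ _ (by decide)) rfl rfl rfl
  have hc₂ : Ctx (I.params 1) (τ.setN 5 0 (k + 1)) :=
    hcτ.of_eq (setN_nat_ne _ _ _ (by decide)) (setN_nat_ne _ _ _ (by decide))
  have hp0 : (τ.setN 5 0 (k + 1)).nat 5 0 = k + 1 := by simp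
  have hpiv : PivOK I.n 1 ((τ.setN 5 0 (k + 1)).nat 5) :=
    ⟨fun j hj => by obtain rfl : j = 0 := by omega
                    omega,
      fun j hj j' hj' _ _ => by omega⟩
  refine Tr.seq ((hl₂.symProg_spec hh hc₂ hd.ge hM hpiv hX hW).mono ?_)
  intro υ g hυ
  have hcυ : Ctx (I.params 1) υ := hc₂.frame g rfl rfl
  have h30 : υ.nat 30 0 = k := by
    rw [g.nat 30 rfl, setN_nat_ne _ _ _ (by decide)]; exact hc
  have hval : (FExpr.get 5 (.add (.mul kE outE) (.lit 1))).val υ =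
      I.circuit.poly.coeff (Finsupp.single ⟨k, hk⟩ 1) := by
    have e1 : (NExpr.add (.mul kE outE) (.lit 1)).val υ =
        (I.d + 1) ^ 1 * I.circuit.out + 1 := by
      have e2 := hcυ.K
      have e3 := hcυ.r
      have e4 := hcυ.out
      simp only [NExpr.val, e3, e4, e2]
      rfl
    rw [FExpr.val, e1, hυ _ I.circuit.out.isLt 1 (by rw [hd]; norm_num)]
    exact I.gateCoeff_single rfl (by omega) ⟨k, hk⟩ hp0
  refine Tr.setF ?_ ?_
  · rw [hval]; exact (hX.gate _ _).trans hXW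
  · rw [hval]
    intro i hi
    have hki : (nv 30).val υ = k := h30
    rw [setN_fld, setF_fld_self, hki]
    rcases Nat.lt_succ_iff_lt_or_eq.1 hi with hi | hi
    · rw [Function.update_of_ne (by omega), g.fld 1 rfl]
      exact hI i hi
    · rw [hi, Function.update_self]
      congr 2
      exact Fin.ext hi.symm

/-! ### The program -/

/-- For degree bound one, replace the number of forms by one. -/
def firstProg : Prog := .ifZeroN (.sub dE (.lit 1)) (.setN 0 (.lit 1) (.lit 1)) .skip

def restProg : Prog := .seq (.ifZeroN (.sub dE (.lit 1)) linProg .skip) mainProg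

/-- The remainder at the point. -/
def prog : Prog := .seq firstProg restProg

/-- The number of forms after the first step. -/
def Input.rEff (I : Input F) : ℕ := if I.d = 1 then 1 else I.r

theorem restProg_spec (hh : Height ht) {I : Input F} (hI : I.Valid) {X : ℕ} {σ : Store F}
    (h : I.Loaded I.rEff σ) (hM : (I.params I.rEff).Fits M) (hnM : I.n + 1 ≤ M) (h10 : 10 ≤ M)
    (h4 : 4 ^ I.rEff ≤ M ^ 2) (hX : I.HeightLE ht X) (hform : ∀ j i, ht (I.form j i) ≤ X)
    (hσ : ∀ (j : Fin I.r) (i : Fin I.n), σ.fld 1 (I.n * j + i) = I.form j i)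
    (hW : M ^ 18 * X ≤ W) :
    Tr ht M W restProg σ fun τ =>
      τ.fld 4 0 = MvPolynomial.eval I.pt (normal I.p I.circuit.poly) := by
  have hdv : (NExpr.sub dE (.lit 1)).val σ = I.d - 1 := by
    have := h.d
    simp only [NExpr.val, this]
    rfl
  have h1d := hI.one_le_d
  refine Tr.seq (Tr.ifZeroN (fun h0 => ?_) fun h0 => Tr.skip ?_) <;> rw [hdv] at h0
  · have hd : I.d = 1 := by omega
    have hr : I.rEff = 1 := if_pos hd
    rw [hr] at h hM h4
    refine (linProg_spec hh h hd hM hnM hX ?_).mono ?_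
    · obtain ⟨P0, Ps, Pm, Pt⟩ := powLE h10 X
      have e1 : M ^ 2 * X ≤ M ^ 18 * X := Pm 2 18 (by norm_num)
      nlinarith
    rintro τ - ⟨hl, hτ⟩
    have hmat : ∀ i : Fin I.n, mat (I.params 1) τ 0 i =
        I.circuit.poly.coeff (Finsupp.single i 1) := by
      intro i
      rw [← hτ i, mat]
      simp
    refine mainProg_spec hh hl h1d hI.totalDegree_le hI.p_ne_zero hI.natDegree_le hM hnM h10 h4 hX
      ?_ ?_ hW
    · intro j hj i hi
      obtain rfl : j = 0 := by omega
      rw [hmat ⟨i, hi⟩]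
      exact hX.gate _ _
    · have := mem_adjoin_of_totalDegree_le_one (hd ▸ hI.totalDegree_le)
      convert this using 5 with j i
      rw [Subsingleton.elim j 0]
      exact funext hmat
  · have hr : I.rEff = I.r := if_neg (by omega)
    rw [hr] at h hM h4
    refine mainProg_spec hh h h1d hI.totalDegree_le hI.p_ne_zero hI.natDegree_le hM hnM h10 h4 hX
      ?_ ?_ hW
    · intro j hj i hi
      exact (congrArg ht (hσ ⟨j, hj⟩ ⟨i, hi⟩)).trans_le (hform _ _)
    · convert hI.mem_adjoin using 5 with j
      exact funext (hσ j)

end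

/-! ### The initial memory -/

section

variable {F : Type u} [Field F] {ht : F → ℕ} {M W : ℕ}

theorem Gate.fst_le {n m : ℕ} (g : Gate F n m) : g.fst ≤ n + m := by
  cases g <;> simp only [Gate.fst] <;> omega

theorem Gate.snd_le {n m : ℕ} (g : Gate F n m) : g.snd ≤ n + m := by
  cases g <;> simp only [Gate.snd] <;> omega

theorem Gate.code_le {n m : ℕ} (g : Gate F n m) : g.code ≤ 3 := by
  cases g <;> simp [Gate.code]

/-- The excluded cell holds `r`, which for `d = 1` may exceed every bound allowed for the running
time. -/
theorem Input.store_nat_le (I : Input F) {a i : ℕ} (h : ¬ (a = 0 ∧ i = 1)) :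
    I.store.nat a i ≤ I.n + I.circuit.size + I.d + 3 := by
  rcases a with _ | _ | _ | _ | a <;> simp only [Input.store]
  · rcases i with _ | _ | _ | _ | _ | i
    · simp; omega
    · exact absurd ⟨rfl, rfl⟩ h
    · simp; omega
    · simp; omega
    · have := I.circuit.out.isLt
      simp; omega
    · simp
  · split_ifs
    · exact (Gate.code_le _).trans (by omega)
    · omega
  · split_ifs
    · exact (Gate.fst_le _).trans (by omega)
    · omega
  · split_ifs
    · exact (Gate.snd_le _).trans (by omega)
    · omega
  · omega

theorem Input.store_fld_le (hh : Height ht) {I : Input F} {X : ℕ} (hX : I.HeightLE ht X)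
    (hform : ∀ j i, ht (I.form j i) ≤ X) (a i : ℕ) : ht (I.store.fld a i) ≤ X := by
  have h0 : ht (0 : F) ≤ X := (hh.zero_le _).trans hX.one
  rcases a with _ | _ | _ | _ | a <;> simp only [Input.store]
  · split_ifs with h
    · have hg := hX.gate ⟨i, h⟩ 0
      rw [Circuit.gatePoly] at hg
      cases hgate : I.circuit.gate ⟨i, h⟩ with
      | const a =>
        rw [hgate] at hg
        simpa [Gate.scalar] using hg
      | var _ => exact h0
      | add _ _ => exact h0
      | mul _ _ => exact h0
    · exact h0
  · split_ifs
    exacts [hform _ _, h0]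
  · split_ifs
    exacts [hX.gen _ _, h0]
  · split_ifs
    exacts [hX.pt _, h0]
  · exact h0

theorem finProdFinEquiv_symm_mk {m n j i : ℕ} (hj : j < m) (hi : i < n) (h : n * j + i < m * n) :
    finProdFinEquiv.symm (⟨n * j + i, h⟩ : Fin (m * n)) = (⟨j, hj⟩, ⟨i, hi⟩) := by
  rw [Equiv.symm_apply_eq]
  ext
  simp [finProdFinEquiv, add_comm]

theorem mul_add_lt_mul {m n j i : ℕ} (hj : j < m) (hi : i < n) : n * j + i < m * n := by
  have : n * (j + 1) ≤ n * m := Nat.mul_le_mul_left _ hj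
  rw [mul_comm m n]
  rw [mul_add] at this
  omega

theorem Input.store_form (I : Input F) (j : Fin I.r) (i : Fin I.n) :
    I.store.fld 1 (I.n * j + i) = I.form j i := by
  simp only [Input.store]
  rw [dif_pos (mul_add_lt_mul j.isLt i.isLt), finProdFinEquiv_symm_mk j.isLt i.isLt]

theorem Input.store_loaded (I : Input F) : I.Loaded I.r I.store where
  n := rfl
  r := rfl
  d := rfl
  s := rfl
  out := rfl
  code m := by simp [Input.store]
  fst m := by simp [Input.store]
  snd m := by simp [Input.store]
  scalar m := by simp [Input.store]
  gen i k hk := by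
    simp only [Input.store]
    rw [dif_pos (mul_add_lt_mul i.isLt hk), finProdFinEquiv_symm_mk i.isLt hk]
  pt i := by simp [Input.store]

theorem Input.sub_one_val (I : Input F) : (NExpr.sub dE (.lit 1)).val I.store = I.d - 1 := rfl

theorem firstProg_exec {I : Input F} (hd : 1 ≤ I.d) :
    firstProg.exec I.store = if I.d = 1 then I.store.setN 0 1 1 else I.store := by
  have e : (NExpr.sub dE (.lit 1)).val I.store = 0 ↔ I.d = 1 := by
    rw [I.sub_one_val]; omega
  simp only [firstProg, Prog.exec, e]
  rfl

theorem firstProg_loaded {I : Input F} (hd : 1 ≤ I.d) :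
    I.Loaded I.rEff (firstProg.exec I.store) := by
  have h := I.store_loaded
  rw [firstProg_exec hd, Input.rEff]
  split_ifs
  · exact ⟨⟨h.n, rfl, h.d, h.s, h.out⟩, h.code, h.fst, h.snd, h.scalar, h.gen, h.pt⟩
  · exact h

theorem firstProg_fld (I : Input F) : (firstProg.exec I.store).fld = I.store.fld :=
  funext fun a => (firstProg.frame I.store).fld a rfl

theorem firstProg_nat_le {I : Input F} (hd : 1 ≤ I.d) (a i : ℕ) :
    (firstProg.exec I.store).nat a i ≤ I.n + I.circuit.size + I.d + I.rEff + 3 := by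
  by_cases h : a = 0 ∧ i = 1
  · obtain ⟨rfl, rfl⟩ := h
    rw [(firstProg_loaded hd).r]
    simp only [Input.params]
    omega
  · have h1 := I.store_nat_le h
    rw [firstProg_exec hd]
    split_ifs
    · rcases eq_or_ne a 0 with rfl | ha
      · rw [setN_nat_self, Function.update_of_ne fun h' => h ⟨rfl, h'⟩]
        omega
      · rw [setN_nat_ne _ _ _ ha]
        omega
    · omega

/-- This step is charged directly and not by `Prog.cost_le`, because the memory is not yet bounded
while `r` is in it. The program overwrites `r` without reading it. -/
theorem firstProg_cost {I : Input F} (w : F → ℕ) (hd : 1 ≤ I.d) :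
    firstProg.cost w I.store ≤ 12 + 2 * I.d := by
  classical
  have h1 : (NExpr.sub dE (.lit 1)).cost I.store ≤ 6 + 2 * I.d := by
    have e1 := size_le_self I.d
    have e2 := size_le_self (I.d - 1)
    have e3 : (NExpr.sub dE (.lit 1)).cost I.store =
        1 + Nat.size 2 + 1 + I.d.size + (1 + Nat.size 1) + 1 + (I.d - 1).size := rfl
    have e4 : Nat.size 2 = 2 := by decide
    have e5 : Nat.size 1 = 1 := by decide
    omega
  have h2 : (Prog.setN 0 (.lit 1) (.lit 1)).cost w I.store = 5 := rfl
  have h3 : Prog.skip.cost w I.store = 1 := rfl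
  simp only [firstProg, Prog.cost.eq_5]
  split_ifs <;> omega

/-! ### Correctness and running time -/

/-- A bound for the numbers in the memory. -/
def Input.bound (I : Input F) : ℕ :=
  10 * (I.n + I.circuit.size + 1) * (I.d + 1) ^ (2 * I.rEff)

theorem Input.Valid.one_le_rEff {I : Input F} (hI : I.Valid) : 1 ≤ I.rEff := by
  have := hI.one_le_r
  rw [Input.rEff]; split_ifs <;> omega

theorem Input.Valid.fits {I : Input F} (hI : I.Valid) : (I.params I.rEff).Fits I.bound ∧
    14 + 2 * I.d ≤ I.bound ∧ I.n + I.circuit.size + I.d + I.rEff + 3 ≤ I.bound ∧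
    4 ^ I.rEff ≤ I.bound ^ 2 := by
  have hd := hI.one_le_d
  have hr := hI.one_le_rEff
  obtain ⟨Q, hQ⟩ : ∃ Q, Q = (I.d + 1) ^ (2 * I.rEff) := ⟨_, rfl⟩
  have hM : I.bound = 10 * (I.n + I.circuit.size + 1) * Q := by rw [hQ]; rfl
  have hQ1 : 1 ≤ Q := hQ ▸ Nat.one_le_pow _ _ (by omega)
  have m1 : 10 * Q ≤ I.bound := by rw [hM]; nlinarith [Nat.zero_le ((I.n + I.circuit.size) * Q)]
  have m2 : 10 * (I.n + I.circuit.size + 1) ≤ I.bound := by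
    rw [hM]; exact Nat.le_mul_of_pos_right _ hQ1
  have q1 : (I.d + 1) ^ I.rEff ≤ Q := hQ ▸ Nat.pow_le_pow_right (by omega) (by omega)
  -- Bernoulli's inequality: besides the number of monomials, `r`, `d` and `r * d + 1` are all below
  -- `(d+1)^r`.
  have q2 : 1 + I.rEff * I.d ≤ (I.d + 1) ^ I.rEff := by
    have := one_add_mul_le_pow_of_sq_nonneg (a := I.d) (Nat.zero_le _) (Nat.zero_le _)
      (Nat.zero_le _) I.rEff
    rw [add_comm I.d 1]
    simpa using this
  have q3 : I.d ≤ I.rEff * I.d := Nat.le_mul_of_pos_left _ hr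
  have q4 : I.rEff ≤ I.rEff * I.d := Nat.le_mul_of_pos_right _ hd
  have q5 : 4 ^ I.rEff ≤ Q := by
    rw [hQ, pow_mul]
    exact Nat.pow_le_pow_left (by nlinarith) _
  refine ⟨⟨?_, ?_, ?_, ?_, ?_, ?_⟩, by omega, by omega, ?_⟩
  · show I.n ≤ _; omega
  · show I.rEff ≤ _; omega
  · show I.d + 1 ≤ _; omega
  · show I.circuit.size ≤ _; omega
  · show I.rEff * I.d + 1 ≤ _; omega
  · show (I.d + 1) ^ I.rEff ≤ _; omega
  · calc 4 ^ I.rEff ≤ I.bound := by omega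
      _ ≤ I.bound ^ 2 := Nat.le_self_pow (by norm_num) _

/-- For `d ≥ 2` the base `d + 1` is at most `d^2`, while for `d = 1` a single form is left and `4`
is a constant. Since a circuit has a gate, `N ≥ 2`, and `N^6 ≥ 64` absorbs the constants. -/
theorem Input.Valid.bound_le {I : Input F} (hI : I.Valid) {N : ℕ}
    (hN : I.n + I.circuit.size + 1 ≤ N) : I.bound ≤ N ^ 7 * I.d ^ (4 * I.r) := by
  have hd := hI.one_le_d
  have hs : 1 ≤ I.circuit.size := Fin.pos I.circuit.out
  have hN6 : 2 ^ 6 ≤ N ^ 6 := Nat.pow_le_pow_left (by omega) 6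
  have hN7 : N ^ 7 = N ^ 6 * N := rfl
  rw [Input.bound, Input.rEff]
  by_cases h1 : I.d = 1
  · rw [if_pos h1, h1, one_pow, hN7]
    norm_num at hN6 ⊢
    nlinarith
  · rw [if_neg h1]
    refine Nat.mul_le_mul ?_ ?_
    · rw [hN7]; exact Nat.mul_le_mul (by omega) hN
    · calc (I.d + 1) ^ (2 * I.r) ≤ (I.d ^ 2) ^ (2 * I.r) := Nat.pow_le_pow_left (by nlinarith [show 2 ≤ I.d by omega]) _
        _ = I.d ^ (4 * I.r) := by rw [← pow_mul]; ring_nf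

theorem prog_spec (hh : Height ht) {I : Input F} (hI : I.Valid) {X : ℕ} (hX : I.HeightLE ht X)
    (hform : ∀ j i, ht (I.form j i) ≤ X) {w : F → ℕ} (hw : ∀ a, w a ≤ 2 * ht a) :
    I.Solves prog ∧ prog.cost w I.store ≤ I.bound ^ (restProg.expo + 19) * X := by
  obtain ⟨hM, h14, hnat, h4⟩ := hI.fits
  have hd := hI.one_le_d
  have hX1 : 1 ≤ X := (hh.pos _).trans hX.one
  have hW1 : X ≤ I.bound ^ 18 * X := Nat.le_mul_of_pos_left _ (Nat.pow_pos (by omega))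
  have hf := firstProg_fld I
  have key := restProg_spec (M := I.bound) hh hI (firstProg_loaded hd) hM (by omega) (by omega) h4
    hX hform (by rw [hf]; exact I.store_form) le_rfl
  have hb : (firstProg.exec I.store).Bdd ht I.bound (I.bound ^ 18 * X) :=
    ⟨fun a i => (firstProg_nat_le hd a i).trans hnat,
      fun a i => by rw [hf]; exact (Input.store_fld_le hh hX hform a i).trans hW1⟩
  refine ⟨⟨_, isRemainder_normal _ hI.p_ne_zero _, fun R' h => h.eq_normal hI.p_ne_zero, key.2⟩, ?_⟩
  have h1 := restProg.cost_le hh hw _ (by omega) key.1 hb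
  have h2 := firstProg_cost w hd
  have h3 : prog.cost w I.store =
      firstProg.cost w I.store + restProg.cost w (firstProg.exec I.store) + 1 := rfl
  -- The exponent `18` comes from the bound on the heights, and one further power pays for the first
  -- step.
  have h5 : I.bound ^ (restProg.expo + 19) * X =
      I.bound * (I.bound ^ restProg.expo * (I.bound ^ 18 * X)) := by ring
  have h6 : 1 ≤ I.bound ^ restProg.expo * (I.bound ^ 18 * X) :=
    Nat.mul_pos (Nat.pow_pos (by omega)) (by omega)
  rw [h3, h5]
  generalize I.bound ^ restProg.expo * (I.bound ^ 18 * X) = Y at *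
  have h7 : (14 + 2 * I.d) * Y ≤ I.bound * Y := Nat.mul_le_mul_right _ h14
  nlinarith

theorem Input.Valid.bound_pow_le {I : Input F} (hI : I.Valid) {N : ℕ}
    (hN : I.n + I.circuit.size + 1 ≤ N) (e : ℕ) :
    I.bound ^ e ≤ I.d ^ ((7 * e + 1) * I.r) * N ^ (7 * e) :=
  calc I.bound ^ e ≤ (N ^ 7 * I.d ^ (4 * I.r)) ^ e := Nat.pow_le_pow_left (hI.bound_le hN) _
    _ = I.d ^ (4 * I.r * e) * N ^ (7 * e) := by rw [mul_pow, ← pow_mul, ← pow_mul, mul_comm]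
    _ ≤ _ := Nat.mul_le_mul_right _ (Nat.pow_le_pow_right hI.one_le_d (by nlinarith))

end

end UnivRem

end

/-! ### The two cost models. -/

theorem theorem1p3 :
    ∃ (P : UnivRem.Prog) (c : ℕ),
      (∀ (F : Type*) [Field F] (I : UnivRem.Input F), I.Valid →
        I.Solves P ∧
        ∀ (w : F → ℕ) (τ : ℕ), (∀ a, w a ≤ τ) →
          P.cost w I.store ≤ (τ + 1) * (I.d ^ (c * I.r) * (I.n + I.circuit.size + 1) ^ c)) ∧
      (∀ (I : UnivRem.Input ℚ) (L : ℕ), I.Valid → I.BitsLE L →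
        I.Solves P ∧
        P.cost UnivRem.ratSize I.store ≤
          I.d ^ (c * I.r) * (I.n + I.circuit.size + L + 1) ^ c) := by
  -- The factor `7` is the exponent of `N` in `bound_le`, and it also exceeds the exponent `4` of
  -- `d` there. The last `1` is for the factor `L + 1` over `ℚ`.
  refine ⟨UnivRem.prog, 7 * (UnivRem.restProg.expo + 19) + 1, fun F _ I hI => ?_,
    fun I L hI hL => ?_⟩
  · have hX (τ : ℕ) : I.HeightLE (fun _ => τ + 1) (τ + 1) :=
      ⟨le_rfl, fun _ _ => le_rfl, fun _ _ => le_rfl, fun _ => le_rfl⟩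
    -- Correctness does not depend on weights, so any weight and constant height will do.
    refine ⟨(UnivRem.prog_spec (w := fun _ => 0) (.const F 0) hI (hX 0) (fun _ _ => le_rfl)
      fun _ => by simp).1, fun w τ hw => ?_⟩
    refine (UnivRem.prog_spec (.const F τ) hI (hX τ) (fun _ _ => le_rfl)
      fun a => (hw a).trans (by omega)).2.trans ?_
    rw [mul_comm]
    refine Nat.mul_le_mul_left _ ((hI.bound_pow_le le_rfl _).trans ?_)
    exact Nat.mul_le_mul_left _ (Nat.pow_le_pow_right (by omega) (by omega))
  · have hle {q : ℚ} (h : UnivRem.ratSize q ≤ L) : UnivRem.ratHt q ≤ L + 1 :=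
      (UnivRem.ratHt_le_ratSize q).trans (by omega)
    have hone : UnivRem.ratHt 1 ≤ L + 1 :=
      -- The height of `1` is minimal, so any coefficient bounded by the promise bounds it.
      (UnivRem.height_ratHt.one_le _).trans (hle (hL.gate I.circuit.out 0))
    obtain ⟨h1, h2⟩ := UnivRem.prog_spec UnivRem.height_ratHt hI (X := L + 1)
      ⟨hone, fun m e => hle (hL.gate m e), fun i k => hle (hL.p i k), fun i => hle (hL.pt i)⟩
      (fun j i => hle (hL.form j i)) UnivRem.ratSize_le_ratHt
    refine ⟨h1, h2.trans ?_⟩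
    rw [pow_succ (I.n + I.circuit.size + L + 1), ← mul_assoc]
    exact Nat.mul_le_mul (hI.bound_pow_le (by omega) _) (by omega)
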